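/- \textbf{Setting.} Let $T\ge 1$ and $\alpha>2$, $\mu>0$. For $i=1,\dots,T$ let $\phi_i$ be homogeneous Poisson point processes on $\mathbb{R}^2$ of intensities $\lambda_i>0$, and let $r^i_j$ be the distance from the origin to the $j$-th nearest point of $\phi_i$. Let $H^i_j$ ($1\le i\le T$, $j\ge1$) be i.i.d. exponential random variables with mean $\mu^{-1}$; the processes $\phi_1,\dots,\phi_T$ and the variables $H^i_j$ are all independent. Let $P_i>0$ (power), $N_0^i\ge 0$ (noise), $\beta_i>0$ (threshold), and put $$\mathrm{SINR}^{i,j}=\frac{P_iH^i_j(r^i_j)^{-\alpha}}{N_0^i+\sum_{k\ne j}P_iH^i_k(r^i_k)^{-\alpha}} .$$ A max-ratio policy selects, as a measurable function of the ratios $(r^i_2/r^i_1)_{i\le T}$, an index $i^*\in\arg\max_{i}\, r_2^i/r_1^i$, and then the nearest point ($j^*=1$) of $\phi_{i^*}$. Its coverage probability is $\mathcal{R}^{cp}=\mathbb{E}[\mathbf{1}(\mathrm{SINR}^{i^*,1}\ge\beta_{i^*})]$ and its average achievable rate is $\mathcal{R}^{r}=\mathbb{E}[\log_2(1+\mathrm{SINR}^{i^*,1})]$.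 For $\beta>0$ and $0<r_1\le r_2$ put $$c_p(1;[r_1,r_2],\lambda,P,N_0,\beta)=e^{-\mu\beta N_0r_1^{\alpha}P^{-1}}\,\frac{1}{1+\beta(r_1/r_2)^{\alpha}}\,\exp\Big(-2\pi\lambda\int_{r_2}^{\infty}\frac{u\,du}{1+\beta^{-1}(u/r_1)^{\alpha}}\Big),$$ and for $t\ge 1$ $$c_p\Big(1;\tfrac{r_2}{r_1}=t,\lambda,P,N_0,\beta\Big)=\int_0^\infty c_p(1;[u,ut],\lambda,P,N_0,\beta)\;2(\pi\lambda)^2u^3t^4e^{-\lambda\pi(ut)^2}\,du .$$ \textbf{Statement.} For every max-ratio policy the following hold. (a) Almost surely $\sum_{k}P_iH^i_k(r^i_k)^{-\alpha}<\infty$ for each $i$. For every $i$ and every $\beta>0$, almost surely $$\mathbb{P}[\mathrm{SINR}^{i,1}\ge\beta\mid r^i_1,r^i_2]=c_p(1;[r^i_1,r^i_2],\lambda_i,P_i,N_0^i,\beta).$$ Given $r^i_2/r^i_1=t$, the distance $r^i_1$ has density $2(\pi\lambda_i)^2u^3t^4e^{-\lambda_i\pi(ut)^2}$ in $u>0$ for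 almost every $t$ with respect to the law of $r^i_2/r^i_1$, and almost surely $$\mathbb{P}\big[\mathrm{SINR}^{i,1}\ge\beta\mid r^i_2/r^i_1\big]=c_p\Big(1;\tfrac{r_2}{r_1}=\tfrac{r^i_2}{r^i_1},\lambda_i,P_i,N_0^i,\beta\Big).$$ (b) The coverage probability is $$\mathcal{R}^{cp}=2\sum_{i=1}^{T}\int_{t\ge 1}c_p\Big(1;\tfrac{r_2}{r_1}=t,\lambda_i,P_i,N_0^i,\beta_i\Big)\frac{1}{t^3}\Big(1-\frac1{t^2}\Big)^{T-1}dt .$$ (c) The random variable $\log_2(1+\mathrm{SINR}^{i^*,1})$ is integrable and $$\mathcal{R}^{r}=2\sum_{i=1}^{T}\int_{v\ge 0}\int_{t\ge 1}c_p\Big(1;\tfrac{r_2}{r_1}=t,\lambda_i,P_i,N_0^i,2^v-1\Big)\frac{1}{t^3}\Big(1-\frac1{t^2}\Big)^{T-1}dt\,dv .$$ The integrals in (b) and (c) converge absolutely. -/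

import Mathlib

open MeasureTheory ProbabilityTheory Set

noncomputable section

namespace MaxRatio

/-- The plane in which the base stations are located. -/
abbrev Plane : Type := EuclideanSpace ℝ (Fin 2)

/-- The number of points of the random set `Φ` in `B`. -/
def count {Ω : Type*} (Φ : Ω → Set Plane) (B : Set Plane) (ω : Ω) : ℕ∞ :=
  (Φ ω ∩ B).encard

/-- The σ-algebra generated by a random set of points, i.e. by all its counting variables. -/
abbrev pointSigma {Ω : Type*} (Φ : Ω → Set Plane) : MeasurableSpace Ω :=
  ⨆ B : {B : Set Plane // MeasurableSet B},
    MeasurableSpace.comap (count Φ B.1) inferInstance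

/-- `Φ` is a homogeneous Poisson point process of intensity `lam` on the plane (regarded as a
random locally finite set of points). -/
structure IsPoissonPointProcess {Ω : Type*} [MeasurableSpace Ω] (P : Measure Ω)
    (Φ : Ω → Set Plane) (lam : ℝ) : Prop where
  locallyFinite : ∀ ω, ∀ R : ℝ, (Φ ω ∩ Metric.closedBall 0 R).Finite
  measurable_count : ∀ B, MeasurableSet B → Measurable (count Φ B)
  law_count : ∀ B, MeasurableSet B → volume B ≠ ⊤ →
    P.map (count Φ B) =
      (poissonMeasure (lam.toNNReal * (volume B).toNNReal)).map (fun n : ℕ => (n : ℕ∞))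
  indep_count : ∀ (n : ℕ) (B : Fin n → Set Plane), (∀ k, MeasurableSet (B k)) →
    Pairwise (fun k l => Disjoint (B k) (B l)) → iIndepFun (fun k => count Φ (B k)) P

/-- Distance from the origin to the nearest (`j = 0`), second nearest (`j = 1`), ... point of
`Φ ω`: the least radius of a closed ball around the origin that holds at least `j + 1` points. -/
def nthDist {Ω : Type*} (Φ : Ω → Set Plane) (j : ℕ) (ω : Ω) : ℝ :=
  sInf {R : ℝ | 0 ≤ R ∧ ((j + 1 : ℕ) : ℕ∞) ≤ count Φ (Metric.closedBall 0 R) ω}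

/-- The ratio of the distances to the second nearest and to the nearest point. -/
def ratio {Ω : Type*} (Φ : Ω → Set Plane) (ω : Ω) : ℝ :=
  nthDist Φ 1 ω / nthDist Φ 0 ω

/-- A network of `T` technologies: independent homogeneous Poisson point processes `Φ i` of
intensity `lam i`, with i.i.d. fading coefficients `H i j` (the one of the `(j+1)`-st nearest
base station of technology `i`), exponential with mean `mu⁻¹` and independent of the point
processes. -/
structure IsPoissonNetwork {Ω : Type*} [MeasurableSpace Ω] (P : Measure Ω) {T : ℕ}
    (Φ : Fin T → Ω → Set Plane) (H : Fin T → ℕ → Ω → ℝ) (lam : Fin T → ℝ) (mu : ℝ) : Prop where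
  poisson : ∀ i, IsPoissonPointProcess P (Φ i) (lam i)
  measurable_fading : ∀ i j, Measurable (H i j)
  law_fading : ∀ i j, P.map (H i j) = expMeasure mu
  indep : iIndep (Sum.elim (fun i : Fin T => pointSigma (Φ i))
    (fun ij : Fin T × ℕ => MeasurableSpace.comap (H ij.1 ij.2) inferInstance)) P

/-- The power received at the origin from the `(j+1)`-st nearest point, with transmission power
`pow`, fading coefficients `H` and path loss `r ↦ r ^ (-α)`. -/
def receivedPower {Ω : Type*} (Φ : Ω → Set Plane) (H : ℕ → Ω → ℝ) (α pow : ℝ) (j : ℕ)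
    (ω : Ω) : ℝ :=
  pow * H j ω * nthDist Φ j ω ^ (-α)

/-- Signal to interference plus noise ratio at the origin when served by the `(j+1)`-st nearest
base station. -/
def sinr {Ω : Type*} (Φ : Ω → Set Plane) (H : ℕ → Ω → ℝ) (α pow noise : ℝ) (j : ℕ)
    (ω : Ω) : ℝ :=
  receivedPower Φ H α pow j ω /
    (noise + ∑' k : {k : ℕ // k ≠ j}, receivedPower Φ H α pow k.1 ω)

/-- A max-ratio association policy: it only uses the information generated by the ratios of the
technologies, selects a technology with the largest ratio, and the nearest base station in it. -/
structure IsMaxRatioPolicy {Ω : Type*} {T : ℕ} (Φ : Fin T → Ω → Set Plane)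
    (π : Ω → Fin T × ℕ) : Prop where
  measurable : Measurable[⨆ i, MeasurableSpace.comap (ratio (Φ i)) inferInstance] π
  maximal : ∀ ω i, ratio (Φ i) ω ≤ ratio (Φ (π ω).1) ω
  nearest : ∀ ω, (π ω).2 = 0

/-- The performance metric whose mean is the coverage probability at threshold `β`. -/
def coverageMetric (β x : ℝ) : ℝ := (Ici β).indicator (fun _ => 1) x

/-- The performance metric whose mean is the average achievable rate. -/
def rateMetric (x : ℝ) : ℝ := Real.logb 2 (1 + x)

/-- The performance metrics `p i` evaluated at the SINR that the policy `π` achieves. -/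
def achieved {Ω : Type*} {T : ℕ} (Φ : Fin T → Ω → Set Plane) (H : Fin T → ℕ → Ω → ℝ)
    (α : ℝ) (pow noise : Fin T → ℝ) (p : Fin T → ℝ → ℝ) (π : Ω → Fin T × ℕ) (ω : Ω) : ℝ :=
  p (π ω).1 (sinr (Φ (π ω).1) (H (π ω).1) α (pow (π ω).1) (noise (π ω).1) (π ω).2 ω)

/-- The performance of the policy `π`: its expected performance metric. -/
def performance {Ω : Type*} [MeasurableSpace Ω] (P : Measure Ω) {T : ℕ}
    (Φ : Fin T → Ω → Set Plane) (H : Fin T → ℕ → Ω → ℝ)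
    (α : ℝ) (pow noise : Fin T → ℝ) (p : Fin T → ℝ → ℝ) (π : Ω → Fin T × ℕ) : ℝ :=
  ∫ ω, achieved Φ H α pow noise p π ω ∂P

/-- The two-distance coverage formula. -/
def coverTwo (α mu lam pow noise β r₁ r₂ : ℝ) : ℝ :=
  Real.exp (-(mu * β * noise * r₁ ^ α * pow⁻¹)) * (1 / (1 + β * (r₁ / r₂) ^ α)) *
    Real.exp (-(2 * Real.pi * lam * ∫ u in Ioi r₂, 1 / (1 + β⁻¹ * (u / r₁) ^ α) * u))

/-- The density in `u` of the nearest distance given that the ratio equals `t`. -/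
def nearestDensity (lam t u : ℝ) : ℝ :=
  2 * (Real.pi * lam) ^ 2 * u ^ 3 * t ^ 4 * Real.exp (-(lam * Real.pi * (u * t) ^ 2))

/-- The coverage formula given that the ratio equals `t`. -/
def coverRatio (α mu lam pow noise β t : ℝ) : ℝ :=
  ∫ u in Ioi (0 : ℝ), coverTwo α mu lam pow noise β u (u * t) * nearestDensity lam t u

/-- The integrand of the max-ratio formulas: the coverage formula given that the ratio equals
`t`, times `t⁻³ (1 - t⁻²) ^ (T - 1)`. -/
def maxRatioIntegrand (T : ℕ) (α mu lam pow noise β t : ℝ) : ℝ :=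
  coverRatio α mu lam pow noise β t * (1 / t ^ 3) * (1 - 1 / t ^ 2) ^ (T - 1)

end MaxRatio

end

open scoped ENNReal NNReal

noncomputable section

open Filter Topology

namespace MaxRatio

/-! Everything rests on the Laplace functional of a Poisson process, E exp(-∑ f(x)) = exp(-λ ∫ (1 -
e^{-f})), proved from the Poisson counts (`IsPoissonPointProcess.laplace`) and read off in the
ordered distances r₀ ≤ r₁ ≤ … (`laplace_nthDist`), whose radial intensity is ρ(u) = 2πλu.
Conditioning on distances is replaced throughout by choosing weights. An infinite weight on a ball
forbids points there and yields the law of r₀ weighted by e^{-∑ h(r_k)}. A steep ramp below b,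
applied to all points but the nearest, forces r₁ ≥ b and yields the joint law of (r₀, r₁) weighted
by the points other than the nearest, with density ρ(x) e^{-h(y)} V_h(y) ρ(y) on 0 < x < y, where
V_h is `voidWeight` (`map_pair`).

Exponential fading fits this scheme. Averaging e^{-θ H r^{-α}} over H gives 1/(1 + (θ/μ) r^{-α}),
which is e^{-h(r)} for `fadingWeight`. For α > 2 this is an admissible weight, so the Laplace
transform of the interference I, jointly with (r₀, r₁), is known. Letting θ → 0 shows I < ∞ almost
surely. The SINR is at least b exactly when H₀ ≥ b r₀^α (N/P + I); integrating out the independent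
H₀ gives exp(-μ b r₀^α (N/P + I)), a Laplace transform at the random argument θ = μ b r₀^α. Simple
functions of (r₀, r₁) reduce this to constant θ, and the resulting density is `coverTwo` times the
unweighted one (`exp_neg_mul_pairDensity`). This is the conditional probability given both
distances.

The substitution y = x t factorises the unweighted density into 2 t⁻³ and `nearestDensity`. Hence
the ratio has law 2 t⁻³ dt on (1, ∞), whatever the intensity, and averaging `coverTwo` over the
second factor gives the conditional probability given the ratio.

The ratios of different technologies are independent with the same atomless law, so ties have
probability zero and selecting i means that all other ratios are at most that of i. Given the ratio
t of i, this has probability (1 - t⁻²)^(T-1), and coverage by i depends on technology i only;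
integration gives the coverage formula. The rate is the layer-cake integral of coverage at the
thresholds 2^v - 1; a bound of order 2^{-v/α} t⁻² on the integrand gives absolute convergence. -/

/-! ### The exponential on `[0, ∞]` and the Poisson transform -/

/-- The function `x ↦ e⁻ˣ` on `[0, ∞]`. -/
def expNeg (x : ℝ≥0∞) : ℝ≥0∞ := (EReal.exp (x : EReal))⁻¹

@[simp] lemma expNeg_zero : expNeg 0 = 1 := by simp [expNeg]

@[simp] lemma expNeg_top : expNeg ⊤ = 0 := by simp [expNeg]

lemma expNeg_ofReal {x : ℝ} (hx : 0 ≤ x) :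
    expNeg (ENNReal.ofReal x) = ENNReal.ofReal (Real.exp (-x)) := by
  rw [expNeg, EReal.coe_ennreal_ofReal, max_eq_left hx, EReal.exp_coe,
    ← ENNReal.ofReal_inv_of_pos (Real.exp_pos x), Real.exp_neg]

lemma one_le_exp_coe (x : ℝ≥0∞) : 1 ≤ EReal.exp (x : EReal) := by
  rw [← EReal.exp_zero]
  exact EReal.exp_monotone (EReal.coe_ennreal_nonneg x)

lemma expNeg_add (x y : ℝ≥0∞) : expNeg (x + y) = expNeg x * expNeg y := by
  have hx := (zero_lt_one.trans_le (one_le_exp_coe x)).ne'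
  have hy := (zero_lt_one.trans_le (one_le_exp_coe y)).ne'
  rw [expNeg, EReal.coe_ennreal_add, EReal.exp_add, ENNReal.mul_inv (Or.inl hx) (Or.inr hy)]
  rfl

lemma continuous_expNeg : Continuous expNeg :=
  continuous_inv.comp (ENNReal.continuous_exp.comp continuous_coe_ennreal_ereal)

@[fun_prop] lemma measurable_expNeg : Measurable expNeg := continuous_expNeg.measurable

lemma expNeg_le_one (x : ℝ≥0∞) : expNeg x ≤ 1 := by
  rw [expNeg, ENNReal.inv_le_one]
  exact one_le_exp_coe x

lemma antitone_expNeg : Antitone expNeg := fun x y h => by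
  rw [expNeg, expNeg, ENNReal.inv_le_inv]
  exact EReal.exp_monotone (EReal.coe_ennreal_le_coe_ennreal_iff.2 h)

lemma expNeg_sum {ι : Type*} (s : Finset ι) (f : ι → ℝ≥0∞) :
    expNeg (∑ i ∈ s, f i) = ∏ i ∈ s, expNeg (f i) := by
  classical
  induction s using Finset.induction_on with
  | empty => simp
  | insert a s ha ih => rw [Finset.sum_insert ha, Finset.prod_insert ha, expNeg_add, ih]

/-- The factor e^{-yn} only replaces v by v e^{-y} in the Poisson series, which sums to e^{-v} exp(v
e^{-y}). -/
lemma lintegral_expNeg_poisson (v : ℝ≥0) (y : ℝ≥0) :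
    ∫⁻ n, expNeg (y * n) ∂(poissonMeasure v) = expNeg (v * (1 - expNeg y)) := by
  have hy : expNeg (y : ℝ≥0∞) = ENNReal.ofReal (Real.exp (-y)) := by
    rw [← expNeg_ofReal y.coe_nonneg]; simp
  have hle : Real.exp (-(y : ℝ)) ≤ 1 := Real.exp_le_one_iff.2 (by simp)
  have hR : expNeg (v * (1 - expNeg y)) =
      ENNReal.ofReal (Real.exp (-(v * (1 - Real.exp (-y))))) := by
    rw [← expNeg_ofReal (mul_nonneg v.coe_nonneg (sub_nonneg.2 hle)), ENNReal.ofReal_mul v.coe_nonneg,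
      ENNReal.ofReal_sub _ (Real.exp_pos _).le, hy]
    simp
  rw [hR, poissonMeasure, lintegral_sum_measure]
  have h1 : ∀ n : ℕ, ∫⁻ m, expNeg (y * (m : ℕ))
        ∂(ENNReal.ofReal (Real.exp (-v) * v ^ n / (n.factorial)) • Measure.dirac n) =
      ENNReal.ofReal (Real.exp (-v) * ((v * Real.exp (-y)) ^ n / (n.factorial))) := by
    intro n
    rw [lintegral_smul_measure, lintegral_dirac, smul_eq_mul]
    have : expNeg ((y : ℝ≥0∞) * n) = ENNReal.ofReal (Real.exp (-(y * n))) := by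
      rw [← expNeg_ofReal (by positivity), ENNReal.ofReal_mul y.coe_nonneg]; simp
    rw [this, ← ENNReal.ofReal_mul (by positivity)]
    congr 1
    rw [mul_pow, ← Real.exp_nat_mul]
    have : (n : ℝ) * -y = -(y * n) := by ring
    rw [this]; ring
  simp_rw [h1]
  have hs : HasSum (fun n : ℕ => Real.exp (-v) * ((v * Real.exp (-y)) ^ n / (n.factorial)))
      (Real.exp (-v) * Real.exp (v * Real.exp (-y))) := by
    rw [Real.exp_eq_exp_ℝ]
    exact (NormedSpace.expSeries_div_hasSum_exp (v * NormedSpace.exp (-(y : ℝ)))).mul_left _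
  rw [← ENNReal.ofReal_tsum_of_nonneg (fun n => by positivity) hs.summable, hs.tsum_eq,
    ← Real.exp_add]
  congr 2; ring

/-! ### The Laplace functional of a Poisson process -/

/-- The counting measure of the random set `Φ ω`. -/
def countingMeasure {Ω : Type*} (Φ : Ω → Set Plane) (ω : Ω) : Measure Plane :=
  Measure.count.restrict (Φ ω)

/-- Local finiteness enters through measurability: `Φ ω` is a countable union of finite sets, hence
a Borel set. -/
lemma countingMeasure_apply {Ω : Type*} {Φ : Ω → Set Plane}
    (hΦ : ∀ ω, ∀ R : ℝ, (Φ ω ∩ Metric.closedBall 0 R).Finite)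
    (ω : Ω) {B : Set Plane} (hB : MeasurableSet B) :
    countingMeasure Φ ω B = (count Φ B ω : ℝ≥0∞) := by
  have hc : (Φ ω).Countable := by
    have : Φ ω = ⋃ n : ℕ, Φ ω ∩ Metric.closedBall 0 n := by
      rw [← inter_iUnion, Metric.iUnion_closedBall_nat, inter_univ]
    rw [this]
    exact countable_iUnion fun n => (hΦ ω n).countable
  rw [countingMeasure, Measure.restrict_apply hB, Measure.count_apply (hB.inter hc.measurableSet),
    inter_comm, count]

section Laplace

variable {Ω : Type*} [MeasurableSpace Ω] {P : Measure Ω} {Φ : Ω → Set Plane} {lam : ℝ}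

lemma IsPoissonPointProcess.lintegral_expNeg_count (h : IsPoissonPointProcess P Φ lam)
    {B : Set Plane} (hB : MeasurableSet B) (hvol : volume B ≠ ⊤) (y : ℝ≥0) :
    ∫⁻ ω, expNeg (y * (count Φ B ω : ℝ≥0∞)) ∂P =
      expNeg ((1 - expNeg y) * (ENNReal.ofReal lam * volume B)) := by
  have hm : Measurable fun n : ℕ∞ => expNeg (y * (n : ℝ≥0∞)) := .of_discrete
  rw [← lintegral_map (f := fun n : ℕ∞ => expNeg (y * (n : ℝ≥0∞))) hm (h.measurable_count B hB),
    h.law_count B hB hvol, lintegral_map hm .of_discrete]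
  have := lintegral_expNeg_poisson (lam.toNNReal * (volume B).toNNReal) y
  simp only [ENat.toENNReal_coe]
  rw [this, ENNReal.coe_mul, ENNReal.coe_toNNReal hvol, mul_comm]
  rfl

/-- The counts of the level sets are independent because the level sets are disjoint, so the
expectation is a product of Poisson transforms. -/
lemma IsPoissonPointProcess.laplace_simpleFunc (h : IsPoissonPointProcess P Φ lam)
    (f : SimpleFunc Plane ℝ≥0∞) (hfin : ∀ x, f x ≠ ⊤) (hsupp : f.FinMeasSupp volume) :
    ∫⁻ ω, expNeg (∫⁻ x, f x ∂(countingMeasure Φ ω)) ∂P =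
      expNeg (ENNReal.ofReal lam * ∫⁻ x, (1 - expNeg (f x))) := by
  classical
  -- The value 0 is left out: its level set has infinite volume, so the law of its count is not
  -- available, and it contributes nothing to either side.
  set s := f.range.filter (· ≠ 0) with hs
  have hL : ∀ ω, ∫⁻ x, f x ∂(countingMeasure Φ ω) =
      ∑ y ∈ s, y * (count Φ (f ⁻¹' {y}) ω : ℝ≥0∞) := by
    intro ω
    rw [SimpleFunc.lintegral_eq_lintegral, SimpleFunc.lintegral, hs, Finset.sum_filter]
    refine Finset.sum_congr rfl fun y _ => ?_
    rw [countingMeasure_apply h.locallyFinite ω (f.measurableSet_fiber y)]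
    split_ifs with hy
    · rfl
    · rw [not_not.1 hy, zero_mul]
  have hR : ENNReal.ofReal lam * ∫⁻ x, (1 - expNeg (f x)) =
      ∑ y ∈ s, (1 - expNeg y) * (ENNReal.ofReal lam * volume (f ⁻¹' {y})) := by
    have : ∫⁻ x, (1 - expNeg (f x)) = (f.map fun y => 1 - expNeg y).lintegral volume := by
      rw [← SimpleFunc.lintegral_eq_lintegral]; rfl
    rw [this, SimpleFunc.map_lintegral, hs, Finset.sum_filter, Finset.mul_sum]
    refine Finset.sum_congr rfl fun y _ => ?_
    split_ifs with hy
    · ring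
    · rw [not_not.1 hy]; simp
  rw [hR, expNeg_sum]
  simp_rw [hL, expNeg_sum]
  -- `indep_count` speaks of families indexed by `Fin n`, so the values are enumerated.
  set e := s.equivFin.symm
  have hprod : ∀ g : ℝ≥0∞ → ℝ≥0∞, ∏ y ∈ s, g y = ∏ i, g (e i) := fun g => by
    rw [← Finset.prod_coe_sort, ← Equiv.prod_comp e]
  simp_rw [hprod]
  have hind : iIndepFun (fun i ω => expNeg ((e i : ℝ≥0∞) *
      (count Φ (f ⁻¹' {(e i : ℝ≥0∞)}) ω : ℝ≥0∞))) P := by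
    refine (h.indep_count _ (fun i => f ⁻¹' {(e i : ℝ≥0∞)})
      (fun i => f.measurableSet_fiber _) ?_).comp
      (fun i (n : ℕ∞) => expNeg ((e i : ℝ≥0∞) * (n : ℝ≥0∞))) (fun i => .of_discrete)
    intro i j hij
    refine Disjoint.preimage _ ?_
    rw [disjoint_singleton]
    exact fun hc => hij (e.injective (Subtype.ext hc))
  have hms : ∀ i, Measurable fun ω => expNeg ((e i : ℝ≥0∞) *
      (count Φ (f ⁻¹' {(e i : ℝ≥0∞)}) ω : ℝ≥0∞)) := fun i =>
    (Measurable.of_discrete (f := fun n : ℕ∞ => expNeg ((e i : ℝ≥0∞) * (n : ℝ≥0∞)))).comp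
      (h.measurable_count _ (f.measurableSet_fiber _))
  rw [lintegral_prod_eq_prod_lintegral_of_indepFun Finset.univ _ hind hms]
  refine Finset.prod_congr rfl fun i _ => ?_
  have hi := (Finset.mem_filter.1 (e i).2)
  obtain ⟨x, hx⟩ := SimpleFunc.mem_range.1 hi.1
  have hne : (e i : ℝ≥0∞) ≠ ⊤ := hx ▸ hfin x
  lift (e i : ℝ≥0∞) to ℝ≥0 using hne with y hy
  exact h.lintegral_expNeg_count (f.measurableSet_fiber _)
    (hsupp.meas_preimage_singleton_ne_zero (by simpa using hi.2)).ne y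

lemma IsPoissonPointProcess.measurable_lintegral_countingMeasure
    (h : IsPoissonPointProcess P Φ lam) {f : Plane → ℝ≥0∞} (hf : Measurable f) :
    Measurable fun ω => ∫⁻ x, f x ∂(countingMeasure Φ ω) := by
  have : Measurable (countingMeasure Φ) := by
    refine Measure.measurable_of_measurable_coe _ fun B hB => ?_
    simp_rw [countingMeasure_apply h.locallyFinite _ hB]
    exact Measurable.comp .of_discrete (h.measurable_count B hB)
  exact (Measure.measurable_lintegral hf).comp this

/-- The Laplace functional of a Poisson point process. -/
lemma IsPoissonPointProcess.laplace [IsProbabilityMeasure P] (h : IsPoissonPointProcess P Φ lam)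
    {f : Plane → ℝ≥0∞} (hf : Measurable f) :
    ∫⁻ ω, expNeg (∫⁻ x, f x ∂(countingMeasure Φ ω)) ∂P =
      expNeg (ENNReal.ofReal lam * ∫⁻ x, (1 - expNeg (f x))) := by
  let B : ℕ → Set Plane := fun n => Metric.closedBall 0 n
  have hB : ∀ n, MeasurableSet (B n) := fun n => Metric.isClosed_closedBall.measurableSet
  -- The cut-off to balls gives the support finite volume; `eapprox` supplies finite values.
  let F : ℕ → SimpleFunc Plane ℝ≥0∞ := fun n => (SimpleFunc.eapprox f n).restrict (B n)
  have hF : ∀ n x, F n x = (B n).indicator (SimpleFunc.eapprox f n) x := fun n x => by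
    rw [SimpleFunc.restrict_apply _ (hB n)]
  have hmono : ∀ x, Monotone fun n => F n x := by
    intro x m n hmn
    simp only [hF]
    refine (indicator_le_indicator (SimpleFunc.monotone_eapprox f hmn x)).trans ?_
    exact indicator_le_indicator_of_subset
      (Metric.closedBall_subset_closedBall (by exact_mod_cast hmn)) (fun _ => zero_le) x
  have hlim : ∀ x, Tendsto (fun n => F n x) atTop (𝓝 (f x)) := by
    intro x
    have h1 : Tendsto (fun n => SimpleFunc.eapprox f n x) atTop (𝓝 (f x)) :=
      SimpleFunc.tendsto_eapprox hf x
    refine h1.congr' ?_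
    obtain ⟨N, hN⟩ := exists_nat_ge ‖x‖
    filter_upwards [eventually_ge_atTop N] with n hn
    rw [hF, indicator_of_mem]
    simp only [B, mem_closedBall_zero_iff]
    exact hN.trans (by exact_mod_cast hn)
  have hn : ∀ n, ∫⁻ ω, expNeg (∫⁻ x, F n x ∂(countingMeasure Φ ω)) ∂P =
      expNeg (ENNReal.ofReal lam * ∫⁻ x, (1 - expNeg (F n x))) := by
    intro n
    refine h.laplace_simpleFunc (F n) (fun x => ?_) ?_
    · rw [hF]
      by_cases hx : x ∈ B n
      · rw [indicator_of_mem hx]; exact (SimpleFunc.eapprox_lt_top f n x).ne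
      · rw [indicator_of_notMem hx]; exact ENNReal.zero_ne_top
    · rw [SimpleFunc.finMeasSupp_iff_support]
      refine (measure_mono (t := B n) fun x hx => ?_).trans_lt measure_closedBall_lt_top
      by_contra hxB
      exact hx (by rw [hF, indicator_of_notMem hxB])
  -- As `expNeg` is bounded by 1 and continuous up to infinity, dominated convergence applies even
  -- where the limiting sum over the points is infinite.
  have hL : Tendsto (fun n => ∫⁻ ω, expNeg (∫⁻ x, F n x ∂(countingMeasure Φ ω)) ∂P) atTop
      (𝓝 (∫⁻ ω, expNeg (∫⁻ x, f x ∂(countingMeasure Φ ω)) ∂P)) := by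
    refine tendsto_lintegral_of_dominated_convergence (fun _ => 1)
      (fun n => measurable_expNeg.comp
        (h.measurable_lintegral_countingMeasure (F n).measurable))
      (fun n => ae_of_all _ fun ω => expNeg_le_one _) (by simp) (ae_of_all _ fun ω => ?_)
    exact (continuous_expNeg.tendsto _).comp (lintegral_tendsto_of_tendsto_of_monotone
      (fun n => (F n).measurable.aemeasurable) (ae_of_all _ hmono) (ae_of_all _ hlim))
  have hR : Tendsto (fun n => expNeg (ENNReal.ofReal lam * ∫⁻ x, (1 - expNeg (F n x)))) atTop
      (𝓝 (expNeg (ENNReal.ofReal lam * ∫⁻ x, (1 - expNeg (f x))))) := by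
    refine (continuous_expNeg.tendsto _).comp (ENNReal.Tendsto.const_mul ?_
      (Or.inr ENNReal.ofReal_ne_top))
    refine lintegral_tendsto_of_tendsto_of_monotone (fun n => ?_)
      (ae_of_all _ fun x m n hmn => ?_) (ae_of_all _ fun x => ?_)
    · exact (measurable_const.sub (measurable_expNeg.comp (F n).measurable)).aemeasurable
    · exact tsub_le_tsub_left (antitone_expNeg (hmono x hmn)) 1
    · exact ENNReal.Tendsto.sub tendsto_const_nhds
        ((continuous_expNeg.tendsto _).comp (hlim x)) (Or.inl ENNReal.one_ne_top)
  simp_rw [hn] at hL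
  exact tendsto_nhds_unique hL hR

end Laplace

/-! ### Ordered distances and ball counts -/

section Distances

variable {Ω : Type*} {Φ : Ω → Set Plane}

lemma count_mono (ω : Ω) {A B : Set Plane} (h : A ⊆ B) : count Φ A ω ≤ count Φ B ω :=
  encard_le_encard (inter_subset_inter_right _ h)

lemma nthDist_nonneg (k : ℕ) (ω : Ω) : 0 ≤ nthDist Φ k ω :=
  Real.sInf_nonneg fun _ h => h.1

lemma exists_le_count_of_infinite {ω : Ω} (hinf : (Φ ω).Infinite) (k : ℕ) :
    ∃ n : ℕ, ((k : ℕ) : ℕ∞) ≤ count Φ (Metric.closedBall 0 n) ω := by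
  obtain ⟨t, ht, hcard⟩ := hinf.exists_subset_card_eq k
  obtain ⟨R, hR⟩ := t.finite_toSet.isBounded.subset_closedBall (0 : Plane)
  obtain ⟨n, hn⟩ := exists_nat_ge R
  refine ⟨n, ?_⟩
  rw [← hcard, ← encard_coe_eq_coe_finsetCard]
  exact encard_le_encard (subset_inter ht
    (hR.trans (Metric.closedBall_subset_closedBall hn)))

/-- The infimum is attained: by local finiteness there is a gap just beyond it that contains no norm
of a point, so a slightly larger ball holds no further points. -/
lemma count_sInf_ge (hΦ : ∀ ω, ∀ R : ℝ, (Φ ω ∩ Metric.closedBall 0 R).Finite) (ω : Ω) (k : ℕ)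
    (hne : {R : ℝ | 0 ≤ R ∧ ((k + 1 : ℕ) : ℕ∞) ≤
      count Φ (Metric.closedBall 0 R) ω}.Nonempty) :
    ((k + 1 : ℕ) : ℕ∞) ≤ count Φ (Metric.closedBall 0 (nthDist Φ k ω)) ω := by
  set r := nthDist Φ k ω with hr
  have hev : ∀ᶠ R in 𝓝[>] r, ∀ x ∈ Φ ω ∩ Metric.closedBall 0 (r + 1), r < ‖x‖ → R < ‖x‖ := by
    rw [(hΦ ω (r + 1)).eventually_all]
    intro x _
    by_cases h : r < ‖x‖
    · filter_upwards [mem_nhdsWithin_of_mem_nhds (Iio_mem_nhds h)] with R hR _ using hR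
    · exact Eventually.of_forall fun _ h' => (h h').elim
  have hev2 : ∀ᶠ R in 𝓝[>] r, R < r + 1 :=
    mem_nhdsWithin_of_mem_nhds (Iio_mem_nhds (lt_add_one r))
  obtain ⟨R, hR, hR1, hRr⟩ := (hev.and (hev2.and self_mem_nhdsWithin)).exists
  obtain ⟨R', hR'S, hR'⟩ := exists_lt_of_csInf_lt hne (show r < R from hRr)
  refine hR'S.2.trans (encard_le_encard fun x hx => ⟨hx.1, ?_⟩)
  have hx2 : ‖x‖ ≤ R' := by simpa using hx.2
  rw [mem_closedBall_zero_iff]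
  by_contra hcon
  have := hR x ⟨hx.1, by simpa using by linarith⟩ (not_le.1 hcon)
  linarith

/-- The link through which statements on distances become statements on counts. Infinitely many
points are assumed so that the infimum is never the default value `sInf ∅ = 0`. -/
lemma nthDist_le_iff (hΦ : ∀ ω, ∀ R : ℝ, (Φ ω ∩ Metric.closedBall 0 R).Finite) {ω : Ω}
    (hinf : (Φ ω).Infinite) (k : ℕ) (R : ℝ) :
    nthDist Φ k ω ≤ R ↔ ((k + 1 : ℕ) : ℕ∞) ≤ count Φ (Metric.closedBall 0 R) ω := by
  obtain ⟨n, hn⟩ := exists_le_count_of_infinite hinf (k + 1)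
  constructor
  · intro h
    exact (count_sInf_ge hΦ ω k ⟨n, by positivity, hn⟩).trans
      (count_mono ω (Metric.closedBall_subset_closedBall h))
  · intro h
    have hR : 0 ≤ R := by
      by_contra hR
      rw [Metric.closedBall_eq_empty.2 (not_le.1 hR)] at h
      simp [count] at h
    exact csInf_le ⟨0, fun _ h => h.1⟩ ⟨hR, h⟩

lemma monotone_nthDist (hΦ : ∀ ω, ∀ R : ℝ, (Φ ω ∩ Metric.closedBall 0 R).Finite) {ω : Ω}
    (hinf : (Φ ω).Infinite) : Monotone fun k => nthDist Φ k ω := fun j k hjk => by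
  rw [nthDist_le_iff hΦ hinf]
  refine le_trans ?_ ((nthDist_le_iff hΦ hinf k _).1 le_rfl)
  exact_mod_cast Nat.succ_le_succ hjk

/-- Only the ball counts are assumed measurable, so that the lemma also applies to the σ-algebra
`pointSigma Φ`, on which independence is stated. -/
lemma measurable_nthDist [MeasurableSpace Ω]
    (hc : ∀ R : ℝ, Measurable (count Φ (Metric.closedBall 0 R))) (k : ℕ) :
    Measurable (nthDist Φ k) := by
  refine measurable_of_Iio fun R => ?_
  rcases le_or_gt R 0 with hR | hR
  · convert MeasurableSet.empty
    exact eq_empty_of_forall_notMem fun ω h =>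
      (h.trans_le hR).not_ge (nthDist_nonneg k ω)
  -- Counts are monotone in the radius, so rational radii suffice. The second set collects the
  -- outcomes with at most `k` points, where the distance is `sInf ∅ = 0 < R`.
  have hs : nthDist Φ k ⁻¹' Iio R =
      (⋃ q : ℚ, if (0 : ℝ) ≤ q ∧ (q : ℝ) < R then
        {ω | ((k + 1 : ℕ) : ℕ∞) ≤ count Φ (Metric.closedBall 0 (q : ℝ)) ω} else ∅) ∪
      ⋂ n : ℕ, {ω | ((k + 1 : ℕ) : ℕ∞) ≤ count Φ (Metric.closedBall 0 (n : ℝ)) ω}ᶜ := by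
    ext ω
    simp only [mem_preimage, mem_Iio, mem_union, mem_iUnion, mem_iInter, mem_compl_iff,
      mem_ofPred_eq]
    constructor
    · intro h
      by_cases hne : {R : ℝ | 0 ≤ R ∧ ((k + 1 : ℕ) : ℕ∞) ≤
        count Φ (Metric.closedBall 0 R) ω}.Nonempty
      · left
        obtain ⟨R', hR', hlt⟩ := exists_lt_of_csInf_lt hne h
        obtain ⟨q, hq1, hq2⟩ := exists_rat_btwn hlt
        refine ⟨q, ?_⟩
        rw [if_pos ⟨hR'.1.trans hq1.le, hq2⟩]
        exact hR'.2.trans (count_mono ω (Metric.closedBall_subset_closedBall hq1.le))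
      · exact Or.inr fun n hn => hne ⟨n, by positivity, hn⟩
    · rintro (⟨q, hq⟩ | h)
      · split_ifs at hq with hq'
        · have hmem : (q : ℝ) ∈ {R : ℝ | 0 ≤ R ∧ ((k + 1 : ℕ) : ℕ∞) ≤
              count Φ (Metric.closedBall 0 R) ω} := ⟨hq'.1, hq⟩
          exact (csInf_le ⟨0, fun _ h => h.1⟩ hmem).trans_lt hq'.2
        · exact hq.elim
      · have : {R : ℝ | 0 ≤ R ∧ ((k + 1 : ℕ) : ℕ∞) ≤
            count Φ (Metric.closedBall 0 R) ω} = ∅ := by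
          refine eq_empty_of_forall_notMem fun R' hR' => ?_
          obtain ⟨n, hn⟩ := exists_nat_ge R'
          exact h n (hR'.2.trans (count_mono ω (Metric.closedBall_subset_closedBall hn)))
        rw [nthDist, this, Real.sInf_empty]
        exact hR
  rw [hs]
  have hm : ∀ R : ℝ, MeasurableSet
      {ω | ((k + 1 : ℕ) : ℕ∞) ≤ count Φ (Metric.closedBall 0 R) ω} := fun R =>
    hc R (.of_discrete (s := Ici ((k + 1 : ℕ) : ℕ∞)))
  refine (MeasurableSet.iUnion fun q => ?_).union (MeasurableSet.iInter fun n => (hm n).compl)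
  split_ifs
  · exact hm q
  · exact MeasurableSet.empty

end Distances

/-! ### Radial images of the point process and of Lebesgue measure -/

lemma Real.measure_ext_of_Iic {μ ν : Measure ℝ} (hfin : ∀ n : ℕ, μ (Iic n) ≠ ⊤)
    (h : ∀ R, μ (Iic R) = ν (Iic R)) : μ = ν := by
  refine Measure.ext_of_generateFrom_of_iUnion (range Iic) (fun n : ℕ => Iic (n : ℝ))
    (borel_eq_generateFrom_Iic ℝ ▸ BorelSpace.measurable_eq) isPiSystem_Iic ?_
    (fun n => mem_range_self _) hfin ?_
  · exact eq_univ_of_forall fun x => mem_iUnion.2 (exists_nat_ge x)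
  · rintro _ ⟨R, rfl⟩; exact h R

/-- If the ball of radius R holds m points, then by `nthDist_le_iff` exactly the indices k < m have
distance at most R. Points with equal norm are thus counted with the right multiplicity. -/
lemma map_norm_countingMeasure {Ω : Type*} {Φ : Ω → Set Plane}
    (hΦ : ∀ ω, ∀ R : ℝ, (Φ ω ∩ Metric.closedBall 0 R).Finite) {ω : Ω}
    (hinf : (Φ ω).Infinite) :
    (countingMeasure Φ ω).map norm = Measure.sum fun k => Measure.dirac (nthDist Φ k ω) := by
  have hpre : ∀ R : ℝ, (norm ⁻¹' Iic R : Set Plane) = Metric.closedBall 0 R := fun R => by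
    ext x; simp
  have hL : ∀ R : ℝ, (countingMeasure Φ ω).map norm (Iic R) =
      (count Φ (Metric.closedBall 0 R) ω : ℝ≥0∞) := fun R => by
    rw [Measure.map_apply measurable_norm measurableSet_Iic, hpre,
      countingMeasure_apply hΦ ω Metric.isClosed_closedBall.measurableSet]
  have hcfin : ∀ R, ∃ n : ℕ, count Φ (Metric.closedBall 0 R) ω = n := fun R => by
    obtain ⟨n, hn⟩ := ENat.ne_top_iff_exists.1 (encard_ne_top_iff.2 (hΦ ω R))
    exact ⟨n, hn.symm⟩
  refine Real.measure_ext_of_Iic (fun n => ?_) fun R => ?_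
  · obtain ⟨m, hm⟩ := hcfin n
    rw [hL, hm]; simp
  · obtain ⟨m, hm⟩ := hcfin R
    rw [hL, hm, Measure.sum_apply _ measurableSet_Iic]
    have : ∀ k, Measure.dirac (nthDist Φ k ω) (Iic R) =
        if k ∈ Finset.range m then (1 : ℝ≥0∞) else 0 := fun k => by
      rw [Measure.dirac_apply' _ measurableSet_Iic, indicator_apply]
      have : nthDist Φ k ω ∈ Iic R ↔ k ∈ Finset.range m := by
        rw [mem_Iic, nthDist_le_iff hΦ hinf, hm, Finset.mem_range]
        exact_mod_cast Nat.succ_le_iff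
      simp only [this, Pi.one_apply]
    simp_rw [this]
    rw [tsum_eq_sum (s := Finset.range m) (fun k hk => by rw [if_neg hk]),
      Finset.sum_congr rfl (fun k hk => if_pos hk)]
    simp

lemma lintegral_norm_countingMeasure {Ω : Type*} {Φ : Ω → Set Plane}
    (hΦ : ∀ ω, ∀ R : ℝ, (Φ ω ∩ Metric.closedBall 0 R).Finite) {ω : Ω}
    (hinf : (Φ ω).Infinite) {h : ℝ → ℝ≥0∞} (hh : Measurable h) :
    ∫⁻ x, h ‖x‖ ∂(countingMeasure Φ ω) = ∑' k, h (nthDist Φ k ω) := by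
  rw [← lintegral_map hh measurable_norm, map_norm_countingMeasure hΦ hinf,
    lintegral_sum_measure]
  simp [lintegral_dirac' _ hh]

/-- Polar coordinates without a change of variables: the areas πR² of the discs determine the radial
measure. -/
lemma map_norm_volume : (volume : Measure Plane).map norm =
    (volume.restrict (Ioi 0)).withDensity fun u => ENNReal.ofReal (2 * Real.pi * u) := by
  have hpre : ∀ R : ℝ, (norm ⁻¹' Iic R : Set Plane) = Metric.closedBall 0 R := fun R => by
    ext x; simp
  refine Real.measure_ext_of_Iic (fun n => ?_) fun R => ?_
  · rw [Measure.map_apply measurable_norm measurableSet_Iic, hpre]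
    exact measure_closedBall_lt_top.ne
  · rw [Measure.map_apply measurable_norm measurableSet_Iic, hpre,
      EuclideanSpace.volume_closedBall_fin_two, withDensity_apply _ measurableSet_Iic,
      Measure.restrict_restrict measurableSet_Iic, inter_comm, Ioi_inter_Iic]
    rcases le_or_gt R 0 with hR | hR
    · rw [Ioc_eq_empty (not_lt.2 hR), ENNReal.ofReal_of_nonpos hR]; simp
    · rw [← ofReal_integral_eq_lintegral_ofReal]
      · rw [← intervalIntegral.integral_of_le hR.le, intervalIntegral.integral_const_mul,
          integral_id, ← ENNReal.ofReal_pow hR.le]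
        rw [← ENNReal.ofReal_mul (by positivity)]
        congr 1; ring
      · exact (by fun_prop : Continuous fun u : ℝ => 2 * Real.pi * u).integrableOn_Ioc
      · filter_upwards [ae_restrict_mem measurableSet_Ioc] with u hu
        have := hu.1.le
        have := Real.pi_pos
        positivity

/-- A point at the origin would make the path loss and the ratio default values. It is excluded
because the count of a null set is Poisson with mean 0. -/
lemma IsPoissonPointProcess.ae_zero_notMem {Ω : Type*} [MeasurableSpace Ω]
    {P : Measure Ω} {Φ : Ω → Set Plane} {lam : ℝ} (h : IsPoissonPointProcess P Φ lam) :
    ∀ᵐ ω ∂P, (0 : Plane) ∉ Φ ω := by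
  have hv : volume ({0} : Set Plane) = 0 := measure_singleton 0
  have h1 := h.law_count {0} (measurableSet_singleton 0) (by simp)
  have h2 : P.map (count Φ {0}) {0}ᶜ = 0 := by
    rw [h1, hv, Measure.map_apply .of_discrete (measurableSet_singleton _).compl]
    have h0 : ∀ n : ℕ, n ≠ 0 → poissonMeasure 0 {n} = 0 := fun n hn => by
      rw [poissonMeasure_singleton]; simp [hn]
    rw [ENNReal.toNNReal_zero, mul_zero]
    refine measure_mono_null (t := ⋃ n : {n : ℕ // n ≠ 0}, {n.1}) (fun n hn => ?_)
      (measure_iUnion_null fun n => h0 n.1 n.2)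
    exact mem_iUnion.2 ⟨⟨n, by simpa using hn⟩, rfl⟩
  rw [Measure.map_apply (h.measurable_count _ (measurableSet_singleton 0))
    (measurableSet_singleton _).compl] at h2
  have h3 : ∀ᵐ ω ∂P, ω ∉ count Φ {0} ⁻¹' {0}ᶜ := measure_eq_zero_iff_ae_notMem.1 h2
  filter_upwards [h3] with ω hω hmem
  refine hω ?_
  simp only [mem_preimage, mem_compl_iff, mem_singleton_iff, count, encard_eq_zero]
  exact Set.Nonempty.ne_empty ⟨0, hmem, rfl⟩

/-! ### Almost sure properties and the Laplace functional of the distances -/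

section Poisson

variable {Ω : Type*} [MeasurableSpace Ω] {P : Measure Ω} [IsProbabilityMeasure P]
  {Φ : Ω → Set Plane} {lam : ℝ}

/-- The Laplace functional of the constant 1 is e^{-∞} = 0, as the plane has infinite area; so
e^{-N} vanishes almost surely for the total number N of points. -/
lemma IsPoissonPointProcess.ae_infinite (h : IsPoissonPointProcess P Φ lam) (hlam : 0 < lam) :
    ∀ᵐ ω ∂P, (Φ ω).Infinite := by
  have h1 := h.laplace (f := fun _ => 1) measurable_const
  have hpos : (1 : ℝ≥0∞) - expNeg 1 ≠ 0 := by
    have : expNeg 1 < 1 := by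
      rw [← ENNReal.ofReal_one, expNeg_ofReal zero_le_one, ENNReal.ofReal_lt_ofReal_iff one_pos]
      simp
    exact (tsub_pos_of_lt this).ne'
  have hvol : (volume : Measure Plane) univ = ⊤ := by simp
  simp only [lintegral_const, hvol, ENNReal.mul_top hpos] at h1
  rw [ENNReal.mul_top (by simpa using hlam), expNeg_top, lintegral_eq_zero_iff] at h1
  · filter_upwards [h1] with ω hω hfin
    have : countingMeasure Φ ω univ ≠ ⊤ := by
      rw [countingMeasure_apply h.locallyFinite ω MeasurableSet.univ]
      simpa [count] using hfin
    lift countingMeasure Φ ω univ to ℝ≥0 using this with c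
    have h2 : expNeg c = ENNReal.ofReal (Real.exp (-c)) := by
      rw [← expNeg_ofReal c.coe_nonneg]; simp
    simp only [one_mul, h2, Pi.zero_apply, ENNReal.ofReal_eq_zero] at hω
    exact absurd hω (not_le.2 (Real.exp_pos _))
  · simpa [Function.comp_def] using measurable_expNeg.comp
      (h.measurable_lintegral_countingMeasure (f := fun _ => 1) measurable_const)

lemma IsPoissonPointProcess.ae_nthDist_pos (h : IsPoissonPointProcess P Φ lam)
    (hlam : 0 < lam) : ∀ᵐ ω ∂P, ∀ k, 0 < nthDist Φ k ω := by
  filter_upwards [h.ae_infinite hlam, h.ae_zero_notMem] with ω hinf h0 k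
  refine lt_of_lt_of_le ?_ (monotone_nthDist h.locallyFinite hinf (Nat.zero_le k))
  rw [← not_le, nthDist_le_iff h.locallyFinite hinf]
  simp only [count, Metric.closedBall_zero, not_le]
  rw [inter_singleton_eq_empty.2 h0]
  simp

/-- The Laplace functional of the distances of the points of a Poisson process. -/
lemma IsPoissonPointProcess.laplace_nthDist (hp : IsPoissonPointProcess P Φ lam)
    (hlam : 0 < lam) {h : ℝ → ℝ≥0∞} (hh : Measurable h) :
    ∫⁻ ω, expNeg (∑' k, h (nthDist Φ k ω)) ∂P =
      expNeg (∫⁻ u in Ioi 0, (1 - expNeg (h u)) * ENNReal.ofReal (2 * Real.pi * lam * u)) := by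
  have h1 := hp.laplace (f := fun x => h ‖x‖) (hh.comp measurable_norm)
  have h2 : ∫⁻ ω, expNeg (∑' k, h (nthDist Φ k ω)) ∂P =
      ∫⁻ ω, expNeg (∫⁻ x, h ‖x‖ ∂(countingMeasure Φ ω)) ∂P := by
    refine lintegral_congr_ae ?_
    filter_upwards [hp.ae_infinite hlam] with ω hinf
    rw [lintegral_norm_countingMeasure hp.locallyFinite hinf hh]
  have hm : Measurable fun u => 1 - expNeg (h u) := by fun_prop
  rw [h2, h1, ← lintegral_map (f := fun u => 1 - expNeg (h u)) hm measurable_norm,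
    map_norm_volume, lintegral_withDensity_eq_lintegral_mul _ (by fun_prop) hm,
    ← lintegral_const_mul _ (by fun_prop)]
  congr 1
  refine lintegral_congr fun u => ?_
  have : ENNReal.ofReal (2 * Real.pi * lam * u) =
      ENNReal.ofReal lam * ENNReal.ofReal (2 * Real.pi * u) := by
    rw [← ENNReal.ofReal_mul hlam.le]; ring_nf
  rw [this, Pi.mul_apply]; ring

end Poisson

/-! ### Radial weights and the void weight -/

/-- Radial intensity of a planar Poisson process of intensity `lam`. -/
def radialIntensity (lam u : ℝ) : ℝ := 2 * Real.pi * lam * u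

lemma radialIntensity_nonneg {lam u : ℝ} (hlam : 0 < lam) (hu : 0 ≤ u) :
    0 ≤ radialIntensity lam u := by
  have := Real.pi_pos
  unfold radialIntensity; positivity

@[fun_prop] lemma continuous_radialIntensity (lam : ℝ) : Continuous (radialIntensity lam) := by
  unfold radialIntensity; fun_prop

@[fun_prop] lemma measurable_radialIntensity (lam : ℝ) : Measurable (radialIntensity lam) :=
  (continuous_radialIntensity lam).measurable

/-- Nonnegative weights for which the Laplace functional of a planar Poisson process of
intensity `lam` does not vanish. -/
structure IsRadialWeight (lam : ℝ) (h : ℝ → ℝ) : Prop where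
  measurable : Measurable h
  nonneg : ∀ u, 0 ≤ h u
  continuousOn : ContinuousOn h (Ioi 0)
  integrableOn : IntegrableOn (fun u => (1 - Real.exp (-h u)) * radialIntensity lam u) (Ioi 0)

/-- The probability that the closed ball of radius `a` holds no point, weighted by `e⁻ʰ` over
all the points outside of it. -/
def voidWeight (lam : ℝ) (h : ℝ → ℝ) (a : ℝ) : ℝ :=
  Real.exp (-(Real.pi * lam * a ^ 2 +
    ∫ u in Ioi a, (1 - Real.exp (-h u)) * radialIntensity lam u))

lemma integral_radialIntensity (lam a b : ℝ) :
    ∫ u in a..b, radialIntensity lam u = Real.pi * lam * b ^ 2 - Real.pi * lam * a ^ 2 := by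
  simp only [radialIntensity]
  rw [intervalIntegral.integral_const_mul, integral_id]; ring

section Analysis

variable {lam : ℝ} {h : ℝ → ℝ}

lemma IsRadialWeight.factor_nonneg (hh : IsRadialWeight lam h) (hlam : 0 < lam) {u : ℝ}
    (hu : 0 ≤ u) : 0 ≤ (1 - Real.exp (-h u)) * radialIntensity lam u :=
  mul_nonneg (sub_nonneg.2 (Real.exp_le_one_iff.2 (by simpa using hh.nonneg u)))
    (radialIntensity_nonneg hlam hu)

lemma IsRadialWeight.integrableOn_Ioi (hh : IsRadialWeight lam h) {a : ℝ} (ha : 0 ≤ a) :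
    IntegrableOn (fun u => (1 - Real.exp (-h u)) * radialIntensity lam u) (Ioi a) :=
  hh.integrableOn.mono_set (Ioi_subset_Ioi ha)

lemma voidWeight_pos (lam : ℝ) (h : ℝ → ℝ) (a : ℝ) : 0 < voidWeight lam h a := Real.exp_pos _

lemma IsRadialWeight.voidWeight_le (hh : IsRadialWeight lam h) (hlam : 0 < lam) {a : ℝ}
    (ha : 0 ≤ a) : voidWeight lam h a ≤ Real.exp (-(Real.pi * lam * a ^ 2)) := by
  refine Real.exp_le_exp.2 (neg_le_neg (le_add_of_nonneg_right ?_))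
  exact setIntegral_nonneg measurableSet_Ioi fun u hu =>
    hh.factor_nonneg hlam (ha.trans hu.le)

/-- With the tail integral written as a constant minus an integral over (0, a), the fundamental
theorem of calculus applies. -/
lemma IsRadialWeight.voidWeight_eq (hh : IsRadialWeight lam h) {a : ℝ} (ha : 0 ≤ a) :
    voidWeight lam h a = Real.exp (-(Real.pi * lam * a ^ 2 +
      ((∫ u in Ioi 0, (1 - Real.exp (-h u)) * radialIntensity lam u) -
        ∫ u in 0..a, (1 - Real.exp (-h u)) * radialIntensity lam u))) := by
  have := intervalIntegral.integral_interval_add_Ioi (a := 0) (b := a) hh.integrableOn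
    (hh.integrableOn_Ioi ha)
  rw [voidWeight, ← this]
  congr 2; ring

/-- Enlarging the radius adds ρ(x) through the area term and removes (1 - e^{-h(x)}) ρ(x) from the
tail; e^{-h(x)} ρ(x) remains. -/
lemma IsRadialWeight.hasDerivAt_voidWeight (hh : IsRadialWeight lam h) {x : ℝ} (hx : 0 < x) :
    HasDerivAt (voidWeight lam h)
      (-(Real.exp (-h x) * voidWeight lam h x * radialIntensity lam x)) x := by
  set q : ℝ → ℝ := fun u => (1 - Real.exp (-h u)) * radialIntensity lam u with hq
  have hqc : ContinuousAt q x := by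
    have : ContinuousAt h x := hh.continuousOn.continuousAt (Ioi_mem_nhds hx)
    exact (continuousAt_const.sub (Real.continuous_exp.continuousAt.comp this.neg)).mul
      (continuous_radialIntensity lam).continuousAt
  have hqm : Measurable q := by
    have := hh.measurable
    fun_prop
  have hint : IntervalIntegrable q volume 0 x := by
    rw [intervalIntegrable_iff_integrableOn_Ioc_of_le hx.le]
    exact hh.integrableOn.mono_set Ioc_subset_Ioi_self
  have h1 : HasDerivAt (fun a => ∫ u in 0..a, q u) (q x) x :=
    intervalIntegral.integral_hasDerivAt_right hint
      hqm.stronglyMeasurable.stronglyMeasurableAtFilter hqc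
  have h2 : HasDerivAt (fun a => Real.exp (-(Real.pi * lam * a ^ 2 +
      ((∫ u in Ioi 0, q u) - ∫ u in 0..a, q u))))
      (Real.exp (-(Real.pi * lam * x ^ 2 + ((∫ u in Ioi 0, q u) - ∫ u in 0..x, q u))) *
        -(Real.pi * lam * (2 * x) + (0 - q x))) x := by
    refine HasDerivAt.exp (HasDerivAt.neg (HasDerivAt.add ?_ ?_))
    · simpa using (hasDerivAt_pow 2 x).const_mul (Real.pi * lam)
    · exact (hasDerivAt_const x _).sub h1
  refine (h2.congr_of_eventuallyEq ?_).congr_deriv ?_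
  · filter_upwards [Ioi_mem_nhds hx] with y hy using hh.voidWeight_eq (le_of_lt hy)
  · rw [← hh.voidWeight_eq hx.le, hq]
    simp only [radialIntensity]
    ring

/-- This supplies the endpoint a = 0, where `h` need not be continuous and the derivative is not
available. -/
lemma IsRadialWeight.continuousWithinAt_voidWeight (hh : IsRadialWeight lam h) {a : ℝ}
    (ha : 0 ≤ a) : ContinuousWithinAt (voidWeight lam h) (Ici a) a := by
  set q : ℝ → ℝ := fun u => (1 - Real.exp (-h u)) * radialIntensity lam u with hq
  have hint : ∀ c, 0 ≤ c → IntervalIntegrable q volume 0 c := fun c hc => by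
    rw [intervalIntegrable_iff_integrableOn_Ioc_of_le hc]
    exact hh.integrableOn.mono_set Ioc_subset_Ioi_self
  have h1 : ContinuousWithinAt (fun c => ∫ u in 0..c, q u) (Ici a) a := by
    have : ContinuousOn (fun c => ∫ u in 0..c, q u) (Icc 0 (a + 1)) := by
      have hi : IntegrableOn q (uIcc 0 (a + 1)) := by
        rw [uIcc_of_le (by linarith), integrableOn_Icc_iff_integrableOn_Ioc]
        exact hh.integrableOn.mono_set Ioc_subset_Ioi_self
      have := intervalIntegral.continuousOn_primitive_interval hi
      rwa [uIcc_of_le (by linarith)] at this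
    refine (this a ⟨ha, by linarith⟩).mono_of_mem_nhdsWithin ?_
    filter_upwards [self_mem_nhdsWithin,
      mem_nhdsWithin_of_mem_nhds (Iio_mem_nhds (lt_add_one a))] with c hc hc'
    exact ⟨ha.trans hc, le_of_lt hc'⟩
  have h2 : ContinuousWithinAt (fun a => Real.exp (-(Real.pi * lam * a ^ 2 +
      ((∫ u in Ioi 0, q u) - ∫ u in 0..a, q u)))) (Ici a) a := by
    refine ContinuousWithinAt.rexp (ContinuousWithinAt.neg (ContinuousWithinAt.add ?_ ?_))
    · exact (by fun_prop : Continuous fun a : ℝ => Real.pi * lam * a ^ 2).continuousWithinAt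
    · exact continuousWithinAt_const.sub h1
  exact h2.congr (fun y hy => hh.voidWeight_eq (ha.trans hy)) (hh.voidWeight_eq ha)

lemma tendsto_exp_neg_sq (hlam : 0 < lam) :
    Tendsto (fun x : ℝ => Real.exp (-(Real.pi * lam * x ^ 2))) atTop (𝓝 0) := by
  refine Real.tendsto_exp_neg_atTop_nhds_zero.comp ?_
  exact (tendsto_pow_atTop two_ne_zero).const_mul_atTop (mul_pos Real.pi_pos hlam)

/-- The integrand is minus the derivative of `voidWeight`, which vanishes at infinity. -/
lemma IsRadialWeight.lintegral_voidWeight (hh : IsRadialWeight lam h) (hlam : 0 < lam) {a : ℝ}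
    (ha : 0 ≤ a) :
    ∫⁻ x in Ioi a, ENNReal.ofReal (Real.exp (-h x) * voidWeight lam h x *
      radialIntensity lam x) = ENNReal.ofReal (voidWeight lam h a) := by
  have hd : ∀ x ∈ Ioi a, HasDerivAt (voidWeight lam h)
      (-(Real.exp (-h x) * voidWeight lam h x * radialIntensity lam x)) x := fun x hx =>
    hh.hasDerivAt_voidWeight (ha.trans_lt hx)
  have hnn : ∀ x ∈ Ioi a, 0 ≤ Real.exp (-h x) * voidWeight lam h x * radialIntensity lam x :=
    fun x hx => mul_nonneg (mul_nonneg (Real.exp_pos _).le (voidWeight_pos _ _ _).le)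
      (radialIntensity_nonneg hlam (ha.trans (le_of_lt hx)))
  have hlim : Tendsto (voidWeight lam h) atTop (𝓝 0) :=
    squeeze_zero' (Eventually.of_forall fun x => (voidWeight_pos _ _ _).le)
      ((eventually_ge_atTop 0).mono fun x hx => hh.voidWeight_le hlam hx)
      (tendsto_exp_neg_sq hlam)
  have hcont := hh.continuousWithinAt_voidWeight ha
  have hint := integrableOn_Ioi_deriv_of_nonpos hcont hd
    (fun x hx => neg_nonpos.2 (hnn x hx)) hlim
  have hval := integral_Ioi_of_hasDerivAt_of_tendsto hcont hd hint hlim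
  rw [← ofReal_integral_eq_lintegral_ofReal]
  · rw [integral_neg] at hval
    congr 1; linarith
  · simpa [IntegrableOn] using hint.neg
  · filter_upwards [ae_restrict_mem measurableSet_Ioi] with x hx using hnn x hx

lemma IsRadialWeight.zero (lam : ℝ) : IsRadialWeight lam fun _ => 0 where
  measurable := measurable_const
  nonneg _ := le_rfl
  continuousOn := continuousOn_const
  integrableOn := by simp

lemma voidWeight_zero (lam a : ℝ) :
    voidWeight lam (fun _ => 0) a = Real.exp (-(Real.pi * lam * a ^ 2)) := by
  simp [voidWeight]

lemma measurable_voidWeight (hh : IsRadialWeight lam h) : Measurable (voidWeight lam h) := by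
  have hm := hh.measurable
  have : Measurable fun a => ∫ u in Ioi a, (1 - Real.exp (-h u)) * radialIntensity lam u := by
    -- The moving domain becomes an indicator in the pair (a, u), so that measurability of
    -- parametric integrals applies.
    have h1 : ∀ a, ∫ u in Ioi a, (1 - Real.exp (-h u)) * radialIntensity lam u =
        ∫ u, ({p : ℝ × ℝ | p.1 < p.2}.indicator
          (fun p => (1 - Real.exp (-h p.2)) * radialIntensity lam p.2)) (a, u) := fun a => by
      rw [← integral_indicator measurableSet_Ioi]; rfl
    simp_rw [h1]
    refine (StronglyMeasurable.integral_prod_right (f := fun a u =>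
      ({p : ℝ × ℝ | p.1 < p.2}.indicator
          (fun p => (1 - Real.exp (-h p.2)) * radialIntensity lam p.2)) (a, u)) ?_).measurable
    exact (Measurable.indicator (by fun_prop)
      (measurableSet_lt measurable_fst measurable_snd)).stronglyMeasurable
  unfold voidWeight
  fun_prop

end Analysis

/-! ### The nearest point -/

lemma Real.measure_ext_of_Ioi_of_pos {μ ν : Measure ℝ} [IsFiniteMeasure μ] (hμ : μ (Iic 0) = 0)
    (hν : ν (Iic 0) = 0) (h : ∀ a, 0 ≤ a → μ (Ioi a) = ν (Ioi a)) : μ = ν := by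
  have key : ∀ (ρ : Measure ℝ), ρ (Iic 0) = 0 → ∀ s, Ioi 0 ⊆ s → ρ s = ρ (Ioi 0) := by
    intro ρ hρ s hs
    refine le_antisymm ?_ (measure_mono hs)
    calc ρ s ≤ ρ (Iic 0 ∪ Ioi 0) := measure_mono (by rw [Iic_union_Ioi]; exact subset_univ s)
      _ ≤ ρ (Iic 0) + ρ (Ioi 0) := measure_union_le _ _
      _ = ρ (Ioi 0) := by rw [hρ, zero_add]
  refine ext_of_generate_finite (range Ioi) (borel_eq_generateFrom_Ioi ℝ ▸
    BorelSpace.measurable_eq) isPiSystem_Ioi ?_ ?_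
  · rintro _ ⟨a, rfl⟩
    rcases le_total 0 a with ha | ha
    · exact h a ha
    · rw [key μ hμ _ (Ioi_subset_Ioi ha), key ν hν _ (Ioi_subset_Ioi ha), h 0 le_rfl]
  · rw [key μ hμ _ (subset_univ _), key ν hν _ (subset_univ _), h 0 le_rfl]

section OnePoint

variable {Ω : Type*} [MeasurableSpace Ω] {P : Measure Ω} [IsProbabilityMeasure P]
  {Φ : Ω → Set Plane} {lam : ℝ} {h : ℝ → ℝ}

lemma IsPoissonPointProcess.measurable_nthDist {Ω : Type*} [MeasurableSpace Ω] {P : Measure Ω}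
    {Φ : Ω → Set Plane} {lam : ℝ} (hp : IsPoissonPointProcess P Φ lam) (k : ℕ) :
    Measurable (nthDist Φ k) :=
  MaxRatio.measurable_nthDist
    (fun _ => hp.measurable_count _ Metric.isClosed_closedBall.measurableSet) k

/-- The event r₀ > a is absorbed into the weight: `H` is infinite on `Iic a`, so e^{-∑ H} vanishes
as soon as a point lies within a. In the Laplace functional this turns 1 - e^{-H} into 1 on (0, a]
and produces the area term πλa². -/
lemma IsPoissonPointProcess.lintegral_first_gt (hp : IsPoissonPointProcess P Φ lam)
    (hlam : 0 < lam) (hh : IsRadialWeight lam h) {a : ℝ} (ha : 0 ≤ a) :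
    ∫⁻ ω in nthDist Φ 0 ⁻¹' Ioi a, expNeg (∑' k, ENNReal.ofReal (h (nthDist Φ k ω))) ∂P =
      ENNReal.ofReal (voidWeight lam h a) := by
  have hm := hh.measurable
  set H : ℝ → ℝ≥0∞ := fun u => ENNReal.ofReal (h u) + (Iic a).indicator (fun _ => ⊤) u with hH
  have hHm : Measurable H :=
    (by fun_prop : Measurable fun u => ENNReal.ofReal (h u)).add
      (measurable_const.indicator measurableSet_Iic)
  have h1 := hp.laplace_nthDist hlam hHm
  have hL : ∫⁻ ω in nthDist Φ 0 ⁻¹' Ioi a,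
        expNeg (∑' k, ENNReal.ofReal (h (nthDist Φ k ω))) ∂P =
      ∫⁻ ω, expNeg (∑' k, H (nthDist Φ k ω)) ∂P := by
    rw [← lintegral_indicator (hp.measurable_nthDist 0 measurableSet_Ioi)]
    refine lintegral_congr_ae ?_
    filter_upwards [hp.ae_infinite hlam] with ω hinf
    by_cases hω : a < nthDist Φ 0 ω
    · rw [indicator_of_mem (show ω ∈ nthDist Φ 0 ⁻¹' Ioi a from hω)]
      congr 1
      refine tsum_congr fun k => ?_
      have : nthDist Φ k ω ∉ Iic a := not_le.2
        (hω.trans_le (monotone_nthDist hp.locallyFinite hinf (Nat.zero_le k)))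
      rw [hH]; simp only [indicator_of_notMem this, add_zero]
    · rw [indicator_of_notMem (show ω ∉ nthDist Φ 0 ⁻¹' Ioi a from hω)]
      have h0 : H (nthDist Φ 0 ω) = ⊤ := by
        rw [hH]; simp only [indicator_of_mem (show nthDist Φ 0 ω ∈ Iic a from not_lt.1 hω),
          add_top]
      rw [ENNReal.tsum_eq_top_of_eq_top ⟨0, h0⟩, expNeg_top]
  have h01 : ∀ u, 1 - expNeg (ENNReal.ofReal (h u)) = ENNReal.ofReal (1 - Real.exp (-h u)) :=
    fun u => by
      rw [expNeg_ofReal (hh.nonneg u), ENNReal.ofReal_sub _ (Real.exp_pos _).le,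
        ENNReal.ofReal_one]
  have hR : ∫⁻ u in Ioi 0, (1 - expNeg (H u)) * ENNReal.ofReal (2 * Real.pi * lam * u) =
      ENNReal.ofReal (Real.pi * lam * a ^ 2 +
        ∫ u in Ioi a, (1 - Real.exp (-h u)) * radialIntensity lam u) := by
    rw [← Ioc_union_Ioi_eq_Ioi ha, lintegral_union measurableSet_Ioi (Ioc_disjoint_Ioi le_rfl),
      ENNReal.ofReal_add (by have := Real.pi_pos; positivity)
        (setIntegral_nonneg measurableSet_Ioi fun u hu =>
          hh.factor_nonneg hlam (ha.trans (le_of_lt hu)))]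
    congr 1
    · have : Real.pi * lam * a ^ 2 = ∫ u in Ioc 0 a, radialIntensity lam u := by
        rw [← intervalIntegral.integral_of_le ha, integral_radialIntensity]; ring
      rw [this, ofReal_integral_eq_lintegral_ofReal
        (continuous_radialIntensity lam).integrableOn_Ioc]
      · refine setLIntegral_congr_fun measurableSet_Ioc fun u hu => ?_
        have : H u = ⊤ := by
          rw [hH]; simp only [indicator_of_mem (show u ∈ Iic a from hu.2), add_top]
        simp only [this, expNeg_top, tsub_zero, one_mul]
        rfl
      · filter_upwards [ae_restrict_mem measurableSet_Ioc] with u hu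
          using radialIntensity_nonneg hlam hu.1.le
    · rw [ofReal_integral_eq_lintegral_ofReal (hh.integrableOn_Ioi ha)]
      · refine setLIntegral_congr_fun measurableSet_Ioi fun u hu => ?_
        have : H u = ENNReal.ofReal (h u) := by
          rw [hH]
          simp only [indicator_of_notMem (show u ∉ Iic a from fun h' => absurd (mem_Ioi.1 hu) (not_lt.2 h')), add_zero]
        simp only [this, h01]
        rw [ENNReal.ofReal_mul
          (sub_nonneg.2 (Real.exp_le_one_iff.2 (by simpa using hh.nonneg u)))]
        rfl
      · filter_upwards [ae_restrict_mem measurableSet_Ioi] with u hu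
          using hh.factor_nonneg hlam (ha.trans (le_of_lt hu))
  rw [hL, h1, hR, expNeg_ofReal]
  · rfl
  · exact add_nonneg (by have := Real.pi_pos; positivity)
      (setIntegral_nonneg measurableSet_Ioi fun u hu =>
          hh.factor_nonneg hlam (ha.trans (le_of_lt hu)))

lemma IsPoissonPointProcess.measurable_tsum_weight {Ω : Type*} [MeasurableSpace Ω]
    {P : Measure Ω} {Φ : Ω → Set Plane} {lam : ℝ} (hp : IsPoissonPointProcess P Φ lam)
    {h : ℝ → ℝ} (hh : Measurable h) (j : ℕ) :
    Measurable fun ω => expNeg (∑' k, ENNReal.ofReal (h (nthDist Φ (k + j) ω))) :=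
  measurable_expNeg.comp (Measurable.tsum fun _ =>
    ENNReal.measurable_ofReal.comp (hh.comp (hp.measurable_nthDist _)))

/-- Law of the nearest distance, weighted by the Laplace functional of all the distances. -/
lemma IsPoissonPointProcess.map_first (hp : IsPoissonPointProcess P Φ lam)
    (hlam : 0 < lam) (hh : IsRadialWeight lam h) :
    (P.withDensity fun ω => expNeg (∑' k, ENNReal.ofReal (h (nthDist Φ k ω)))).map
        (nthDist Φ 0) =
      (volume.restrict (Ioi 0)).withDensity fun x => ENNReal.ofReal
        (Real.exp (-h x) * voidWeight lam h x * radialIntensity lam x) := by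
  have hfin : IsFiniteMeasure (P.withDensity fun ω =>
      expNeg (∑' k, ENNReal.ofReal (h (nthDist Φ k ω)))) := by
    refine isFiniteMeasure_withDensity (ne_top_of_le_ne_top (b := 1) ENNReal.one_ne_top ?_)
    exact (lintegral_mono fun ω => expNeg_le_one _).trans (by simp)
  refine Real.measure_ext_of_Ioi_of_pos ?_ ?_ fun a ha => ?_
  · rw [Measure.map_apply (hp.measurable_nthDist 0) measurableSet_Iic]
    refine withDensity_absolutelyContinuous _ _ ?_
    rw [measure_eq_zero_iff_ae_notMem]
    filter_upwards [hp.ae_nthDist_pos hlam] with ω hω hmem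
    exact absurd hmem (not_le.2 (hω 0))
  · refine withDensity_absolutelyContinuous _ _ ?_
    rw [Measure.restrict_apply measurableSet_Iic, Iic_inter_Ioi, Ioc_self, measure_empty]
  · rw [Measure.map_apply (hp.measurable_nthDist 0) measurableSet_Ioi,
      withDensity_apply _ (hp.measurable_nthDist 0 measurableSet_Ioi),
      hp.lintegral_first_gt hlam hh ha, withDensity_apply _ measurableSet_Ioi,
      Measure.restrict_restrict measurableSet_Ioi, Ioi_inter_Ioi, sup_eq_left.2 ha,
      hh.lintegral_voidWeight hlam ha]

/-- Given the nearest distance, the other points form a Poisson process outside a ball. -/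
lemma IsPoissonPointProcess.lintegral_first (hp : IsPoissonPointProcess P Φ lam)
    (hlam : 0 < lam) (hh : IsRadialWeight lam h) {φ : ℝ → ℝ≥0∞} (hφ : Measurable φ) :
    ∫⁻ ω, φ (nthDist Φ 0 ω) *
        expNeg (∑' k, ENNReal.ofReal (h (nthDist Φ (k + 1) ω))) ∂P =
      ∫⁻ x in Ioi 0, φ x * ENNReal.ofReal (voidWeight lam h x * radialIntensity lam x) := by
  have hm := hh.measurable
  have hvm := measurable_voidWeight hh
  have hr := hp.measurable_nthDist 0
  have hW := hp.measurable_tsum_weight hm 0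
  simp only [add_zero] at hW
  -- Testing `map_first` against φ e^{h} cancels the factor e^{-h(r₀)} of the nearest point itself.
  set ψ : ℝ → ℝ≥0∞ := fun x => φ x * ENNReal.ofReal (Real.exp (h x)) with hψ
  have hψm : Measurable ψ := by fun_prop
  have h1 := congrArg (fun μ => ∫⁻ x, ψ x ∂μ) (hp.map_first hlam hh)
  rw [lintegral_map hψm hr, lintegral_withDensity_eq_lintegral_mul _ hW
      (g := fun ω => ψ (nthDist Φ 0 ω)) (hψm.comp hr),
    lintegral_withDensity_eq_lintegral_mul _ (by fun_prop) hψm] at h1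
  have hcancel : ∀ x, ENNReal.ofReal (Real.exp (h x)) * ENNReal.ofReal (Real.exp (-h x)) = 1 :=
    fun x => by
      rw [← ENNReal.ofReal_mul (Real.exp_pos _).le, ← Real.exp_add]; simp
  have hL : ∀ ω, φ (nthDist Φ 0 ω) *
      expNeg (∑' k, ENNReal.ofReal (h (nthDist Φ (k + 1) ω))) =
      expNeg (∑' k, ENNReal.ofReal (h (nthDist Φ k ω))) * ψ (nthDist Φ 0 ω) := fun ω => by
    have hs : ∑' k, ENNReal.ofReal (h (nthDist Φ k ω)) = ENNReal.ofReal (h (nthDist Φ 0 ω)) +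
        ∑' k, ENNReal.ofReal (h (nthDist Φ (k + 1) ω)) :=
      tsum_eq_zero_add' (f := fun k => ENNReal.ofReal (h (nthDist Φ k ω)))
        ENNReal.summable
    rw [hs, expNeg_add, expNeg_ofReal (hh.nonneg _), hψ]
    generalize expNeg (∑' k, ENNReal.ofReal (h (nthDist Φ (k + 1) ω))) = c
    calc _ = φ (nthDist Φ 0 ω) * c * 1 := (mul_one _).symm
      _ = _ := by rw [← hcancel (nthDist Φ 0 ω)]; ring
  have hR : ∀ x, φ x * ENNReal.ofReal (voidWeight lam h x * radialIntensity lam x) =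
      ENNReal.ofReal (Real.exp (-h x) * voidWeight lam h x * radialIntensity lam x) * ψ x :=
    fun x => by
      rw [hψ, mul_assoc (Real.exp (-h x)), ENNReal.ofReal_mul (Real.exp_pos _).le]
      generalize ENNReal.ofReal (voidWeight lam h x * radialIntensity lam x) = c
      calc _ = φ x * c * 1 := (mul_one _).symm
        _ = _ := by rw [← hcancel x]; ring
  simp_rw [hL, hR]
  exact h1

end OnePoint

/-! ### Ramps that push the other points beyond a radius -/

section Ramp

variable {lam : ℝ} {h : ℝ → ℝ}

/-- The weight `h`, increased by a ramp of slope `n` that vanishes beyond `b`. -/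
def addRamp (h : ℝ → ℝ) (b : ℝ) (n : ℕ) (u : ℝ) : ℝ := h u + n * max (b - u) 0

lemma le_addRamp (h : ℝ → ℝ) (b : ℝ) (n : ℕ) (u : ℝ) : h u ≤ addRamp h b n u :=
  le_add_of_nonneg_right (by positivity)

lemma addRamp_of_le (h : ℝ → ℝ) {b u : ℝ} (n : ℕ) (hu : b ≤ u) : addRamp h b n u = h u := by
  rw [addRamp, max_eq_right (by linarith), mul_zero, add_zero]

/-- A dominating function that does not depend on `n`: below b the first factor is at most 1, beyond
b the ramp changes nothing. -/
lemma IsRadialWeight.one_sub_exp_addRamp_le (hh : IsRadialWeight lam h) (hlam : 0 < lam) (b : ℝ)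
    (n : ℕ) {u : ℝ} (hu : 0 ≤ u) :
    (1 - Real.exp (-addRamp h b n u)) * radialIntensity lam u ≤
      (1 - Real.exp (-h u)) * radialIntensity lam u +
        (Iic b).indicator (radialIntensity lam) u := by
  by_cases hub : u ≤ b
  · rw [indicator_of_mem (show u ∈ Iic b from hub)]
    have h1 := hh.factor_nonneg hlam hu
    have h2 := radialIntensity_nonneg hlam hu
    have h3 : (1 - Real.exp (-addRamp h b n u)) * radialIntensity lam u ≤
        1 * radialIntensity lam u :=
      mul_le_mul_of_nonneg_right (by linarith [Real.exp_pos (-addRamp h b n u)]) h2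
    linarith
  · rw [addRamp_of_le h n (le_of_not_ge hub),
      indicator_of_notMem (show u ∉ Iic b from hub), add_zero]

lemma integrableOn_indicator_radialIntensity (lam b : ℝ) :
    IntegrableOn ((Iic b).indicator (radialIntensity lam)) (Ioi 0) := by
  rw [IntegrableOn, integrable_indicator_iff measurableSet_Iic, IntegrableOn,
    Measure.restrict_restrict measurableSet_Iic, inter_comm, Ioi_inter_Iic]
  exact (continuous_radialIntensity lam).integrableOn_Ioc

lemma IsRadialWeight.addRamp (hh : IsRadialWeight lam h) (hlam : 0 < lam) (b : ℝ) (n : ℕ) :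
    IsRadialWeight lam (addRamp h b n) := by
  have hm := hh.measurable
  have hm' : Measurable (MaxRatio.addRamp h b n) := by unfold MaxRatio.addRamp; fun_prop
  have hnn : ∀ u, 0 ≤ MaxRatio.addRamp h b n u := fun u =>
    (hh.nonneg u).trans (le_addRamp h b n u)
  refine ⟨hm', hnn, ?_, ?_⟩
  · exact hh.continuousOn.add (by fun_prop)
  · refine Integrable.mono' (hh.integrableOn.add (integrableOn_indicator_radialIntensity lam b))
      (by fun_prop) ?_
    filter_upwards [ae_restrict_mem measurableSet_Ioi] with u hu
    rw [Real.norm_of_nonneg (mul_nonneg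
      (sub_nonneg.2 (Real.exp_le_one_iff.2 (by simpa using hnn u)))
      (radialIntensity_nonneg hlam (le_of_lt hu)))]
    exact hh.one_sub_exp_addRamp_le hlam b n (le_of_lt hu)

lemma tendsto_exp_neg_addRamp {h : ℝ → ℝ} {b u : ℝ} (hu : u < b) :
    Tendsto (fun n : ℕ => Real.exp (-addRamp h b n u)) atTop (𝓝 0) := by
  refine Real.tendsto_exp_neg_atTop_nhds_zero.comp (tendsto_atTop_add_const_left _ _ ?_)
  exact tendsto_natCast_atTop_atTop.atTop_mul_const (lt_max_of_lt_left (sub_pos.2 hu))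

/-- In the limit the integrand is the full intensity on (x, b), and its integral enlarges the empty
ball from radius x to `max x b`. -/
lemma IsRadialWeight.tendsto_voidWeight_addRamp (hh : IsRadialWeight lam h) (hlam : 0 < lam)
    (b : ℝ) {x : ℝ} (hx : 0 < x) :
    Tendsto (fun n => voidWeight lam (MaxRatio.addRamp h b n) x) atTop
      (𝓝 (voidWeight lam h (max x b))) := by
  set q : ℝ → ℝ := fun u => (1 - Real.exp (-h u)) * radialIntensity lam u with hq
  set qb : ℝ → ℝ := fun u => if u < b then radialIntensity lam u else q u with hqb
  have hlim : Tendsto (fun n => ∫ u in Ioi x,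
      (1 - Real.exp (-MaxRatio.addRamp h b n u)) * radialIntensity lam u) atTop
      (𝓝 (∫ u in Ioi x, qb u)) := by
    refine tendsto_integral_of_dominated_convergence
      (fun u => q u + (Iic b).indicator (radialIntensity lam) u)
      (fun n => ((hh.addRamp hlam b n).integrableOn_Ioi hx.le).1)
      ((hh.integrableOn_Ioi hx.le).add ((integrableOn_indicator_radialIntensity lam b).mono_set
        (Ioi_subset_Ioi hx.le))) (fun n => ?_) ?_
    · filter_upwards [ae_restrict_mem measurableSet_Ioi] with u hu
      have hu0 : 0 ≤ u := hx.le.trans (le_of_lt hu)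
      rw [Real.norm_of_nonneg ((hh.addRamp hlam b n).factor_nonneg hlam hu0)]
      exact hh.one_sub_exp_addRamp_le hlam b n hu0
    · refine ae_of_all _ fun u => ?_
      simp only [hqb]
      split_ifs with hub
      · simpa using ((tendsto_exp_neg_addRamp (h := h) hub).const_sub 1).mul_const
          (radialIntensity lam u)
      · simp only [addRamp_of_le h _ (not_lt.1 hub)]
        exact tendsto_const_nhds
  have hval : Real.pi * lam * x ^ 2 + ∫ u in Ioi x, qb u =
      Real.pi * lam * (max x b) ^ 2 + ∫ u in Ioi (max x b), q u := by
    have hbi : ∫ u in Ioi (max x b), qb u = ∫ u in Ioi (max x b), q u :=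
      setIntegral_congr_fun measurableSet_Ioi fun u hu =>
        if_neg (not_lt.2 ((le_max_right x b).trans (le_of_lt hu)))
    have hfi : ∫ u in Ioc x (max x b), qb u = ∫ u in Ioc x (max x b), radialIntensity lam u := by
      -- The right endpoint is removed because at u = b the ramp vanishes and `qb` is still `q`.
      rw [integral_Ioc_eq_integral_Ioo, integral_Ioc_eq_integral_Ioo]
      refine setIntegral_congr_fun measurableSet_Ioo fun u hu => if_pos ?_
      exact (lt_max_iff.1 hu.2).resolve_left (not_lt.2 hu.1.le)
    have hqbi : IntegrableOn qb (Ioi x) := by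
      refine Integrable.mono' ((hh.integrableOn_Ioi hx.le).add
        ((integrableOn_indicator_radialIntensity lam b).mono_set (Ioi_subset_Ioi hx.le))) ?_ ?_
      · have := hh.measurable
        exact (Measurable.ite (measurableSet_lt measurable_id measurable_const) (by fun_prop)
          (by fun_prop)).aestronglyMeasurable
      · filter_upwards [ae_restrict_mem measurableSet_Ioi] with u hu
        have hu0 : 0 ≤ u := hx.le.trans (le_of_lt hu)
        have h1 := hh.factor_nonneg hlam hu0
        have h2 := radialIntensity_nonneg hlam hu0
        simp only [hqb, Pi.add_apply]
        split_ifs with hub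
        · rw [indicator_of_mem (show u ∈ Iic b from hub.le), Real.norm_of_nonneg h2]
          linarith
        · rw [Real.norm_of_nonneg h1]
          exact le_add_of_nonneg_right (indicator_apply_nonneg fun _ => h2)
    rw [← Ioc_union_Ioi_eq_Ioi (le_max_left x b), setIntegral_union
      (Ioc_disjoint_Ioi le_rfl) measurableSet_Ioi
      (hqbi.mono_set Ioc_subset_Ioi_self)
      (hqbi.mono_set (Ioi_subset_Ioi (le_max_left x b))), hbi, hfi,
      ← intervalIntegral.integral_of_le (le_max_left x b), integral_radialIntensity]
    ring
  rw [voidWeight, ← hval]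
  exact (Real.continuous_exp.tendsto _).comp (hlim.const_add _).neg

end Ramp

/-! ### The two nearest points -/

lemma indicator_one_le {α : Type*} (s : Set α) (x : α) : s.indicator (1 : α → ℝ≥0∞) x ≤ 1 :=
  indicator_apply_le' (fun _ => le_rfl) fun _ => zero_le

section TwoPoint

variable {Ω : Type*} [MeasurableSpace Ω] {P : Measure Ω} [IsProbabilityMeasure P]
  {Φ : Ω → Set Plane} {lam : ℝ} {h : ℝ → ℝ}

lemma lintegral_void_ne_top (hlam : 0 < lam) :
    ∫⁻ x in Ioi 0, ENNReal.ofReal (voidWeight lam (fun _ => 0) x * radialIntensity lam x) ≠ ⊤ := by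
  have := (IsRadialWeight.zero lam).lintegral_voidWeight hlam le_rfl
  simp only [neg_zero, Real.exp_zero, one_mul] at this
  rw [this]; exact ENNReal.ofReal_ne_top

/-- The limit of `lintegral_first` along steeper ramps. The ramp does not touch the nearest point,
and it is harmless for the others exactly when r₁ ≥ b; otherwise the term of r₁ sends the weight to
0. Finite continuous ramps, unlike an infinite weight, stay within `IsRadialWeight`. -/
lemma IsPoissonPointProcess.lintegral_first_gt_second_ge (hp : IsPoissonPointProcess P Φ lam)
    (hlam : 0 < lam) (hh : IsRadialWeight lam h) {a : ℝ} (ha : 0 ≤ a) (b : ℝ) :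
    ∫⁻ ω, (Ioi a).indicator 1 (nthDist Φ 0 ω) * ((Ici b).indicator 1 (nthDist Φ 1 ω) *
        expNeg (∑' k, ENNReal.ofReal (h (nthDist Φ (k + 1) ω)))) ∂P =
      ∫⁻ x in Ioi a, ENNReal.ofReal (voidWeight lam h (max x b) * radialIntensity lam x) := by
  have hn := fun n => hp.lintegral_first hlam (hh.addRamp hlam b n)
    (φ := (Ioi a).indicator 1) (measurable_const.indicator measurableSet_Ioi)
  have hind : Measurable ((Ioi a).indicator (1 : ℝ → ℝ≥0∞)) :=
    measurable_const.indicator measurableSet_Ioi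
  have hL : Tendsto (fun n => ∫⁻ ω, (Ioi a).indicator 1 (nthDist Φ 0 ω) *
        expNeg (∑' k, ENNReal.ofReal (addRamp h b n (nthDist Φ (k + 1) ω))) ∂P) atTop
      (𝓝 (∫⁻ ω, (Ioi a).indicator 1 (nthDist Φ 0 ω) * ((Ici b).indicator 1 (nthDist Φ 1 ω) *
        expNeg (∑' k, ENNReal.ofReal (h (nthDist Φ (k + 1) ω)))) ∂P)) := by
    refine tendsto_lintegral_of_dominated_convergence (fun _ => 1) (fun n => ?_)
      (fun n => ae_of_all _ fun ω => ?_) (by simp) ?_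
    · exact (hind.comp (hp.measurable_nthDist 0)).mul
        (hp.measurable_tsum_weight (hh.addRamp hlam b n).measurable 1)
    · exact mul_le_one' (indicator_one_le _ _) (expNeg_le_one _)
    · filter_upwards [hp.ae_infinite hlam] with ω hinf
      refine ENNReal.Tendsto.const_mul ?_ (Or.inr ?_)
      · by_cases hb : b ≤ nthDist Φ 1 ω
        · have hk : ∀ k, b ≤ nthDist Φ (k + 1) ω := fun k =>
            hb.trans (monotone_nthDist hp.locallyFinite hinf (Nat.le_add_left 1 k))
          simp only [addRamp_of_le h _ (hk _),
            indicator_of_mem (show nthDist Φ 1 ω ∈ Ici b from hb), Pi.one_apply, one_mul]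
          exact tendsto_const_nhds
        · rw [indicator_of_notMem (show nthDist Φ 1 ω ∉ Ici b from hb), zero_mul]
          have hup : ∀ n : ℕ, expNeg (∑' k, ENNReal.ofReal (addRamp h b n
              (nthDist Φ (k + 1) ω))) ≤
              ENNReal.ofReal (Real.exp (-addRamp h b n (nthDist Φ 1 ω))) := fun n => by
            rw [← expNeg_ofReal ((hh.addRamp hlam b n).nonneg _)]
            exact antitone_expNeg (ENNReal.le_tsum
              (f := fun k => ENNReal.ofReal (addRamp h b n (nthDist Φ (k + 1) ω))) 0)
          refine tendsto_of_tendsto_of_tendsto_of_le_of_le tendsto_const_nhds ?_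
            (fun n => zero_le) hup
          simpa using ENNReal.tendsto_ofReal (tendsto_exp_neg_addRamp (h := h) (not_le.1 hb))
      · exact ((indicator_one_le _ _).trans_lt ENNReal.one_lt_top).ne
  have hR : Tendsto (fun n => ∫⁻ x in Ioi 0, (Ioi a).indicator 1 x *
        ENNReal.ofReal (voidWeight lam (addRamp h b n) x * radialIntensity lam x)) atTop
      (𝓝 (∫⁻ x in Ioi 0, (Ioi a).indicator 1 x *
        ENNReal.ofReal (voidWeight lam h (max x b) * radialIntensity lam x))) := by
    refine tendsto_lintegral_of_dominated_convergence
      (fun x => ENNReal.ofReal (voidWeight lam (fun _ => 0) x * radialIntensity lam x))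
      (fun n => ?_) (fun n => ?_) (lintegral_void_ne_top hlam) ?_
    · have := measurable_voidWeight (hh.addRamp hlam b n)
      fun_prop
    · filter_upwards [ae_restrict_mem measurableSet_Ioi] with x hx
      refine (mul_le_of_le_one_left' (indicator_one_le _ _)).trans
        (ENNReal.ofReal_le_ofReal ?_)
      rw [voidWeight_zero]
      exact mul_le_mul_of_nonneg_right ((hh.addRamp hlam b n).voidWeight_le hlam (le_of_lt hx))
        (radialIntensity_nonneg hlam (le_of_lt hx))
    · filter_upwards [ae_restrict_mem measurableSet_Ioi] with x hx
      refine ENNReal.Tendsto.const_mul (ENNReal.tendsto_ofReal ?_) (Or.inr ?_)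
      · exact (hh.tendsto_voidWeight_addRamp hlam b hx).mul_const _
      · exact ((indicator_one_le _ _).trans_lt ENNReal.one_lt_top).ne
  simp_rw [hn] at hL
  rw [tendsto_nhds_unique hL hR]
  have : ∀ x, (Ioi a).indicator 1 x *
        ENNReal.ofReal (voidWeight lam h (max x b) * radialIntensity lam x) =
      (Ioi a).indicator (fun x =>
        ENNReal.ofReal (voidWeight lam h (max x b) * radialIntensity lam x)) x := fun x => by
    by_cases hx : x ∈ Ioi a <;> simp [hx]
  simp_rw [this]
  rw [lintegral_indicator measurableSet_Ioi, Measure.restrict_restrict measurableSet_Ioi,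
    Ioi_inter_Ioi, sup_eq_left.2 ha]

/-- The density of the two smallest distances, weighted by `e⁻ʰ` over all the points but the
nearest one. -/
def pairDensity (lam : ℝ) (h : ℝ → ℝ) (p : ℝ × ℝ) : ℝ≥0∞ :=
  {p : ℝ × ℝ | 0 < p.1 ∧ p.1 < p.2}.indicator (fun p => ENNReal.ofReal (radialIntensity lam p.1) *
    ENNReal.ofReal (Real.exp (-h p.2) * voidWeight lam h p.2 * radialIntensity lam p.2)) p

lemma measurableSet_ordered : MeasurableSet {p : ℝ × ℝ | 0 < p.1 ∧ p.1 < p.2} :=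
  (measurableSet_lt measurable_const measurable_fst).inter
    (measurableSet_lt measurable_fst measurable_snd)

lemma IsRadialWeight.measurable_pairDensity (hh : IsRadialWeight lam h) :
    Measurable (pairDensity lam h) := by
  have h1 := hh.measurable
  have h2 := measurable_voidWeight hh
  exact Measurable.indicator (by fun_prop) measurableSet_ordered

/-- The mixed shape, open then closed, is the one in which `lintegral_first_gt_second_ge` delivers
the rectangles. -/
lemma Real.measure_prod_ext_of_Ioi_Ici {μ ν : Measure (ℝ × ℝ)} [IsFiniteMeasure μ]
    (huniv : μ univ = ν univ)
    (h : ∀ a b, μ (Ioi a ×ˢ Ici b) = ν (Ioi a ×ˢ Ici b)) : μ = ν := by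
  refine ext_of_generate_finite (image2 (· ×ˢ ·) (range Ioi) (range Ici)) ?_
    (isPiSystem_Ioi.prod isPiSystem_Ici) ?_ huniv
  · refine (generateFrom_eq_prod (borel_eq_generateFrom_Ioi ℝ ▸ BorelSpace.measurable_eq.symm)
      (borel_eq_generateFrom_Ici ℝ ▸ BorelSpace.measurable_eq.symm) ?_ ?_).symm
    · refine ⟨fun n : ℕ => Ioi (-n : ℝ), fun n => mem_range_self _,
        eq_univ_of_forall fun x => mem_iUnion.2 ?_⟩
      obtain ⟨n, hn⟩ := exists_nat_gt (-x)
      exact ⟨n, by simp only [mem_Ioi]; linarith⟩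
    · refine ⟨fun n : ℕ => Ici (-n : ℝ), fun n => mem_range_self _,
        eq_univ_of_forall fun x => mem_iUnion.2 ?_⟩
      obtain ⟨n, hn⟩ := exists_nat_gt (-x)
      exact ⟨n, by simp only [mem_Ici]; linarith⟩
  · rintro _ ⟨_, ⟨a, rfl⟩, _, ⟨b, rfl⟩, rfl⟩
    exact h a b

lemma IsRadialWeight.lintegral_pairDensity (hh : IsRadialWeight lam h) (hlam : 0 < lam)
    {a : ℝ} (ha : 0 ≤ a) (b : ℝ) :
    ∫⁻ p in Ioi a ×ˢ Ici b, pairDensity lam h p =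
      ∫⁻ x in Ioi a, ENNReal.ofReal (voidWeight lam h (max x b) * radialIntensity lam x) := by
  have hm := hh.measurable
  have hv := measurable_voidWeight hh
  rw [Measure.volume_eq_prod, ← Measure.prod_restrict,
    lintegral_prod _ hh.measurable_pairDensity.aemeasurable]
  refine setLIntegral_congr_fun measurableSet_Ioi fun x hx => ?_
  have hx0 : 0 < x := ha.trans_lt hx
  have h1 : ∀ y, pairDensity lam h (x, y) = (Ioi x).indicator (fun y =>
      ENNReal.ofReal (radialIntensity lam x) * ENNReal.ofReal
        (Real.exp (-h y) * voidWeight lam h y * radialIntensity lam y)) y := fun y => by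
    simp only [pairDensity, indicator_apply, mem_ofPred_eq, hx0, true_and, mem_Ioi]
  simp only [h1]
  rw [lintegral_indicator measurableSet_Ioi, Measure.restrict_restrict measurableSet_Ioi,
    lintegral_const_mul _ (by fun_prop)]
  have h2 : ∫⁻ y in Ioi x ∩ Ici b, ENNReal.ofReal
        (Real.exp (-h y) * voidWeight lam h y * radialIntensity lam y) =
      ∫⁻ y in Ioi (max x b), ENNReal.ofReal
        (Real.exp (-h y) * voidWeight lam h y * radialIntensity lam y) := by
    refine setLIntegral_congr ?_
    rw [← Ioi_inter_Ioi]
    exact (ae_eq_refl _).inter Ioi_ae_eq_Ici.symm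
  rw [h2, hh.lintegral_voidWeight hlam (le_max_of_le_left hx0.le), mul_comm,
    ENNReal.ofReal_mul (voidWeight_pos _ _ _).le]

/-- Joint law of the two smallest distances, weighted by the Laplace functional of all the
distances but the smallest. -/
lemma IsPoissonPointProcess.map_pair (hp : IsPoissonPointProcess P Φ lam)
    (hlam : 0 < lam) (hh : IsRadialWeight lam h) :
    (P.withDensity fun ω => expNeg (∑' k, ENNReal.ofReal (h (nthDist Φ (k + 1) ω)))).map
        (fun ω => (nthDist Φ 0 ω, nthDist Φ 1 ω)) =
      (volume : Measure (ℝ × ℝ)).withDensity (pairDensity lam h) := by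
  have hW := hp.measurable_tsum_weight hh.measurable 1
  have hr : Measurable fun ω => (nthDist Φ 0 ω, nthDist Φ 1 ω) :=
    (hp.measurable_nthDist 0).prodMk (hp.measurable_nthDist 1)
  have hfin : IsFiniteMeasure (P.withDensity fun ω =>
      expNeg (∑' k, ENNReal.ofReal (h (nthDist Φ (k + 1) ω)))) := by
    refine isFiniteMeasure_withDensity (ne_top_of_le_ne_top (b := 1) ENNReal.one_ne_top ?_)
    exact (lintegral_mono fun ω => expNeg_le_one _).trans (by simp)
  set μ := (P.withDensity fun ω => expNeg (∑' k, ENNReal.ofReal (h (nthDist Φ (k + 1) ω)))).map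
        (fun ω => (nthDist Φ 0 ω, nthDist Φ 1 ω))
  set ν := (volume : Measure (ℝ × ℝ)).withDensity (pairDensity lam h)
  have hbase : ∀ a b, 0 ≤ a → μ (Ioi a ×ˢ Ici b) = ν (Ioi a ×ˢ Ici b) := by
    intro a b ha
    have hs : MeasurableSet (Ioi a ×ˢ Ici b) := measurableSet_Ioi.prod measurableSet_Ici
    rw [Measure.map_apply hr hs, withDensity_apply _ (hr hs), withDensity_apply _ hs,
      hh.lintegral_pairDensity hlam ha, ← hp.lintegral_first_gt_second_ge hlam hh ha,
      ← lintegral_indicator (hr hs)]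
    refine lintegral_congr fun ω => ?_
    by_cases h1 : nthDist Φ 0 ω ∈ Ioi a <;> by_cases h2 : nthDist Φ 1 ω ∈ Ici b <;>
      simp [h1, h2]
  -- Both measures live on the quadrant, so a rectangle with any corner reduces to one with a ≥ 0.
  have hμ : ∀ s, μ s = μ (s ∩ Ioi 0 ×ˢ Ici 0) := fun s => by
    refine (measure_inter_conull ?_).symm
    rw [Measure.map_apply hr (measurableSet_Ioi.prod measurableSet_Ici).compl]
    refine withDensity_absolutelyContinuous _ _ ?_
    rw [measure_eq_zero_iff_ae_notMem]
    filter_upwards [hp.ae_nthDist_pos hlam] with ω hω hmem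
    exact hmem ⟨hω 0, (hω 1).le⟩
  have hν : ∀ s, ν s = ν (s ∩ Ioi 0 ×ˢ Ici 0) := fun s => by
    refine (measure_inter_conull ?_).symm
    have hc := (measurableSet_Ioi.prod measurableSet_Ici : MeasurableSet
      (Ioi (0 : ℝ) ×ˢ Ici (0 : ℝ))).compl
    rw [withDensity_apply _ hc, setLIntegral_eq_zero_iff hc hh.measurable_pairDensity]
    refine ae_of_all _ fun p hp => indicator_of_notMem (fun hmem => hp ?_) _
    exact ⟨hmem.1, (hmem.1.trans hmem.2).le⟩
  refine Real.measure_prod_ext_of_Ioi_Ici ?_ fun a b => ?_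
  · rw [hμ, hν, univ_inter, hbase 0 0 le_rfl]
  · rw [hμ, hν, prod_inter_prod, Ioi_inter_Ioi, Ici_inter_Ici]
    exact hbase _ _ le_sup_right

lemma IsPoissonPointProcess.lintegral_pair (hp : IsPoissonPointProcess P Φ lam)
    (hlam : 0 < lam) (hh : IsRadialWeight lam h) {ψ : ℝ × ℝ → ℝ≥0∞} (hψ : Measurable ψ) :
    ∫⁻ ω, ψ (nthDist Φ 0 ω, nthDist Φ 1 ω) *
        expNeg (∑' k, ENNReal.ofReal (h (nthDist Φ (k + 1) ω))) ∂P =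
      ∫⁻ p, ψ p * pairDensity lam h p := by
  have hr : Measurable fun ω => (nthDist Φ 0 ω, nthDist Φ 1 ω) :=
    (hp.measurable_nthDist 0).prodMk (hp.measurable_nthDist 1)
  have hW := hp.measurable_tsum_weight hh.measurable 1
  have h1 := congrArg (fun μ => ∫⁻ x, ψ x ∂μ) (hp.map_pair hlam hh)
  rw [lintegral_map hψ hr, lintegral_withDensity_eq_lintegral_mul _ hW
    (g := fun ω => ψ (nthDist Φ 0 ω, nthDist Φ 1 ω)) (hψ.comp hr),
    lintegral_withDensity_eq_lintegral_mul _ hh.measurable_pairDensity hψ] at h1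
  simp only [Pi.mul_apply] at h1
  simp_rw [mul_comm (ψ _)]
  exact h1

end TwoPoint

/-! ### Integrating out independent variables -/

section Independence

variable {Ω β γ : Type*} {mΩ : MeasurableSpace Ω} {P : Measure Ω} [IsProbabilityMeasure P]
  [MeasurableSpace β] [MeasurableSpace γ]

/-- Fubini for the joint law of ((Z, W), Y). The spare factor Z lets independent variables be
integrated out one at a time. -/
lemma lintegral_mul_of_indepFun {Z : Ω → ℝ≥0∞} (hZ : Measurable Z) {W : Ω → β}
    (hW : Measurable W) {Y : Ω → γ} (hY : Measurable Y)
    (hif : IndepFun (fun ω => (Z ω, W ω)) Y P) {φ : β → γ → ℝ≥0∞}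
    (hφ : Measurable (Function.uncurry φ)) :
    ∫⁻ ω, Z ω * φ (W ω) (Y ω) ∂P = ∫⁻ ω, Z ω * ∫⁻ ω', φ (W ω) (Y ω') ∂P ∂P := by
  have hmap := hif.map_prod_eq_prod_map_map (hZ.prodMk hW).aemeasurable hY.aemeasurable
  have hF : Measurable fun q : (ℝ≥0∞ × β) × γ => q.1.1 * φ q.1.2 q.2 :=
    measurable_fst.fst.mul (hφ.comp (measurable_fst.snd.prodMk measurable_snd))
  have : IsProbabilityMeasure (P.map Y) := Measure.isProbabilityMeasure_map hY.aemeasurable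
  calc _ = ∫⁻ q, q.1.1 * φ q.1.2 q.2 ∂(P.map fun ω => ((Z ω, W ω), Y ω)) := by
        rw [lintegral_map hF ((hZ.prodMk hW).prodMk hY)]
    _ = ∫⁻ q, ∫⁻ y, q.1 * φ q.2 y ∂(P.map Y) ∂(P.map fun ω => (Z ω, W ω)) := by
        rw [hmap, lintegral_prod _ hF.aemeasurable]
    _ = _ := by
        rw [lintegral_map (Measurable.lintegral_prod_right' hF) (hZ.prodMk hW)]
        refine lintegral_congr fun ω => ?_
        have hφω : Measurable fun y => φ (W ω) y := hφ.comp measurable_prodMk_left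
        rw [lintegral_const_mul _ hφω, lintegral_map hφω hY]

lemma lintegral_mul_of_indep {m₁ m₂ : MeasurableSpace Ω} (h₁ : m₁ ≤ mΩ) (h₂ : m₂ ≤ mΩ)
    (hind : Indep m₁ m₂ P) {Z : Ω → ℝ≥0∞} (hZ : Measurable[m₁] Z) {W : Ω → β}
    (hW : Measurable[m₁] W) {Y : Ω → γ} (hY : Measurable[m₂] Y) {φ : β → γ → ℝ≥0∞}
    (hφ : Measurable (Function.uncurry φ)) :
    ∫⁻ ω, Z ω * φ (W ω) (Y ω) ∂P = ∫⁻ ω, Z ω * ∫⁻ ω', φ (W ω) (Y ω') ∂P ∂P := by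
  have hX : Measurable[m₁] fun ω => (Z ω, W ω) := hZ.prodMk hW
  exact lintegral_mul_of_indepFun (hZ.mono h₁ le_rfl) (hW.mono h₁ le_rfl) (hY.mono h₂ le_rfl)
    (indep_of_indep_of_le_left (indep_of_indep_of_le_right hind hY.comap_le) hX.comap_le) hφ

/-- Induction on S with Z free: the variable `Y k` is independent of A and of the remaining factors,
and once integrated out its factor depends on A only and is merged into Z. It serves for the fading
coefficients given the points and for the ratios given one technology. -/
lemma lintegral_mul_prod_of_iIndep {ι κ : Type*} {m : ι → MeasurableSpace Ω}
    (hle : ∀ i, m i ≤ mΩ) (hind : iIndep m P) (A : Set ι) (e : κ → ι)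
    (he : Function.Injective e) (S : Finset κ) (hA : ∀ k ∈ S, e k ∉ A) {W : κ → Ω → β}
    (hW : ∀ k, Measurable[⨆ i ∈ A, m i] (W k)) {Y : κ → Ω → γ}
    (hY : ∀ k, Measurable[m (e k)] (Y k)) {φ : κ → β → γ → ℝ≥0∞}
    (hφ : ∀ k, Measurable (Function.uncurry (φ k))) {Z : Ω → ℝ≥0∞}
    (hZ : Measurable[⨆ i ∈ A, m i] Z) :
    ∫⁻ ω, Z ω * ∏ k ∈ S, φ k (W k ω) (Y k ω) ∂P =
      ∫⁻ ω, Z ω * ∏ k ∈ S, ∫⁻ ω', φ k (W k ω) (Y k ω') ∂P ∂P := by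
  classical
  induction S using Finset.induction_on generalizing Z with
  | empty => simp
  | insert k S hk ih =>
    have hΦ : Measurable fun b => ∫⁻ ω', φ k b (Y k ω') ∂P :=
      Measurable.lintegral_prod_right' (f := fun q : β × Ω => φ k q.1 (Y k q.2))
        ((hφ k).comp (measurable_fst.prodMk (((hY k).mono (hle _) le_rfl).comp measurable_snd)))
    have hA₁ : ⨆ i ∈ A, m i ≤ ⨆ i ∈ A ∪ e '' S, m i :=
      biSup_mono fun i hi => Or.inl hi
    have hd : Disjoint (A ∪ e '' S) {e k} := by
      rw [disjoint_singleton_right]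
      rintro (h | ⟨j, hj, hjk⟩)
      · exact hA k (Finset.mem_insert_self k S) h
      · exact hk (he hjk ▸ hj)
    have hind' := indep_iSup_of_disjoint hle hind hd
    simp only [mem_singleton_iff, iSup_iSup_eq_left] at hind'
    have hprod : Measurable[⨆ i ∈ A ∪ e '' S, m i] fun ω => ∏ j ∈ S, φ j (W j ω) (Y j ω) := by
      refine Finset.measurable_prod _ fun j hj => ?_
      refine (hφ j).comp (((hW j).mono hA₁ le_rfl).prodMk ((hY j).mono ?_ le_rfl))
      exact le_biSup (f := fun i => m i) (i := e j) (Or.inr ⟨j, hj, rfl⟩)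
    calc _ = ∫⁻ ω, (Z ω * ∏ j ∈ S, φ j (W j ω) (Y j ω)) * φ k (W k ω) (Y k ω) ∂P := by
          refine lintegral_congr fun ω => ?_
          rw [Finset.prod_insert hk]; ring
      _ = ∫⁻ ω, (Z ω * ∏ j ∈ S, φ j (W j ω) (Y j ω)) * ∫⁻ ω', φ k (W k ω) (Y k ω') ∂P ∂P :=
          lintegral_mul_of_indep (iSup₂_le fun i _ => hle i) (hle (e k)) hind'
            ((hZ.mono hA₁ le_rfl).mul hprod) ((hW k).mono hA₁ le_rfl) (hY k) (hφ k)
      _ = ∫⁻ ω, (Z ω * ∫⁻ ω', φ k (W k ω) (Y k ω') ∂P) * ∏ j ∈ S, φ j (W j ω) (Y j ω) ∂P := by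
          refine lintegral_congr fun ω => ?_
          ring
      _ = _ := by
          rw [ih (fun j hj => hA j (Finset.mem_insert_of_mem hj))
            (Z := fun ω => Z ω * ∫⁻ ω', φ k (W k ω) (Y k ω') ∂P) (hZ.mul (hΦ.comp (hW k)))]
          refine lintegral_congr fun ω => ?_
          rw [Finset.prod_insert hk]; ring

end Independence

/-! ### Exponential fading coefficients -/

section Exponential

variable {mu : ℝ}

/-- Tilting the exponential density of rate μ by e^{-cy} gives μ/(μ + c) times the exponential
density of rate μ + c. -/
lemma lintegral_expNeg_expMeasure (hmu : 0 < mu) {c : ℝ} (hc : 0 ≤ c) :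
    ∫⁻ y, expNeg (ENNReal.ofReal (c * y)) ∂(expMeasure mu) =
      ENNReal.ofReal (1 / (1 + c / mu)) := by
  have hm : Measurable (gammaPDF 1 mu) := by unfold gammaPDF; fun_prop
  rw [expMeasure, gammaMeasure, lintegral_withDensity_eq_lintegral_mul _ hm (by fun_prop)]
  have h1 : ∀ y, (gammaPDF 1 mu * fun y => expNeg (ENNReal.ofReal (c * y))) y =
      ENNReal.ofReal (1 / (1 + c / mu)) * exponentialPDF (mu + c) y := by
    intro y
    rw [Pi.mul_apply]
    change exponentialPDF mu y * _ = _
    rcases lt_or_ge y 0 with hy | hy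
    · rw [exponentialPDF_of_neg hy, exponentialPDF_of_neg hy]; simp
    · rw [exponentialPDF_of_nonneg hy, exponentialPDF_of_nonneg hy,
        expNeg_ofReal (mul_nonneg hc hy), ← ENNReal.ofReal_mul (by positivity),
        ← ENNReal.ofReal_mul (by positivity), mul_assoc, ← Real.exp_add]
      congr 1
      have : -((mu + c) * y) = -(mu * y) + -(c * y) := by ring
      rw [this]
      field_simp
  simp_rw [h1]
  rw [lintegral_const_mul _ (by unfold exponentialPDF; exact
    (measurable_exponentialPDFReal _).ennreal_ofReal),
    lintegral_exponentialPDF_eq_one (by positivity), mul_one]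

/-- The tail of the exponential law, for a threshold that may be infinite and as an indicator of the
pair, the form needed for integrating out the serving fading coefficient. -/
lemma expMeasure_ofReal_ge (hmu : 0 < mu) (w : ℝ≥0∞) :
    ∫⁻ y, {q : ℝ≥0∞ × ℝ | q.1 ≤ ENNReal.ofReal q.2}.indicator 1 (w, y) ∂(expMeasure mu) =
      expNeg (ENNReal.ofReal mu * w) := by
  have hp := isProbabilityMeasure_expMeasure hmu
  have h1 : ∀ y, {q : ℝ≥0∞ × ℝ | q.1 ≤ ENNReal.ofReal q.2}.indicator
      (1 : ℝ≥0∞ × ℝ → ℝ≥0∞) (w, y) =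
    {y : ℝ | w ≤ ENNReal.ofReal y}.indicator 1 y := fun y => rfl
  simp_rw [h1]
  rw [lintegral_indicator_one (measurableSet_le measurable_const ENNReal.measurable_ofReal)]
  rcases eq_or_ne w ⊤ with rfl | hw
  · rw [ENNReal.mul_top (by simpa using hmu)]
    simp
  lift w to ℝ≥0 using hw
  have hval : ENNReal.ofReal mu * w = ENNReal.ofReal (mu * w) := by
    rw [ENNReal.ofReal_mul hmu.le, ENNReal.ofReal_coe_nnreal]
  rw [hval, expNeg_ofReal (by positivity)]
  have hcdf : expMeasure mu (Iic w) = ENNReal.ofReal (1 - Real.exp (-(mu * w))) := by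
    rw [← ofReal_cdf, cdf_expMeasure_eq hmu, if_pos w.coe_nonneg]
  -- At w = 0 the set is all of ℝ rather than `Ici 0`, since `ENNReal.ofReal` truncates negative
  -- values.
  rcases eq_or_ne w 0 with rfl | hw0
  · simp
  have hset : {y : ℝ | (w : ℝ≥0∞) ≤ ENNReal.ofReal y} = Ici (w : ℝ) := by
    ext y
    simp only [mem_ofPred_eq, mem_Ici]
    rw [← ENNReal.ofReal_coe_nnreal, ENNReal.ofReal_le_ofReal_iff']
    refine or_iff_left fun h => hw0 (by exact_mod_cast le_antisymm h w.coe_nonneg)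
  have hatom : NullSingletonClass (expMeasure mu) := by
    unfold expMeasure gammaMeasure; infer_instance
  rw [hset, ← measure_congr Ioi_ae_eq_Ici, ← compl_Iic,
    prob_compl_eq_one_sub measurableSet_Iic, hcdf, ← ENNReal.ofReal_one,
    ← ENNReal.ofReal_sub _ (sub_nonneg.2 (Real.exp_le_one_iff.2 (by
      simpa using by positivity)))]
  congr 1; ring

end Exponential

/-! ### The weight produced by fading -/

/-- The radial weight with `e⁻ʰ⁽ᵘ⁾ = 1 / (1 + κ u⁻ᵅ)`, which arises from exponential fading. -/
def fadingWeight (α κ u : ℝ) : ℝ := Real.log (1 + κ * |u| ^ (-α))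

section FadingWeight

variable {lam α κ : ℝ}

lemma one_add_fading_pos (hκ : 0 ≤ κ) (u : ℝ) : 0 < 1 + κ * |u| ^ (-α) := by positivity

lemma exp_neg_fadingWeight (hκ : 0 ≤ κ) (u : ℝ) :
    Real.exp (-fadingWeight α κ u) = 1 / (1 + κ * |u| ^ (-α)) := by
  rw [fadingWeight, Real.exp_neg, Real.exp_log (one_add_fading_pos hκ u), one_div]

lemma fadingWeight_nonneg (hκ : 0 ≤ κ) (u : ℝ) : 0 ≤ fadingWeight α κ u :=
  Real.log_nonneg (le_add_of_nonneg_right (by positivity))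

lemma fadingWeight_mono {κ' : ℝ} (hκ : 0 ≤ κ) (h : κ ≤ κ') (u : ℝ) :
    fadingWeight α κ u ≤ fadingWeight α κ' u :=
  Real.log_le_log (one_add_fading_pos hκ u) (by gcongr)

lemma measurable_fadingWeight (α : ℝ) : Measurable fun p : ℝ × ℝ => fadingWeight α p.1 p.2 := by
  unfold fadingWeight; fun_prop

lemma continuousAt_fadingWeight_left (hκ : 0 ≤ κ) (u : ℝ) :
    ContinuousAt (fun κ => fadingWeight α κ u) κ := by
  unfold fadingWeight
  exact ContinuousAt.log (by fun_prop) (one_add_fading_pos hκ u).ne'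

/-- The only obstacle is integrability at infinity: 1 - e^{-h(u)} ≤ κ u^{-α}, and u^{1-α} is
integrable there because α > 2. Near 0 the singular path loss is harmless, as 1 - e^{-h} ≤ 1. -/
lemma isRadialWeight_fadingWeight (hlam : 0 < lam) (hα : 2 < α) (hκ : 0 ≤ κ) :
    IsRadialWeight lam (fadingWeight α κ) := by
  have hm : Measurable (fadingWeight α κ) :=
    (measurable_fadingWeight α).comp measurable_prodMk_left
  have hq : ∀ u, 0 ≤ 1 - Real.exp (-fadingWeight α κ u) := fun u =>
    sub_nonneg.2 (Real.exp_le_one_iff.2 (by simpa using fadingWeight_nonneg hκ u))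
  have hmq : Measurable fun u =>
    (1 - Real.exp (-fadingWeight α κ u)) * radialIntensity lam u := by fun_prop
  refine ⟨hm, fadingWeight_nonneg hκ, fun u hu => ?_, ?_⟩
  · refine ContinuousAt.continuousWithinAt ?_
    unfold fadingWeight
    refine ContinuousAt.log (continuousAt_const.add (continuousAt_const.mul ?_))
      (one_add_fading_pos hκ u).ne'
    exact continuousAt_id.abs.rpow_const (Or.inl (abs_pos.2 (ne_of_gt hu)).ne')
  · rw [← Ioc_union_Ioi_eq_Ioi zero_le_one]
    refine IntegrableOn.union ?_ ?_
    · refine Integrable.mono' (continuous_radialIntensity lam).integrableOn_Ioc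
        hmq.aestronglyMeasurable ?_
      filter_upwards [ae_restrict_mem measurableSet_Ioc] with u hu
      have := radialIntensity_nonneg hlam hu.1.le
      rw [Real.norm_of_nonneg (mul_nonneg (hq u) this)]
      exact mul_le_of_le_one_left this (by linarith [Real.exp_pos (-fadingWeight α κ u)])
    · refine Integrable.mono' (((integrableOn_Ioi_rpow_of_lt (a := 1 - α) (by linarith)
        zero_lt_one).const_mul (κ * (2 * Real.pi * lam)))) hmq.aestronglyMeasurable ?_
      filter_upwards [ae_restrict_mem measurableSet_Ioi] with u hu
      have hu0 : 0 < u := zero_lt_one.trans hu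
      have := radialIntensity_nonneg hlam hu0.le
      rw [Real.norm_of_nonneg (mul_nonneg (hq u) this)]
      have h1 : 1 - Real.exp (-fadingWeight α κ u) ≤ κ * u ^ (-α) := by
        rw [exp_neg_fadingWeight hκ, abs_of_pos hu0]
        have hx : 0 ≤ κ * u ^ (-α) := by positivity
        have : 1 - κ * u ^ (-α) ≤ 1 / (1 + κ * u ^ (-α)) := by
          rw [le_div_iff₀ (by positivity)]; nlinarith
        linarith
      calc _ ≤ κ * u ^ (-α) * radialIntensity lam u := mul_le_mul_of_nonneg_right h1 this
        _ = _ := by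
          rw [radialIntensity, sub_eq_add_neg, Real.rpow_add hu0, Real.rpow_one]; ring

/-- Joint measurability is needed because κ will depend on the nearest distance. -/
lemma measurable_voidWeight_fadingWeight (lam α : ℝ) :
    Measurable fun p : ℝ × ℝ => voidWeight lam (fadingWeight α p.1) p.2 := by
  have hm := measurable_fadingWeight α
  have hI : Measurable fun p : ℝ × ℝ => ∫ u in Ioi p.2,
      (1 - Real.exp (-fadingWeight α p.1 u)) * radialIntensity lam u := by
    have h1 : ∀ p : ℝ × ℝ, ∫ u in Ioi p.2,
        (1 - Real.exp (-fadingWeight α p.1 u)) * radialIntensity lam u =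
        ∫ u, ({q : (ℝ × ℝ) × ℝ | q.1.2 < q.2}.indicator
          (fun q => (1 - Real.exp (-fadingWeight α q.1.1 q.2)) * radialIntensity lam q.2))
            (p, u) := fun p => by
      rw [← integral_indicator measurableSet_Ioi]; rfl
    simp_rw [h1]
    have hf : Measurable fun q : (ℝ × ℝ) × ℝ => fadingWeight α q.1.1 q.2 :=
      hm.comp (measurable_fst.fst.prodMk measurable_snd)
    refine (StronglyMeasurable.integral_prod_right (f := fun p u =>
      ({q : (ℝ × ℝ) × ℝ | q.1.2 < q.2}.indicator
          (fun q => (1 - Real.exp (-fadingWeight α q.1.1 q.2)) * radialIntensity lam q.2))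
            (p, u)) ?_).measurable
    exact (Measurable.indicator (by fun_prop)
      (measurableSet_lt measurable_fst.snd measurable_snd)).stronglyMeasurable
  unfold voidWeight
  fun_prop

lemma tendsto_voidWeight_fadingWeight (hlam : 0 < lam) (hα : 2 < α) {κs : ℕ → ℝ}
    (hκs : ∀ n, 0 ≤ κs n) (hκ : 0 ≤ κ) (hlim : Tendsto κs atTop (𝓝 κ)) {y : ℝ} (hy : 0 ≤ y) :
    Tendsto (fun n => voidWeight lam (fadingWeight α (κs n)) y) atTop
      (𝓝 (voidWeight lam (fadingWeight α κ) y)) := by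
  obtain ⟨K, hK⟩ := hlim.bddAbove_range
  have hK' : ∀ n, κs n ≤ K := fun n => hK (mem_range_self n)
  have hK0 : 0 ≤ K := (hκs 0).trans (hK' 0)
  refine (Real.continuous_exp.tendsto _).comp ((Tendsto.const_add _ ?_).neg)
  refine tendsto_integral_of_dominated_convergence
    (fun u => (1 - Real.exp (-fadingWeight α K u)) * radialIntensity lam u)
    (fun n => ((isRadialWeight_fadingWeight hlam hα (hκs n)).integrableOn_Ioi hy).1)
    ((isRadialWeight_fadingWeight hlam hα hK0).integrableOn_Ioi hy) (fun n => ?_) ?_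
  · filter_upwards [ae_restrict_mem measurableSet_Ioi] with u hu
    have hu0 : 0 ≤ u := hy.trans (le_of_lt hu)
    rw [Real.norm_of_nonneg
      ((isRadialWeight_fadingWeight hlam hα (hκs n)).factor_nonneg hlam hu0)]
    refine mul_le_mul_of_nonneg_right ?_ (radialIntensity_nonneg hlam hu0)
    have := Real.exp_le_exp.2 (neg_le_neg (fadingWeight_mono (α := α) (hκs n) (hK' n) u))
    linarith
  · refine ae_of_all _ fun u => ?_
    refine Tendsto.mul_const _ (Tendsto.const_sub _ ?_)
    exact (Real.continuous_exp.tendsto _).comp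
      (((continuousAt_fadingWeight_left hκ u).tendsto.comp hlim).neg)

lemma fadingWeight_zero (α : ℝ) : fadingWeight α 0 = fun _ => 0 := by
  ext u; simp [fadingWeight]

lemma pairDensity_le (hlam : 0 < lam) {h : ℝ → ℝ} (hh : IsRadialWeight lam h) (p : ℝ × ℝ) :
    pairDensity lam h p ≤ pairDensity lam (fun _ => 0) p := by
  unfold pairDensity
  refine indicator_le_indicator' fun hp => ?_
  have hp2 : 0 ≤ p.2 := (hp.1.trans hp.2).le
  gcongr
  · exact radialIntensity_nonneg hlam hp2
  · exact (voidWeight_pos _ _ _).le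
  · exact hh.nonneg _
  · rw [voidWeight_zero]
    exact hh.voidWeight_le hlam hp2

/-- Continuity in κ, dominated by the unweighted density. It is used for κ → 0, where it yields
finite interference, and for simple functions approximating a κ that varies with the distances. -/
lemma lintegral_tendsto_pairDensity (hlam : 0 < lam) (hα : 2 < α)
    (hfin : ∫⁻ p, pairDensity lam (fun _ => 0) p ≠ ⊤) {κs : ℕ → ℝ × ℝ → ℝ} {κ : ℝ × ℝ → ℝ}
    (hκm : ∀ n, Measurable (κs n)) (hκs : ∀ n p, 0 ≤ κs n p) (hκ : ∀ p, 0 ≤ κ p)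
    (hlim : ∀ p, Tendsto (fun n => κs n p) atTop (𝓝 (κ p)))
    {ψ : ℝ × ℝ → ℝ≥0∞} (hψ : Measurable ψ) (hψ1 : ∀ p, ψ p ≤ 1) :
    Tendsto (fun n => ∫⁻ p, ψ p * pairDensity lam (fadingWeight α (κs n p)) p) atTop
      (𝓝 (∫⁻ p, ψ p * pairDensity lam (fadingWeight α (κ p)) p)) := by
  refine tendsto_lintegral_of_dominated_convergence (fun p => pairDensity lam (fun _ => 0) p)
    (fun n => hψ.mul ?_) (fun n => ae_of_all _ fun p => ?_) hfin (ae_of_all _ fun p => ?_)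
  · refine Measurable.indicator (s := {p : ℝ × ℝ | 0 < p.1 ∧ p.1 < p.2}) ?_ measurableSet_ordered
    have h1 := hκm n
    have h2 : Measurable fun p => fadingWeight α (κs n p) p.2 :=
      (measurable_fadingWeight α).comp ((hκm n).prodMk measurable_snd)
    have h3 : Measurable fun p => voidWeight lam (fadingWeight α (κs n p)) p.2 :=
      (measurable_voidWeight_fadingWeight lam α).comp ((hκm n).prodMk measurable_snd)
    fun_prop
  · exact (mul_le_of_le_one_left' (hψ1 p)).trans
      (pairDensity_le hlam (isRadialWeight_fadingWeight hlam hα (hκs n p)) p)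
  · refine ENNReal.Tendsto.const_mul ?_ (Or.inr ((hψ1 p).trans_lt ENNReal.one_lt_top).ne)
    unfold pairDensity
    by_cases hp : p ∈ {p : ℝ × ℝ | 0 < p.1 ∧ p.1 < p.2}
    · simp only [indicator_of_mem hp]
      refine ENNReal.Tendsto.const_mul (ENNReal.tendsto_ofReal ?_) (Or.inr ENNReal.ofReal_ne_top)
      refine Tendsto.mul_const _ (Tendsto.mul ?_ ?_)
      · exact (Real.continuous_exp.tendsto _).comp
          (((continuousAt_fadingWeight_left (hκ p) p.2).tendsto.comp (hlim p)).neg)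
      · exact tendsto_voidWeight_fadingWeight hlam hα (fun n => hκs n p) (hκ p) (hlim p)
          (hp.1.trans hp.2).le
    · simp only [indicator_of_notMem hp]
      exact tendsto_const_nhds

end FadingWeight

/-! ### The Laplace transform of the interference -/

section Network

lemma IsPoissonNetwork.ae_fading_pos {Ω : Type*} [MeasurableSpace Ω] {P : Measure Ω}
    {T : ℕ} {Φ : Fin T → Ω → Set Plane} {H : Fin T → ℕ → Ω → ℝ} {lam : Fin T → ℝ} {mu : ℝ}
    (hnet : IsPoissonNetwork P Φ H lam mu) :
    ∀ᵐ ω ∂P, ∀ i k, 0 < H i k ω := by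
  rw [ae_all_iff]; intro i
  rw [ae_all_iff]; intro k
  have h0 : expMeasure mu (Iic 0) = 0 := by
    have hatom : NullSingletonClass (expMeasure mu) := by
      unfold expMeasure gammaMeasure; infer_instance
    rw [← measure_congr Iio_ae_eq_Iic, expMeasure, gammaMeasure,
      withDensity_apply _ measurableSet_Iio]
    exact lintegral_exponentialPDF_of_nonpos le_rfl
  rw [← hnet.law_fading i k, Measure.map_apply (hnet.measurable_fading i k) measurableSet_Iic,
    measure_eq_zero_iff_ae_notMem] at h0
  filter_upwards [h0] with ω hω using not_le.1 hω

variable {Ω : Type*} [mΩ : MeasurableSpace Ω] {P : Measure Ω} [IsProbabilityMeasure P] {T : ℕ}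
  {Φ : Fin T → Ω → Set Plane} {H : Fin T → ℕ → Ω → ℝ} {lam : Fin T → ℝ} {mu α : ℝ}

/-- The independent σ-algebras of a network. -/
abbrev networkSigma {Ω : Type*} {T : ℕ} (Φ : Fin T → Ω → Set Plane) (H : Fin T → ℕ → Ω → ℝ) :
    Fin T ⊕ (Fin T × ℕ) → MeasurableSpace Ω :=
  Sum.elim (fun i => pointSigma (Φ i))
    (fun ij => MeasurableSpace.comap (H ij.1 ij.2) inferInstance)

lemma measurable_nthDist_pointSigma {Ω : Type*} (Φ : Ω → Set Plane) (k : ℕ) :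
    Measurable[pointSigma Φ] (nthDist Φ k) := by
  refine @measurable_nthDist Ω Φ (pointSigma Φ) (fun R => ?_) k
  refine Measurable.mono (comap_measurable _) ?_ le_rfl
  exact le_iSup (fun B : {B : Set Plane // MeasurableSet B} =>
    MeasurableSpace.comap (count Φ B.1) inferInstance)
    ⟨_, Metric.isClosed_closedBall.measurableSet⟩

lemma IsPoissonNetwork.networkSigma_le {Ω : Type*} [mΩ : MeasurableSpace Ω] {P : Measure Ω}
    {T : ℕ} {Φ : Fin T → Ω → Set Plane} {H : Fin T → ℕ → Ω → ℝ} {lam : Fin T → ℝ} {mu : ℝ}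
    (hnet : IsPoissonNetwork P Φ H lam mu) (s) : networkSigma Φ H s ≤ mΩ := by
  rcases s with i | ij
  · exact iSup_le fun B => ((hnet.poisson i).measurable_count B.1 B.2).comap_le
  · exact (hnet.measurable_fading ij.1 ij.2).comap_le

/-- The interference at the origin, per unit of transmission power, of all the points but the
nearest one. -/
def fadingSum {Ω : Type*} (Φ : Ω → Set Plane) (H : ℕ → Ω → ℝ) (α : ℝ) (ω : Ω) : ℝ≥0∞ :=
  ∑' k, ENNReal.ofReal (H (k + 1) ω * nthDist Φ (k + 1) ω ^ (-α))

lemma measurable_fadingSum {Ω : Type*} {m : MeasurableSpace Ω} {Φ : Ω → Set Plane}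
    {H : ℕ → Ω → ℝ} (hr : ∀ k, Measurable (nthDist Φ k)) (hH : ∀ k, Measurable (H (k + 1))) (α : ℝ) :
    Measurable (fadingSum Φ H α) :=
  Measurable.tsum fun k =>
    ENNReal.measurable_ofReal.comp ((hH k).mul ((hr (k + 1)).pow_const _))

/-- Given the points, each e^{-θ H_k r_k^{-α}} averages to e^{-h(r_k)} with h = `fadingWeight α (θ /
mu)`, independently over k, and `lintegral_pair` evaluates the result. Independence handles finitely
many interferers; dominated convergence then gives all of them. -/
lemma IsPoissonNetwork.laplace_fadingSum (hnet : IsPoissonNetwork P Φ H lam mu) (i : Fin T)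
    (hlam : 0 < lam i) (hmu : 0 < mu) (hα : 2 < α) {θ : ℝ} (hθ : 0 ≤ θ)
    {ψ : ℝ × ℝ → ℝ≥0∞} (hψ : Measurable ψ) (hψ1 : ∀ p, ψ p ≤ 1) :
    ∫⁻ ω, ψ (nthDist (Φ i) 0 ω, nthDist (Φ i) 1 ω) *
        expNeg (ENNReal.ofReal θ * fadingSum (Φ i) (H i) α ω) ∂P =
      ∫⁻ p, ψ p * pairDensity (lam i) (fadingWeight α (θ / mu)) p := by
  have hκ : 0 ≤ θ / mu := by positivity
  have hrm := (hnet.poisson i).measurable_nthDist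
  have hHm := hnet.measurable_fading i
  have hw := isRadialWeight_fadingWeight hlam hα hκ
  have hA : (⨆ s ∈ ({Sum.inl i} : Set (Fin T ⊕ (Fin T × ℕ))), networkSigma Φ H s) =
      pointSigma (Φ i) := iSup_singleton
  have hZ : Measurable[⨆ s ∈ ({Sum.inl i} : Set (Fin T ⊕ (Fin T × ℕ))), networkSigma Φ H s]
      fun ω => ψ (nthDist (Φ i) 0 ω, nthDist (Φ i) 1 ω) := by
    rw [hA]
    exact hψ.comp ((measurable_nthDist_pointSigma (Φ i) 0).prodMk
      (measurable_nthDist_pointSigma (Φ i) 1))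
  have hn : ∀ n, ∫⁻ ω, ψ (nthDist (Φ i) 0 ω, nthDist (Φ i) 1 ω) *
        ∏ k ∈ Finset.range n, expNeg (ENNReal.ofReal
          (θ * nthDist (Φ i) (k + 1) ω ^ (-α) * H i (k + 1) ω)) ∂P =
      ∫⁻ ω, ψ (nthDist (Φ i) 0 ω, nthDist (Φ i) 1 ω) *
        expNeg (∑ k ∈ Finset.range n, ENNReal.ofReal
          (fadingWeight α (θ / mu) (nthDist (Φ i) (k + 1) ω))) ∂P := by
    intro n
    rw [lintegral_mul_prod_of_iIndep (hnet.networkSigma_le) hnet.indep {Sum.inl i}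
      (fun k : ℕ => Sum.inr (i, k + 1)) (fun a b h => by simpa using h) (Finset.range n)
      (fun k _ => by simp) (W := fun k ω => nthDist (Φ i) (k + 1) ω ^ (-α)) ?_
      (Y := fun k ω => H i (k + 1) ω) (fun k => comap_measurable _)
      (φ := fun _ w y => expNeg (ENNReal.ofReal (θ * w * y))) (fun k => ?_) hZ]
    · refine lintegral_congr fun ω => ?_
      rw [expNeg_sum]
      congr 1
      refine Finset.prod_congr rfl fun k _ => ?_
      have hr := nthDist_nonneg (Φ := Φ i) (k + 1) ω
      rw [← lintegral_map (f := fun y => expNeg (ENNReal.ofReal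
          (θ * nthDist (Φ i) (k + 1) ω ^ (-α) * y))) (by fun_prop) (hHm (k + 1)),
        hnet.law_fading, lintegral_expNeg_expMeasure hmu (by positivity),
        expNeg_ofReal (fadingWeight_nonneg hκ _), exp_neg_fadingWeight hκ, abs_of_nonneg hr]
      congr 3; ring
    · intro k
      rw [hA]
      exact (measurable_nthDist_pointSigma (Φ i) (k + 1)).pow_const _
    · unfold Function.uncurry; fun_prop
  rw [← (hnet.poisson i).lintegral_pair hlam hw hψ]
  have hψm : Measurable fun ω => ψ (nthDist (Φ i) 0 ω, nthDist (Φ i) 1 ω) :=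
    hψ.comp ((hrm 0).prodMk (hrm 1))
  have hL : Tendsto (fun n => ∫⁻ ω, ψ (nthDist (Φ i) 0 ω, nthDist (Φ i) 1 ω) *
        ∏ k ∈ Finset.range n, expNeg (ENNReal.ofReal
          (θ * nthDist (Φ i) (k + 1) ω ^ (-α) * H i (k + 1) ω)) ∂P) atTop
      (𝓝 (∫⁻ ω, ψ (nthDist (Φ i) 0 ω, nthDist (Φ i) 1 ω) *
        expNeg (ENNReal.ofReal θ * fadingSum (Φ i) (H i) α ω) ∂P)) := by
    simp_rw [← expNeg_sum]
    refine tendsto_lintegral_of_dominated_convergence (fun _ => 1) (fun n => by fun_prop)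
      (fun n => ae_of_all _ fun ω => mul_le_one' (hψ1 _) (expNeg_le_one _)) (by simp)
      (ae_of_all _ fun ω => ENNReal.Tendsto.const_mul ?_
        (Or.inr ((hψ1 _).trans_lt ENNReal.one_lt_top).ne))
    refine (continuous_expNeg.tendsto _).comp ?_
    have : ENNReal.ofReal θ * fadingSum (Φ i) (H i) α ω =
        ∑' k, ENNReal.ofReal (θ * nthDist (Φ i) (k + 1) ω ^ (-α) * H i (k + 1) ω) := by
      rw [fadingSum, ← ENNReal.tsum_mul_left]
      refine tsum_congr fun k => ?_
      rw [← ENNReal.ofReal_mul hθ]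
      congr 1; ring
    rw [this]
    exact ENNReal.tendsto_nat_tsum _
  have hR : Tendsto (fun n => ∫⁻ ω, ψ (nthDist (Φ i) 0 ω, nthDist (Φ i) 1 ω) *
        expNeg (∑ k ∈ Finset.range n, ENNReal.ofReal
          (fadingWeight α (θ / mu) (nthDist (Φ i) (k + 1) ω))) ∂P) atTop
      (𝓝 (∫⁻ ω, ψ (nthDist (Φ i) 0 ω, nthDist (Φ i) 1 ω) *
        expNeg (∑' k, ENNReal.ofReal
          (fadingWeight α (θ / mu) (nthDist (Φ i) (k + 1) ω))) ∂P)) := by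
    have := hw.measurable
    refine tendsto_lintegral_of_dominated_convergence (fun _ => 1) (fun n => by fun_prop)
      (fun n => ae_of_all _ fun ω => mul_le_one' (hψ1 _) (expNeg_le_one _)) (by simp)
      (ae_of_all _ fun ω => ENNReal.Tendsto.const_mul ?_
        (Or.inr ((hψ1 _).trans_lt ENNReal.one_lt_top).ne))
    exact (continuous_expNeg.tendsto _).comp (ENNReal.tendsto_nat_tsum _)
  simp_rw [hn] at hL
  exact tendsto_nhds_unique hL hR

lemma IsPoissonPointProcess.lintegral_pairDensity_zero {Φ : Ω → Set Plane} {lam : ℝ}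
    (hp : IsPoissonPointProcess P Φ lam) (hlam : 0 < lam) :
    ∫⁻ p, pairDensity lam (fun _ => 0) p = 1 := by
  have := hp.lintegral_pair hlam (IsRadialWeight.zero lam) (ψ := fun _ => 1) measurable_const
  simpa using this.symm

/-- As θ → 0, e^{-θI} tends to the indicator of I < ∞, while its expectation tends to the mass 1 of
the unweighted density. -/
lemma IsPoissonNetwork.ae_fadingSum_lt_top (hnet : IsPoissonNetwork P Φ H lam mu) (i : Fin T)
    (hlam : 0 < lam i) (hmu : 0 < mu) (hα : 2 < α) :
    ∀ᵐ ω ∂P, fadingSum (Φ i) (H i) α ω < ⊤ := by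
  have hI := measurable_fadingSum (hnet.poisson i).measurable_nthDist
    (fun k => hnet.measurable_fading i (k + 1)) α
  have h1 := (hnet.poisson i).lintegral_pairDensity_zero hlam
  have hθ : Tendsto (fun n : ℕ => (1 / ((n : ℝ) + 1)) / mu) atTop (𝓝 0) := by
    simpa using tendsto_one_div_add_atTop_nhds_zero_nat.div_const mu
  have hR := lintegral_tendsto_pairDensity hlam hα (by rw [h1]; exact ENNReal.one_ne_top)
    (κs := fun n _ => (1 / ((n : ℝ) + 1)) / mu) (κ := fun _ => 0) (fun n => measurable_const)
    (fun n p => by positivity) (fun p => le_rfl) (fun p => hθ) (ψ := fun _ => 1)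
    measurable_const (fun p => le_rfl)
  have hn : ∀ n : ℕ, _ := fun n => hnet.laplace_fadingSum i hlam hmu hα
    (θ := 1 / ((n : ℝ) + 1)) (by positivity) (ψ := fun _ => 1) measurable_const (fun p => le_rfl)
  simp_rw [← hn] at hR
  simp only [one_mul, fadingWeight_zero, h1] at hR
  have hL : Tendsto (fun n : ℕ => ∫⁻ ω, expNeg (ENNReal.ofReal (1 / ((n : ℝ) + 1)) *
      fadingSum (Φ i) (H i) α ω) ∂P) atTop
      (𝓝 (∫⁻ ω, {ω | fadingSum (Φ i) (H i) α ω < ⊤}.indicator 1 ω ∂P)) := by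
    refine tendsto_lintegral_of_dominated_convergence (fun _ => 1) (fun n => by fun_prop)
      (fun n => ae_of_all _ fun ω => expNeg_le_one _) (by simp) (ae_of_all _ fun ω => ?_)
    by_cases hω : fadingSum (Φ i) (H i) α ω < ⊤
    · rw [indicator_of_mem (show ω ∈ {ω | fadingSum (Φ i) (H i) α ω < ⊤} from hω),
        Pi.one_apply, ← expNeg_zero]
      refine (continuous_expNeg.tendsto _).comp ?_
      rw [← zero_mul (fadingSum (Φ i) (H i) α ω)]
      refine ENNReal.Tendsto.mul_const ?_ (Or.inr hω.ne)
      simpa using ENNReal.tendsto_ofReal (tendsto_one_div_add_atTop_nhds_zero_nat (𝕜 := ℝ))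
    · rw [indicator_of_notMem (show ω ∉ {ω | fadingSum (Φ i) (H i) α ω < ⊤} from hω),
        not_lt_top_iff.1 hω]
      have : ∀ n : ℕ, expNeg (ENNReal.ofReal (1 / ((n : ℝ) + 1)) * ⊤) = 0 := fun n => by
        rw [ENNReal.mul_top, expNeg_top]
        simp only [ne_eq, ENNReal.ofReal_eq_zero, not_le]
        positivity
      simp only [this]
      exact tendsto_const_nhds
  have hS : MeasurableSet {ω | fadingSum (Φ i) (H i) α ω < ⊤} :=
    measurableSet_lt hI measurable_const
  rw [lintegral_indicator_one hS] at hL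
  exact (mem_ae_iff_prob_eq_one hS).2 (tendsto_nhds_unique hL hR)

end Network

/-! ### The coverage formula given two distances -/

section CoverTwo

variable {α mu lam pow noise b : ℝ}

lemma measurable_coverTwo (α mu lam pow noise : ℝ) :
    Measurable fun p : ℝ × ℝ × ℝ => coverTwo α mu lam pow noise p.1 p.2.1 p.2.2 := by
  have hI : Measurable fun p : ℝ × ℝ × ℝ => ∫ u in Ioi p.2.2,
      1 / (1 + p.1⁻¹ * (u / p.2.1) ^ α) * u := by
    have h1 : ∀ p : ℝ × ℝ × ℝ, ∫ u in Ioi p.2.2, 1 / (1 + p.1⁻¹ * (u / p.2.1) ^ α) * u =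
        ∫ u, ({q : (ℝ × ℝ × ℝ) × ℝ | q.1.2.2 < q.2}.indicator
          (fun q => 1 / (1 + q.1.1⁻¹ * (q.2 / q.1.2.1) ^ α) * q.2)) (p, u) := fun p => by
      rw [← integral_indicator measurableSet_Ioi]; rfl
    simp_rw [h1]
    refine (StronglyMeasurable.integral_prod_right (f := fun p u =>
      ({q : (ℝ × ℝ × ℝ) × ℝ | q.1.2.2 < q.2}.indicator
          (fun q => 1 / (1 + q.1.1⁻¹ * (q.2 / q.1.2.1) ^ α) * q.2)) (p, u)) ?_).measurable
    exact (Measurable.indicator (by fun_prop)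
      (measurableSet_lt measurable_fst.snd.snd measurable_snd)).stronglyMeasurable
  unfold coverTwo
  fun_prop

lemma coverTwo_pos (hb : 0 < b) {x y : ℝ} (hx : 0 < x) (hy : 0 < y) :
    0 < coverTwo α mu lam pow noise b x y := by
  unfold coverTwo
  have : 0 < (x / y) ^ α := Real.rpow_pos_of_pos (div_pos hx hy) _
  positivity

/-- Only the interference of the second nearest point is kept; the other two factors are at most 1.
-/
lemma coverTwo_le (hlam : 0 < lam) (hmu : 0 < mu) (hpow : 0 < pow) (hnoise : 0 ≤ noise)
    (hb : 0 < b) {x y : ℝ} (hx : 0 < x) (hy : 0 < y) :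
    coverTwo α mu lam pow noise b x y ≤ 1 / (1 + b * (x / y) ^ α) := by
  have h0 : 0 < (x / y) ^ α := Real.rpow_pos_of_pos (div_pos hx hy) _
  have h1 : Real.exp (-(mu * b * noise * x ^ α * pow⁻¹)) ≤ 1 := by
    rw [Real.exp_le_one_iff, neg_nonpos]; positivity
  have hI : 0 ≤ ∫ u in Ioi y, 1 / (1 + b⁻¹ * (u / x) ^ α) * u :=
    setIntegral_nonneg measurableSet_Ioi fun u hu => by
      have hu0 : 0 < u := hy.trans hu
      positivity
  have h2 : Real.exp (-(2 * Real.pi * lam * ∫ u in Ioi y, 1 / (1 + b⁻¹ * (u / x) ^ α) * u)) ≤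
      1 := by
    rw [Real.exp_le_one_iff, neg_nonpos]
    have := Real.pi_pos
    positivity
  unfold coverTwo
  calc _ ≤ 1 * (1 / (1 + b * (x / y) ^ α)) * 1 := by gcongr
    _ = _ := by ring

/-- For κ = b r₁^α one has κ u^{-α} = b (r₁/u)^α. Hence e^{-h(r₂)} is the middle factor of
`coverTwo`, and the void weight splits into the unweighted one, e^{-πλ r₂²}, and the interference
exponential. -/
lemma exp_neg_mul_pairDensity (hlam : 0 < lam) (hb : 0 < b) (p : ℝ × ℝ) :
    ENNReal.ofReal (Real.exp (-(mu * b * noise * p.1 ^ α * pow⁻¹))) *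
        pairDensity lam (fadingWeight α (b * |p.1| ^ α)) p =
      ENNReal.ofReal (coverTwo α mu lam pow noise b p.1 p.2) *
        pairDensity lam (fun _ => 0) p := by
  obtain ⟨x, y⟩ := p
  unfold pairDensity
  by_cases hp : (x, y) ∈ {p : ℝ × ℝ | 0 < p.1 ∧ p.1 < p.2}
  swap
  · simp only [indicator_of_notMem hp, mul_zero]
  have hx : 0 < x := hp.1
  have hy : 0 < y := hx.trans hp.2
  have hκ : 0 ≤ b * |x| ^ α := by positivity
  simp only [indicator_of_mem hp]
  have hxy : ∀ u, 0 < u → b * |x| ^ α * |u| ^ (-α) = b * (x / u) ^ α := fun u hu => by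
    rw [abs_of_pos hx, abs_of_pos hu, Real.div_rpow hx.le hu.le, Real.rpow_neg hu.le,
      div_eq_mul_inv]
    ring
  have hI : ∫ u in Ioi y, (1 - Real.exp (-fadingWeight α (b * |x| ^ α) u)) *
        radialIntensity lam u =
      2 * Real.pi * lam * ∫ u in Ioi y, 1 / (1 + b⁻¹ * (u / x) ^ α) * u := by
    rw [← integral_const_mul]
    refine setIntegral_congr_fun measurableSet_Ioi fun u hu => ?_
    have hu0 : 0 < u := hy.trans hu
    rw [exp_neg_fadingWeight hκ, hxy u hu0, radialIntensity]
    have h1 : (u / x) ^ α = ((x / u) ^ α)⁻¹ := by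
      rw [← Real.inv_rpow (div_pos hx hu0).le, inv_div]
    have h2 : 0 < (x / u) ^ α := Real.rpow_pos_of_pos (div_pos hx hu0) _
    rw [h1]
    field_simp
    ring
  have hρ := radialIntensity_nonneg hlam hy.le
  rw [exp_neg_fadingWeight hκ, hxy y hy, voidWeight, hI, voidWeight_zero, coverTwo]
  simp only [neg_zero, Real.exp_zero, one_mul]
  set A := Real.exp (-(mu * b * noise * x ^ α * pow⁻¹))
  set B := 1 / (1 + b * (x / y) ^ α) with hB
  set J := ∫ u in Ioi y, 1 / (1 + b⁻¹ * (u / x) ^ α) * u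
  have hB0 : 0 ≤ B := by
    have : 0 < (x / y) ^ α := Real.rpow_pos_of_pos (div_pos hx hy) _
    positivity
  have hA0 : 0 ≤ A := (Real.exp_pos _).le
  rw [neg_add, Real.exp_add]
  set E := Real.exp (-(2 * Real.pi * lam * J))
  set G := Real.exp (-(Real.pi * lam * y ^ 2))
  have hE0 : 0 ≤ E := (Real.exp_pos _).le
  have hG0 : 0 ≤ G := (Real.exp_pos _).le
  have hmain : ENNReal.ofReal A * ENNReal.ofReal (B * (G * E) * radialIntensity lam y) =
      ENNReal.ofReal (A * B * E) * ENNReal.ofReal (G * radialIntensity lam y) := by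
    rw [← ENNReal.ofReal_mul hA0, ← ENNReal.ofReal_mul (mul_nonneg (mul_nonneg hA0 hB0) hE0)]
    congr 1; ring
  rw [mul_left_comm, hmain, mul_left_comm]

end CoverTwo

/-! ### Random Laplace argument and the coverage event -/

section Network

variable {Ω : Type*} [mΩ : MeasurableSpace Ω] {P : Measure Ω} [IsProbabilityMeasure P] {T : ℕ}
  {Φ : Fin T → Ω → Set Plane} {H : Fin T → ℕ → Ω → ℝ} {lam : Fin T → ℝ} {mu α : ℝ}

/-- On each fibre of θ the argument is constant, and the indicator of the fibre can be absorbed into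
ψ. -/
lemma IsPoissonNetwork.laplace_fadingSum_simpleFunc (hnet : IsPoissonNetwork P Φ H lam mu)
    (i : Fin T) (hlam : 0 < lam i) (hmu : 0 < mu) (hα : 2 < α) (θ : SimpleFunc (ℝ × ℝ) ℝ≥0)
    {ψ : ℝ × ℝ → ℝ≥0∞} (hψ : Measurable ψ) (hψ1 : ∀ p, ψ p ≤ 1) :
    ∫⁻ ω, ψ (nthDist (Φ i) 0 ω, nthDist (Φ i) 1 ω) *
        expNeg (θ (nthDist (Φ i) 0 ω, nthDist (Φ i) 1 ω) * fadingSum (Φ i) (H i) α ω) ∂P =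
      ∫⁻ p, ψ p * pairDensity (lam i) (fadingWeight α (θ p / mu)) p := by
  have hrm := (hnet.poisson i).measurable_nthDist
  have hI := measurable_fadingSum hrm (fun k => hnet.measurable_fading i (k + 1)) α
  have hR : Measurable fun ω => (nthDist (Φ i) 0 ω, nthDist (Φ i) 1 ω) :=
    (hrm 0).prodMk (hrm 1)
  have hsum : ∀ (p : ℝ × ℝ) (F : ℝ≥0 → ℝ≥0∞), ψ p * F (θ p) =
      ∑ y ∈ θ.range, (θ ⁻¹' {y}).indicator ψ p * F y := by
    intro p F
    rw [Finset.sum_eq_single (θ p)]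
    · rw [indicator_of_mem (show p ∈ θ ⁻¹' {θ p} from rfl)]
    · intro y _ hy
      rw [indicator_of_notMem (show p ∉ θ ⁻¹' {y} from fun h => hy (mem_singleton_iff.1 h).symm),
        zero_mul]
    · exact fun h => (h (SimpleFunc.mem_range_self θ p)).elim
  have hψy : ∀ y, Measurable ((θ ⁻¹' {y}).indicator ψ) := fun y =>
    hψ.indicator (θ.measurableSet_fiber y)
  calc _ = ∫⁻ ω, ∑ y ∈ θ.range,
        (θ ⁻¹' {y}).indicator ψ (nthDist (Φ i) 0 ω, nthDist (Φ i) 1 ω) *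
          expNeg (y * fadingSum (Φ i) (H i) α ω) ∂P :=
        lintegral_congr fun ω => hsum _ fun y => expNeg (y * fadingSum (Φ i) (H i) α ω)
    _ = ∑ y ∈ θ.range, ∫⁻ p, (θ ⁻¹' {y}).indicator ψ p *
          pairDensity (lam i) (fadingWeight α (y / mu)) p := by
        rw [lintegral_finsetSum _ (f := fun y ω =>
          (θ ⁻¹' {y}).indicator ψ (nthDist (Φ i) 0 ω, nthDist (Φ i) 1 ω) *
          expNeg (y * fadingSum (Φ i) (H i) α ω)) fun y _ => ((hψy y).comp hR).mul (by fun_prop)]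
        refine Finset.sum_congr rfl fun y _ => ?_
        rw [← hnet.laplace_fadingSum i hlam hmu hα y.coe_nonneg (hψy y)
          (fun p => indicator_apply_le' (fun _ => hψ1 p) fun _ => zero_le),
          ENNReal.ofReal_coe_nnreal]
    _ = _ := by
        rw [← lintegral_finsetSum _ (f := fun (y : ℝ≥0) p => (θ ⁻¹' {y}).indicator ψ p *
          pairDensity (lam i) (fadingWeight α (y / mu)) p) fun y _ => (hψy y).mul
          (isRadialWeight_fadingWeight hlam hα (by positivity)).measurable_pairDensity]
        exact lintegral_congr fun p => (hsum p fun y =>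
          pairDensity (lam i) (fadingWeight α (y / mu)) p).symm

/-- Approximation of θ by simple functions. Almost sure finiteness of I is what makes θₙ I converge
to θ I, since multiplication on `[0, ∞]` is not continuous at (0, ∞). -/
lemma IsPoissonNetwork.laplace_fadingSum_random (hnet : IsPoissonNetwork P Φ H lam mu)
    (i : Fin T) (hlam : 0 < lam i) (hmu : 0 < mu) (hα : 2 < α) {θ : ℝ × ℝ → ℝ≥0}
    (hθ : Measurable θ) {ψ : ℝ × ℝ → ℝ≥0∞} (hψ : Measurable ψ) (hψ1 : ∀ p, ψ p ≤ 1) :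
    ∫⁻ ω, ψ (nthDist (Φ i) 0 ω, nthDist (Φ i) 1 ω) *
        expNeg (θ (nthDist (Φ i) 0 ω, nthDist (Φ i) 1 ω) * fadingSum (Φ i) (H i) α ω) ∂P =
      ∫⁻ p, ψ p * pairDensity (lam i) (fadingWeight α (θ p / mu)) p := by
  have hrm := (hnet.poisson i).measurable_nthDist
  have hI := measurable_fadingSum hrm (fun k => hnet.measurable_fading i (k + 1)) α
  have hR : Measurable fun ω => (nthDist (Φ i) 0 ω, nthDist (Φ i) 1 ω) :=
    (hrm 0).prodMk (hrm 1)
  let s : ℕ → SimpleFunc (ℝ × ℝ) ℝ≥0 := hθ.stronglyMeasurable.approx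
  have hs : ∀ p, Tendsto (fun n => s n p) atTop (𝓝 (θ p)) :=
    hθ.stronglyMeasurable.tendsto_approx
  have hfin : ∫⁻ p, pairDensity (lam i) (fun _ => 0) p ≠ ⊤ := by
    rw [(hnet.poisson i).lintegral_pairDensity_zero hlam]; exact ENNReal.one_ne_top
  have h1 := lintegral_tendsto_pairDensity hlam hα hfin (κs := fun n p => s n p / mu)
    (κ := fun p => θ p / mu)
    (fun n => (measurable_coe_nnreal_real.comp (s n).measurable).div_const mu)
    (fun n p => by positivity) (fun p => by positivity)
    (fun p => ((NNReal.tendsto_coe.2 (hs p)).div_const mu)) hψ hψ1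
  have h2 : Tendsto (fun n => ∫⁻ ω, ψ (nthDist (Φ i) 0 ω, nthDist (Φ i) 1 ω) *
        expNeg (s n (nthDist (Φ i) 0 ω, nthDist (Φ i) 1 ω) * fadingSum (Φ i) (H i) α ω) ∂P) atTop
      (𝓝 (∫⁻ ω, ψ (nthDist (Φ i) 0 ω, nthDist (Φ i) 1 ω) *
        expNeg (θ (nthDist (Φ i) 0 ω, nthDist (Φ i) 1 ω) * fadingSum (Φ i) (H i) α ω) ∂P)) := by
    refine tendsto_lintegral_of_dominated_convergence (fun _ => 1) (fun n => ?_)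
      (fun n => ae_of_all _ fun ω => mul_le_one' (hψ1 _) (expNeg_le_one _)) (by simp) ?_
    · have := (s n).measurable.comp hR
      exact (hψ.comp hR).mul (measurable_expNeg.comp
        ((measurable_coe_nnreal_ennreal.comp this).mul hI))
    · filter_upwards [hnet.ae_fadingSum_lt_top i hlam hmu hα] with ω hω
      refine ENNReal.Tendsto.const_mul ?_ (Or.inr ((hψ1 _).trans_lt ENNReal.one_lt_top).ne)
      refine (continuous_expNeg.tendsto _).comp (ENNReal.Tendsto.mul_const ?_ (Or.inr hω.ne))
      exact ENNReal.tendsto_coe.2 (hs _)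
  simp_rw [hnet.laplace_fadingSum_simpleFunc i hlam hmu hα (s _) hψ hψ1] at h2
  exact tendsto_nhds_unique h2 h1

/-- The value that the fading coefficient of the nearest point has to reach in order that the
signal to interference plus noise ratio be at least `b`. -/
def fadingThreshold {Ω : Type*} (Φ : Ω → Set Plane) (H : ℕ → Ω → ℝ) (α pow noise b : ℝ) (ω : Ω) :
    ℝ≥0∞ :=
  ENNReal.ofReal (b * nthDist Φ 0 ω ^ α) * (ENNReal.ofReal (noise / pow) + fadingSum Φ H α ω)

/-- The event that the signal to interference plus noise ratio is at least `b`. -/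
def coverEvent {Ω : Type*} (Φ : Ω → Set Plane) (H : ℕ → Ω → ℝ) (α pow noise b : ℝ) : Set Ω :=
  {ω | fadingThreshold Φ H α pow noise b ω ≤ ENNReal.ofReal (H 0 ω)}

lemma measurableSet_coverEvent {Ω : Type*} {m : MeasurableSpace Ω} {Φ : Ω → Set Plane}
    {H : ℕ → Ω → ℝ} (hr : ∀ k, Measurable (nthDist Φ k)) (hH : ∀ k, Measurable (H k))
    (α pow noise b : ℝ) : MeasurableSet (coverEvent Φ H α pow noise b) := by
  have hI := measurable_fadingSum hr (fun k => hH (k + 1)) α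
  have h0 := hr 0
  have hH0 := hH 0
  unfold coverEvent fadingThreshold
  exact measurableSet_le (by fun_prop) (by fun_prop)

variable {pow noise b : ℝ}

/-- The coefficient H₀ is independent of the points and of the other coefficients, so the event has
conditional probability e^{-μW} with W the threshold; e^{-μW} is a noise factor times e^{-θI}, where
θ = μ b r₀^α. -/
lemma IsPoissonNetwork.lintegral_coverEvent (hnet : IsPoissonNetwork P Φ H lam mu)
    (i : Fin T) (hlam : 0 < lam i) (hmu : 0 < mu) (hα : 2 < α) (hpow : 0 < pow)
    (hnoise : 0 ≤ noise) (hb : 0 < b) {ψ : ℝ × ℝ → ℝ≥0∞} (hψ : Measurable ψ)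
    (hψ1 : ∀ p, ψ p ≤ 1) :
    ∫⁻ ω, ψ (nthDist (Φ i) 0 ω, nthDist (Φ i) 1 ω) *
        (coverEvent (Φ i) (H i) α pow noise b).indicator 1 ω ∂P =
      ∫⁻ ω, ψ (nthDist (Φ i) 0 ω, nthDist (Φ i) 1 ω) * ENNReal.ofReal
        (coverTwo α mu (lam i) pow noise b (nthDist (Φ i) 0 ω) (nthDist (Φ i) 1 ω)) ∂P := by
  have hrm := (hnet.poisson i).measurable_nthDist
  set A : Set (Fin T ⊕ (Fin T × ℕ)) := insert (Sum.inl i) {s | ∃ k, s = Sum.inr (i, k + 1)}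
  have hAr : ∀ k, Measurable[⨆ s ∈ A, networkSigma Φ H s] (nthDist (Φ i) k) := fun k =>
    (measurable_nthDist_pointSigma (Φ i) k).mono
      (le_biSup (networkSigma Φ H) (i := Sum.inl i) (mem_insert _ _)) le_rfl
  have hAH : ∀ k, Measurable[⨆ s ∈ A, networkSigma Φ H s] (H i (k + 1)) := fun k =>
    (comap_measurable (H i (k + 1))).mono
      (le_biSup (networkSigma Φ H) (i := Sum.inr (i, k + 1)) (Or.inr ⟨k, rfl⟩)) le_rfl
  have hAI : Measurable[⨆ s ∈ A, networkSigma Φ H s] (fadingSum (Φ i) (H i) α) :=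
    measurable_fadingSum hAr hAH α
  have hAW : Measurable[⨆ s ∈ A, networkSigma Φ H s]
      (fadingThreshold (Φ i) (H i) α pow noise b) :=
    (ENNReal.measurable_ofReal.comp (((hAr 0).pow_const _).const_mul b)).mul
      (hAI.const_add _)
  have hAZ : Measurable[⨆ s ∈ A, networkSigma Φ H s]
      fun ω => ψ (nthDist (Φ i) 0 ω, nthDist (Φ i) 1 ω) := hψ.comp ((hAr 0).prodMk (hAr 1))
  have hind : Indep (⨆ s ∈ A, networkSigma Φ H s) (networkSigma Φ H (Sum.inr (i, 0))) P := by
    have := indep_iSup_of_disjoint hnet.networkSigma_le hnet.indep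
      (S := A) (T := {Sum.inr (i, 0)}) (by
        rw [disjoint_singleton_right]
        rintro (h | ⟨k, h⟩)
        · simp at h
        · simp at h)
    simpa only [mem_singleton_iff, iSup_iSup_eq_left] using this
  have h1 := lintegral_mul_of_indep (iSup₂_le fun s _ => hnet.networkSigma_le s)
    (hnet.networkSigma_le (Sum.inr (i, 0))) hind hAZ hAW (comap_measurable (H i 0))
    (φ := fun w y => {q : ℝ≥0∞ × ℝ | q.1 ≤ ENNReal.ofReal q.2}.indicator 1 (w, y))
    (measurable_const.indicator (measurableSet_le measurable_fst
      (ENNReal.measurable_ofReal.comp measurable_snd)))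
  have h2 : ∀ w : ℝ≥0∞, ∫⁻ ω', {q : ℝ≥0∞ × ℝ | q.1 ≤ ENNReal.ofReal q.2}.indicator 1
      (w, H i 0 ω') ∂P = expNeg (ENNReal.ofReal mu * w) := fun w => by
    rw [← expMeasure_ofReal_ge hmu, ← hnet.law_fading i 0, lintegral_map _
      (hnet.measurable_fading i 0)]
    exact (measurable_const.indicator (measurableSet_le measurable_fst
      (ENNReal.measurable_ofReal.comp measurable_snd))).comp measurable_prodMk_left
  simp_rw [h2] at h1
  refine h1.trans ?_
  -- The absolute value keeps the argument of `Real.toNNReal` nonnegative on all of ℝ², so nothing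
  -- is truncated. Division by μ in the fading weight will leave κ = b r₀^α.
  set θ : ℝ × ℝ → ℝ≥0 := fun p => Real.toNNReal (mu * (b * |p.1| ^ α)) with hθ
  have hθm : Measurable θ := by fun_prop
  set ψ' : ℝ × ℝ → ℝ≥0∞ := fun p => ψ p *
    ENNReal.ofReal (Real.exp (-(mu * b * noise * |p.1| ^ α * pow⁻¹))) with hψ'
  have hψ'm : Measurable ψ' := by fun_prop
  have hψ'1 : ∀ p, ψ' p ≤ 1 := fun p => by
    refine mul_le_one' (hψ1 p) (ENNReal.ofReal_le_one.2 ?_)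
    rw [Real.exp_le_one_iff, neg_nonpos]; positivity
  have h3 := hnet.laplace_fadingSum_random i hlam hmu hα hθm hψ'm hψ'1
  have h4 : ∀ ω, ψ (nthDist (Φ i) 0 ω, nthDist (Φ i) 1 ω) *
      expNeg (ENNReal.ofReal mu * fadingThreshold (Φ i) (H i) α pow noise b ω) =
      ψ' (nthDist (Φ i) 0 ω, nthDist (Φ i) 1 ω) *
        expNeg (θ (nthDist (Φ i) 0 ω, nthDist (Φ i) 1 ω) * fadingSum (Φ i) (H i) α ω) := by
    intro ω
    have hr := nthDist_nonneg (Φ := Φ i) 0 ω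
    have h5 : ENNReal.ofReal mu * fadingThreshold (Φ i) (H i) α pow noise b ω =
        ENNReal.ofReal (mu * b * noise * |nthDist (Φ i) 0 ω| ^ α * pow⁻¹) +
          θ (nthDist (Φ i) 0 ω, nthDist (Φ i) 1 ω) * fadingSum (Φ i) (H i) α ω := by
      rw [fadingThreshold, ← mul_assoc, mul_add, ← ENNReal.ofReal_mul hmu.le,
        ← ENNReal.ofReal_mul (by positivity)]
      simp only [hθ, abs_of_nonneg hr]
      congr 2
      rw [div_eq_mul_inv]; ring
    rw [h5, expNeg_add, expNeg_ofReal (by positivity)]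
    simp only [hψ']
    ring
  simp_rw [h4]
  rw [h3]
  have hcov := measurable_coverTwo α mu (lam i) pow noise
  have hcm : Measurable fun p : ℝ × ℝ =>
      ENNReal.ofReal (coverTwo α mu (lam i) pow noise b p.1 p.2) :=
    ENNReal.measurable_ofReal.comp (hcov.comp
      (measurable_const.prodMk (measurable_fst.prodMk measurable_snd)))
  have h6 := (hnet.poisson i).lintegral_pair hlam (IsRadialWeight.zero (lam i)) (hψ.mul hcm)
  simp only [ENNReal.ofReal_zero, tsum_zero, expNeg_zero, mul_one, Pi.mul_apply] at h6
  rw [h6]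
  refine lintegral_congr fun p => ?_
  have hθp : (θ p : ℝ) / mu = b * |p.1| ^ α := by
    rw [hθ, Real.coe_toNNReal _ (by positivity)]
    field_simp
  simp only [hψ']
  rw [mul_assoc (ψ p), mul_assoc (ψ p), hθp]
  congr 1
  by_cases hp : 0 < p.1
  · rw [← exp_neg_mul_pairDensity hlam hb, abs_of_pos hp]
  · have : ∀ h, pairDensity (lam i) h p = 0 := fun h => indicator_of_notMem (fun h' => hp h'.1) _
    rw [this, this, mul_zero, mul_zero]

end Network

/-! ### Conditional coverage probabilities and the SINR -/

/-- The defining property of conditional expectation, checked in `[0, ∞]`. The function `f` need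
only agree almost surely with an indicator, because the SINR is identified with the coverage event
only off a null set. -/
lemma condExp_indicator_eq_of_lintegral {Ω E : Type*} [mΩ : MeasurableSpace Ω] {P : Measure Ω}
    [IsProbabilityMeasure P] [MeasurableSpace E] {X : Ω → E} (hX : Measurable X) {f : Ω → ℝ}
    {S : Set Ω} (hS : MeasurableSet S) (hf : f =ᵐ[P] S.indicator 1) {g : E → ℝ}
    (hg : Measurable g) (hg0 : ∀ᵐ ω ∂P, 0 ≤ g (X ω))
    (h : ∀ B, MeasurableSet B → ∫⁻ ω, B.indicator 1 (X ω) * S.indicator 1 ω ∂P =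
      ∫⁻ ω, B.indicator 1 (X ω) * ENNReal.ofReal (g (X ω)) ∂P) :
    condExp (MeasurableSpace.comap X inferInstance) P f =ᵐ[P] fun ω => g (X ω) := by
  have hgX := hg.comp hX
  have hind : Integrable (S.indicator (1 : Ω → ℝ)) P :=
    (integrable_const (1 : ℝ)).indicator hS
  have hfi : Integrable f P := hind.congr hf.symm
  have hset : ∀ B, MeasurableSet B → ∫⁻ ω in X ⁻¹' B, ENNReal.ofReal (S.indicator 1 ω) ∂P =
      ∫⁻ ω in X ⁻¹' B, ENNReal.ofReal (g (X ω)) ∂P := by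
    intro B hB
    rw [← lintegral_indicator (hX hB), ← lintegral_indicator (hX hB)]
    refine (lintegral_congr fun ω => ?_).trans ((h B hB).trans (lintegral_congr fun ω => ?_))
    · by_cases h1 : X ω ∈ B <;> by_cases h2 : ω ∈ S <;> simp [h1, h2]
    · by_cases h1 : X ω ∈ B <;> simp [h1]
  have hgi : Integrable (fun ω => g (X ω)) P := by
    refine ⟨hgX.aestronglyMeasurable, ?_⟩
    rw [hasFiniteIntegral_iff_ofReal hg0]
    have := hset univ MeasurableSet.univ
    rw [preimage_univ, Measure.restrict_univ] at this
    rw [← this]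
    refine (lintegral_mono (g := fun _ => 1) fun ω => ?_).trans_lt (by simp)
    by_cases h2 : ω ∈ S <;> simp [h2]
  refine (ae_eq_condExp_of_forall_setIntegral_eq hX.comap_le hfi
    (fun s _ _ => hgi.integrableOn) ?_ ?_).symm
  · rintro _ ⟨B, hB, rfl⟩ _
    rw [setIntegral_congr_ae (g := S.indicator (1 : Ω → ℝ)) (hX hB) (hf.mono fun ω h _ => h),
      integral_eq_lintegral_of_nonneg_ae (ae_restrict_of_ae hg0)
        hgX.aestronglyMeasurable.restrict,
      integral_eq_lintegral_of_nonneg_ae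
        (f := S.indicator (1 : Ω → ℝ))
        (ae_of_all _ fun ω => indicator_nonneg (fun _ _ => zero_le_one) ω)
        hind.aestronglyMeasurable.restrict, hset B hB]
  · exact (hg.comp (comap_measurable X)).stronglyMeasurable.aestronglyMeasurable

section Sinr

variable {Ω : Type*} [mΩ : MeasurableSpace Ω] {P : Measure Ω} [IsProbabilityMeasure P] {T : ℕ}
  {Φ : Fin T → Ω → Set Plane} {H : Fin T → ℕ → Ω → ℝ} {lam : Fin T → ℝ} {mu α : ℝ}
  {pow noise : ℝ}

lemma summable_fading {Ω : Type*} {Φ : Ω → Set Plane} {H : ℕ → Ω → ℝ} {α : ℝ} {ω : Ω}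
    (hH : ∀ k, 0 < H k ω) (hI : fadingSum Φ H α ω < ⊤) :
    Summable (fun k => H (k + 1) ω * nthDist Φ (k + 1) ω ^ (-α)) ∧
      ∑' k, H (k + 1) ω * nthDist Φ (k + 1) ω ^ (-α) = (fadingSum Φ H α ω).toReal := by
  have hnn : ∀ k, 0 ≤ H (k + 1) ω * nthDist Φ (k + 1) ω ^ (-α) := fun k =>
    mul_nonneg (hH _).le (Real.rpow_nonneg (nthDist_nonneg _ _) _)
  constructor
  · refine (ENNReal.summable_toReal hI.ne).congr fun k => ?_
    rw [ENNReal.toReal_ofReal (hnn k)]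
  · rw [fadingSum, ENNReal.tsum_toReal_eq fun _ => ENNReal.ofReal_ne_top]
    exact tsum_congr fun k => (ENNReal.toReal_ofReal (hnn k)).symm

lemma IsPoissonNetwork.ae_summable_receivedPower (hnet : IsPoissonNetwork P Φ H lam mu)
    (i : Fin T) (hlam : 0 < lam i) (hmu : 0 < mu) (hα : 2 < α) :
    ∀ᵐ ω ∂P, Summable fun k => receivedPower (Φ i) (H i) α pow k ω := by
  filter_upwards [hnet.ae_fading_pos, hnet.ae_fadingSum_lt_top i hlam hmu hα] with ω hH hI
  rw [← summable_nat_add_iff 1]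
  refine ((summable_fading (hH i) hI).1.mul_left pow).congr fun k => ?_
  rw [receivedPower, mul_assoc]

/-- The natural numbers are in bijection with the nonzero ones. -/
def succEquiv : ℕ ≃ {k : ℕ // k ≠ 0} where
  toFun k := ⟨k + 1, k.succ_ne_zero⟩
  invFun k := k.1 - 1
  left_inv k := by simp
  right_inv k := Subtype.ext (Nat.succ_pred_eq_of_ne_zero k.2)

lemma IsPoissonNetwork.ae_sinr_eq (hnet : IsPoissonNetwork P Φ H lam mu)
    (i : Fin T) (hlam : 0 < lam i) (hmu : 0 < mu) (hα : 2 < α) :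
    ∀ᵐ ω ∂P, sinr (Φ i) (H i) α pow noise 0 ω =
      pow * H i 0 ω * nthDist (Φ i) 0 ω ^ (-α) /
        (noise + pow * (fadingSum (Φ i) (H i) α ω).toReal) := by
  filter_upwards [hnet.ae_fading_pos, hnet.ae_fadingSum_lt_top i hlam hmu hα] with ω hH hI
  rw [sinr, ← succEquiv.tsum_eq]
  have : ∑' k, receivedPower (Φ i) (H i) α pow (succEquiv k).1 ω =
      pow * (fadingSum (Φ i) (H i) α ω).toReal := by
    rw [← (summable_fading (hH i) hI).2, ← tsum_mul_left]
    refine tsum_congr fun k => ?_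
    rw [receivedPower, mul_assoc]
    rfl
  rw [this, receivedPower]

lemma IsPoissonNetwork.aemeasurable_sinr (hnet : IsPoissonNetwork P Φ H lam mu)
    (i : Fin T) (hlam : 0 < lam i) (hmu : 0 < mu) (hα : 2 < α) :
    AEMeasurable (sinr (Φ i) (H i) α pow noise 0) P := by
  have hrm := (hnet.poisson i).measurable_nthDist
  have hI := measurable_fadingSum hrm (fun k => hnet.measurable_fading i (k + 1)) α
  have h0 := hrm 0
  have hH0 := hnet.measurable_fading i 0
  exact ⟨_, by fun_prop, hnet.ae_sinr_eq i hlam hmu hα⟩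

/-- Clearing denominators turns the SINR condition into the threshold for H₀. One null set serves
all thresholds b. -/
lemma IsPoissonNetwork.ae_le_sinr_iff (hnet : IsPoissonNetwork P Φ H lam mu)
    (i : Fin T) (hlam : 0 < lam i) (hmu : 0 < mu) (hα : 2 < α) (hpow : 0 < pow)
    (hnoise : 0 ≤ noise) :
    ∀ᵐ ω ∂P, 0 ≤ sinr (Φ i) (H i) α pow noise 0 ω ∧ ∀ b, 0 < b →
      (b ≤ sinr (Φ i) (H i) α pow noise 0 ω ↔ ω ∈ coverEvent (Φ i) (H i) α pow noise b) := by
  filter_upwards [hnet.ae_fading_pos, hnet.ae_fadingSum_lt_top i hlam hmu hα,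
    hnet.ae_sinr_eq i hlam hmu hα, (hnet.poisson i).ae_nthDist_pos hlam] with ω hH hI hs hr
  -- When the noise is 0, positivity of the denominator comes from the interference alone.
  have hI0 : 0 < (fadingSum (Φ i) (H i) α ω).toReal := by
    rw [← (summable_fading (hH i) hI).2]
    exact (summable_fading (hH i) hI).1.tsum_pos
      (fun k => (mul_pos (hH i _) (Real.rpow_pos_of_pos (hr _) _)).le) 0
      (mul_pos (hH i _) (Real.rpow_pos_of_pos (hr _) _))
  have hrα : 0 < nthDist (Φ i) 0 ω ^ α := Real.rpow_pos_of_pos (hr 0) _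
  have hH0 := hH i 0
  have hD : 0 < noise + pow * (fadingSum (Φ i) (H i) α ω).toReal := by positivity
  rw [hs, Real.rpow_neg (hr 0).le]
  refine ⟨by positivity, fun b hb => ?_⟩
  have hW : fadingThreshold (Φ i) (H i) α pow noise b ω = ENNReal.ofReal
      (b * nthDist (Φ i) 0 ω ^ α * (noise / pow + (fadingSum (Φ i) (H i) α ω).toReal)) := by
    rw [fadingThreshold, ENNReal.ofReal_mul (p := b * nthDist (Φ i) 0 ω ^ α) (by positivity),
      ENNReal.ofReal_add (by positivity) hI0.le, ENNReal.ofReal_toReal hI.ne]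
  change _ ↔ fadingThreshold (Φ i) (H i) α pow noise b ω ≤ ENNReal.ofReal (H i 0 ω)
  rw [hW, ENNReal.ofReal_le_ofReal_iff hH0.le, le_div_iff₀ hD, ← div_eq_mul_inv,
    le_div_iff₀ hrα]
  have : b * nthDist (Φ i) 0 ω ^ α * (noise / pow + (fadingSum (Φ i) (H i) α ω).toReal) =
      b * (noise + pow * (fadingSum (Φ i) (H i) α ω).toReal) * nthDist (Φ i) 0 ω ^ α / pow := by
    field_simp
  rw [this, div_le_iff₀ hpow, mul_comm (H i 0 ω)]

lemma IsPoissonNetwork.ae_coverageMetric_eq (hnet : IsPoissonNetwork P Φ H lam mu)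
    (i : Fin T) (hlam : 0 < lam i) (hmu : 0 < mu) (hα : 2 < α) (hpow : 0 < pow)
    (hnoise : 0 ≤ noise) {b : ℝ} (hb : 0 < b) :
    (fun ω => coverageMetric b (sinr (Φ i) (H i) α pow noise 0 ω)) =ᵐ[P]
      (coverEvent (Φ i) (H i) α pow noise b).indicator 1 := by
  filter_upwards [hnet.ae_le_sinr_iff i hlam hmu hα hpow hnoise] with ω hω
  rw [coverageMetric]
  by_cases h : ω ∈ coverEvent (Φ i) (H i) α pow noise b
  · rw [indicator_of_mem h, indicator_of_mem (mem_Ici.2 ((hω.2 b hb).2 h)), Pi.one_apply]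
  · rw [indicator_of_notMem h, indicator_of_notMem (s := Ici b) fun h' => h ((hω.2 b hb).1 h')]

lemma IsPoissonNetwork.condExp_coverageMetric (hnet : IsPoissonNetwork P Φ H lam mu)
    (i : Fin T) (hlam : 0 < lam i) (hmu : 0 < mu) (hα : 2 < α) (hpow : 0 < pow)
    (hnoise : 0 ≤ noise) {b : ℝ} (hb : 0 < b) :
    condExp (MeasurableSpace.comap
        (fun ω => (nthDist (Φ i) 0 ω, nthDist (Φ i) 1 ω)) inferInstance) P
      (fun ω => coverageMetric b (sinr (Φ i) (H i) α pow noise 0 ω))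
    =ᵐ[P] fun ω => coverTwo α mu (lam i) pow noise b (nthDist (Φ i) 0 ω)
      (nthDist (Φ i) 1 ω) := by
  have hrm := (hnet.poisson i).measurable_nthDist
  refine condExp_indicator_eq_of_lintegral
    (X := fun ω => (nthDist (Φ i) 0 ω, nthDist (Φ i) 1 ω))
    (g := fun p => coverTwo α mu (lam i) pow noise b p.1 p.2) ((hrm 0).prodMk (hrm 1))
    (measurableSet_coverEvent hrm (hnet.measurable_fading i) α pow noise b)
    (hnet.ae_coverageMetric_eq i hlam hmu hα hpow hnoise hb)
    ((measurable_coverTwo α mu (lam i) pow noise).comp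
      (measurable_const.prodMk (measurable_fst.prodMk measurable_snd))) ?_ fun B hB => ?_
  · filter_upwards [(hnet.poisson i).ae_nthDist_pos hlam] with ω hω
    exact (coverTwo_pos hb (hω 0) (hω 1)).le
  · exact hnet.lintegral_coverEvent i hlam hmu hα hpow hnoise hb
      (measurable_const.indicator hB) (indicator_one_le B)

end Sinr

/-! ### The law of the ratio and the nearest distance given the ratio -/

/-- The law of the ratio of the distances to the two nearest points, with density `2 t⁻³` on
`(1, ∞)`. -/
def ratioLaw : Measure ℝ :=
  (volume.restrict (Ioi 1)).withDensity fun t => ENNReal.ofReal (2 / t ^ 3)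

lemma measurable_ratioDensity : Measurable fun t : ℝ => ENNReal.ofReal (2 / t ^ 3) := by
  fun_prop

lemma lintegral_ratioLaw {f : ℝ → ℝ≥0∞} (hf : Measurable f) :
    ∫⁻ t, f t ∂ratioLaw = ∫⁻ t in Ioi 1, ENNReal.ofReal (2 / t ^ 3) * f t := by
  rw [ratioLaw, lintegral_withDensity_eq_lintegral_mul _ measurable_ratioDensity hf]
  rfl

lemma ae_ratioLaw_one_lt : ∀ᵐ t ∂ratioLaw, 1 < t :=
  (withDensity_absolutelyContinuous _ _).ae_le (ae_restrict_mem measurableSet_Ioi)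

lemma nearestDensity_nonneg {lam t u : ℝ} (hu : 0 ≤ u) : 0 ≤ nearestDensity lam t u := by
  rw [nearestDensity]
  have : 0 ≤ t ^ 4 := by positivity
  positivity

lemma measurable_nearestDensity (lam : ℝ) :
    Measurable fun p : ℝ × ℝ => ENNReal.ofReal (nearestDensity lam p.1 p.2) := by
  simp only [nearestDensity]
  fun_prop

lemma measurable_nearestDensity_right (lam t : ℝ) :
    Measurable fun u => ENNReal.ofReal (nearestDensity lam t u) := by
  simp only [nearestDensity]
  fun_prop

lemma lintegral_comp_mul_left_real {x : ℝ} (hx : x ≠ 0) {g : ℝ → ℝ≥0∞} (hg : Measurable g) :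
    ∫⁻ y, g y = ENNReal.ofReal |x| * ∫⁻ t, g (x * t) := by
  conv_lhs => rw [← Real.smul_map_volume_mul_left hx]
  rw [lintegral_smul_measure, lintegral_map hg (measurable_const_mul x), smul_eq_mul]

/-- The substitution y = x t, whose Jacobian is x, splits the joint density into 2 t⁻³ and a factor
of total mass 1 in x. The intensity appears in the second factor only, so all technologies share one
ratio law. -/
lemma pairDensity_zero_mul {lam x t : ℝ} (hlam : 0 < lam) (hx : 0 < x) :
    ENNReal.ofReal |x| * pairDensity lam (fun _ => 0) (x, x * t) =
      (Ioi 1).indicator (fun t => ENNReal.ofReal (2 / t ^ 3) *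
        ENNReal.ofReal (nearestDensity lam t x)) t := by
  by_cases ht : 1 < t
  · have h1 : (x, x * t) ∈ {p : ℝ × ℝ | 0 < p.1 ∧ p.1 < p.2} := ⟨hx, lt_mul_of_one_lt_right hx ht⟩
    have ht0 : 0 < t := one_pos.trans ht
    rw [pairDensity, indicator_of_mem h1, indicator_of_mem (mem_Ioi.2 ht), voidWeight_zero,
      abs_of_pos hx, ← ENNReal.ofReal_mul (radialIntensity_nonneg hlam hx.le),
      ← ENNReal.ofReal_mul hx.le, ← ENNReal.ofReal_mul (by positivity)]
    congr 1
    simp only [radialIntensity, nearestDensity, neg_zero, Real.exp_zero]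
    rw [show lam * Real.pi * (x * t) ^ 2 = Real.pi * lam * (x * t) ^ 2 by ring]
    field_simp
  · have h1 : (x, x * t) ∉ {p : ℝ × ℝ | 0 < p.1 ∧ p.1 < p.2} := fun h =>
      ht ((lt_mul_iff_one_lt_right hx).1 h.2)
    rw [pairDensity, indicator_of_notMem h1, indicator_of_notMem (notMem_Ioi.2 (not_lt.1 ht)),
      mul_zero]

section Ratio

lemma IsPoissonPointProcess.measurable_ratio {Ω : Type*} [MeasurableSpace Ω] {P : Measure Ω}
    {Φ : Ω → Set Plane} {lam : ℝ} (hp : IsPoissonPointProcess P Φ lam) :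
    Measurable (ratio Φ) :=
  (hp.measurable_nthDist 1).div (hp.measurable_nthDist 0)

instance : SFinite ratioLaw := by
  rw [ratioLaw]
  infer_instance

variable {Ω : Type*} [MeasurableSpace Ω] {P : Measure Ω} [IsProbabilityMeasure P]
  {Φ : Ω → Set Plane} {lam : ℝ}

/-- The disintegration from which the ratio law, the conditional density and the coverage formula
given the ratio are all read off. -/
lemma IsPoissonPointProcess.lintegral_nthDist_ratio (hp : IsPoissonPointProcess P Φ lam)
    (hlam : 0 < lam) {F : ℝ × ℝ → ℝ≥0∞} (hF : Measurable F) :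
    ∫⁻ ω, F (nthDist Φ 0 ω, ratio Φ ω) ∂P =
      ∫⁻ t, (∫⁻ x in Ioi 0, F (x, t) * ENNReal.ofReal (nearestDensity lam t x)) ∂ratioLaw := by
  have hψ : Measurable fun p : ℝ × ℝ => F (p.1, p.2 / p.1) := by fun_prop
  have h1 := hp.lintegral_pair hlam (IsRadialWeight.zero lam) hψ
  simp only [ENNReal.ofReal_zero, tsum_zero, expNeg_zero, mul_one] at h1
  have hd := (IsRadialWeight.zero lam).measurable_pairDensity
  have hinner : ∀ x, ∫⁻ y, F (x, y / x) * pairDensity lam (fun _ => 0) (x, y) =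
      (Ioi 0).indicator (fun x => ∫⁻ t in Ioi 1, ENNReal.ofReal (2 / t ^ 3) *
        (F (x, t) * ENNReal.ofReal (nearestDensity lam t x))) x := by
    intro x
    by_cases hx : 0 < x
    · have hg : Measurable fun y => F (x, y / x) * pairDensity lam (fun _ => 0) (x, y) :=
        (hψ.mul hd).comp (measurable_const.prodMk measurable_id)
      rw [indicator_of_mem (mem_Ioi.2 hx), lintegral_comp_mul_left_real hx.ne' hg,
        ← lintegral_const_mul _ (show Measurable fun t => F (x, x * t / x) *
          pairDensity lam (fun _ => 0) (x, x * t) from hg.comp (measurable_const_mul x)),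
        ← lintegral_indicator measurableSet_Ioi]
      refine lintegral_congr fun t => ?_
      rw [mul_div_cancel_left₀ t hx.ne', mul_left_comm, pairDensity_zero_mul hlam hx]
      by_cases ht : t ∈ Ioi (1 : ℝ)
      · rw [indicator_of_mem ht, indicator_of_mem ht, mul_left_comm]
      · rw [indicator_of_notMem ht, indicator_of_notMem ht, mul_zero]
    · rw [indicator_of_notMem (notMem_Ioi.2 (not_lt.1 hx))]
      refine (lintegral_congr fun y => ?_).trans lintegral_zero
      have : (x, y) ∉ {p : ℝ × ℝ | 0 < p.1 ∧ p.1 < p.2} := fun h => hx h.1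
      rw [pairDensity, indicator_of_notMem this, mul_zero]
  have hm : Measurable fun p : ℝ × ℝ => F (p.2, p.1) * ENNReal.ofReal (nearestDensity lam p.1 p.2) :=
    (hF.comp measurable_swap).mul (measurable_nearestDensity lam)
  rw [show (fun ω => F (nthDist Φ 0 ω, ratio Φ ω)) = fun ω => F (nthDist Φ 0 ω,
    nthDist Φ 1 ω / nthDist Φ 0 ω) from rfl, h1, Measure.volume_eq_prod,
    lintegral_prod (fun p : ℝ × ℝ => F (p.1, p.2 / p.1) * pairDensity lam (fun _ => 0) p)
      (hψ.mul hd).aemeasurable, lintegral_congr hinner,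
    lintegral_indicator measurableSet_Ioi, lintegral_lintegral_swap,
    lintegral_ratioLaw hm.lintegral_prod_right']
  · refine lintegral_congr fun t => ?_
    exact lintegral_const_mul _ (hm.comp (measurable_const.prodMk measurable_id))
  · exact ((measurable_ratioDensity.comp measurable_snd).mul (hm.comp measurable_swap)).aemeasurable

lemma lintegral_nearestDensity {t : ℝ} (hlam : 0 < lam) (ht : 0 < t) :
    ∫⁻ x in Ioi 0, ENNReal.ofReal (nearestDensity lam t x) = 1 := by
  have hc : 0 < lam * Real.pi * t ^ 2 := by have := Real.pi_pos; positivity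
  set c := lam * Real.pi * t ^ 2 with hcdef
  -- In terms of c the density is 2c²x³ e^{-cx²}; this antiderivative rises from -1 at 0 to 0 at
  -- infinity.
  have hd : ∀ x ∈ Ici (0 : ℝ), HasDerivAt (fun x => -((c * x ^ 2 + 1) * Real.exp (-(c * x ^ 2))))
      (nearestDensity lam t x) x := by
    intro x _
    have h1 : HasDerivAt (fun x => c * x ^ 2) (c * (2 * x)) x := by
      simpa using (hasDerivAt_pow 2 x).const_mul c
    convert! ((h1.add_const 1).mul h1.neg.exp).neg using 1
    rw [nearestDensity, show lam * Real.pi * (x * t) ^ 2 = c * x ^ 2 by rw [hcdef]; ring]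
    simp only [Pi.neg_apply, hcdef]
    ring
  have hlim : Tendsto (fun x => -((c * x ^ 2 + 1) * Real.exp (-(c * x ^ 2)))) atTop (𝓝 0) := by
    have h1 : Tendsto (fun y : ℝ => -((y + 1) * Real.exp (-y))) atTop (𝓝 0) := by
      have h2 := Real.tendsto_pow_mul_exp_neg_atTop_nhds_zero 1
      have h3 := Real.tendsto_pow_mul_exp_neg_atTop_nhds_zero 0
      have h4 := (h2.add h3).neg
      simp only [add_zero, neg_zero] at h4
      refine h4.congr fun y => ?_
      ring
    exact h1.comp ((tendsto_pow_atTop two_ne_zero).const_mul_atTop hc)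
  have hnn : ∀ x ∈ Ioi (0 : ℝ), 0 ≤ nearestDensity lam t x := fun x hx =>
    nearestDensity_nonneg (le_of_lt hx)
  rw [← ofReal_integral_eq_lintegral_ofReal (integrableOn_Ioi_deriv_of_nonneg' hd hnn hlim)
    ((ae_restrict_iff' measurableSet_Ioi).2 (ae_of_all _ hnn)),
    integral_Ioi_of_hasDerivAt_of_nonneg' hd hnn hlim]
  simp

lemma IsPoissonPointProcess.lintegral_ratio (hp : IsPoissonPointProcess P Φ lam)
    (hlam : 0 < lam) {f : ℝ → ℝ≥0∞} (hf : Measurable f) :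
    ∫⁻ ω, f (ratio Φ ω) ∂P = ∫⁻ t, f t ∂ratioLaw := by
  refine (hp.lintegral_nthDist_ratio hlam (hf.comp measurable_snd)).trans
    (lintegral_congr_ae ?_)
  filter_upwards [ae_ratioLaw_one_lt] with t ht
  simp only [Function.comp_apply]
  rw [lintegral_const_mul _ (measurable_nearestDensity_right lam t),
    lintegral_nearestDensity hlam (one_pos.trans ht), mul_one]

lemma IsPoissonPointProcess.map_ratio (hp : IsPoissonPointProcess P Φ lam)
    (hlam : 0 < lam) : P.map (ratio Φ) = ratioLaw := by
  ext s hs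
  have := hp.lintegral_ratio hlam (f := s.indicator 1) (measurable_one.indicator hs)
  rw [← lintegral_map (measurable_one.indicator hs) hp.measurable_ratio,
    lintegral_indicator_one hs, lintegral_indicator_one hs] at this
  exact this

lemma ratioLaw_Iic {t : ℝ} (ht : 1 ≤ t) : ratioLaw (Iic t) = ENNReal.ofReal (1 - 1 / t ^ 2) := by
  have hd : ∀ x ∈ uIcc 1 t, HasDerivAt (fun x : ℝ => -(1 / x ^ 2)) (2 / x ^ 3) x := by
    intro x hx
    rw [uIcc_of_le ht] at hx
    have hx0 : x ≠ 0 := (one_pos.trans_le hx.1).ne'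
    have := ((hasDerivAt_pow 2 x).inv (pow_ne_zero 2 hx0)).neg
    simp only [one_div]
    convert! this using 1
    field_simp
    norm_num
  have hc : ContinuousOn (fun x : ℝ => 2 / x ^ 3) (uIcc 1 t) := by
    rw [uIcc_of_le ht]
    exact continuousOn_const.div (continuousOn_pow 3) fun x hx =>
      pow_ne_zero 3 (one_pos.trans_le hx.1).ne'
  have hint := hc.intervalIntegrable (μ := volume)
  rw [ratioLaw, withDensity_apply _ measurableSet_Iic, Measure.restrict_restrict measurableSet_Iic,
    inter_comm, Ioi_inter_Iic, ← ofReal_integral_eq_lintegral_ofReal hint.1,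
    ← intervalIntegral.integral_of_le ht,
    intervalIntegral.integral_eq_sub_of_hasDerivAt hd hint]
  · congr 1; ring
  · refine (ae_restrict_iff' measurableSet_Ioc).2 (ae_of_all _ fun x hx => ?_)
    have : 0 < x := one_pos.trans hx.1
    simp only [Pi.zero_apply]
    positivity

lemma IsPoissonPointProcess.condDistrib_nthDist_ratio (hp : IsPoissonPointProcess P Φ lam)
    (hlam : 0 < lam) :
    ∀ᵐ t ∂(P.map (ratio Φ)), condDistrib (nthDist Φ 0) (ratio Φ) P t =
      (volume.restrict (Ioi (0 : ℝ))).withDensity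
        (fun u => ENNReal.ofReal (nearestDensity lam t u)) := by
  have hfm : Measurable (Function.uncurry fun t u : ℝ =>
      (Ioi (0 : ℝ)).indicator (fun t => ENNReal.ofReal (nearestDensity lam t u)) t) := by
    have : (Function.uncurry fun t u : ℝ =>
        (Ioi (0 : ℝ)).indicator (fun t => ENNReal.ofReal (nearestDensity lam t u)) t) =
        (Prod.fst ⁻¹' Ioi (0 : ℝ)).indicator
          (fun p => ENNReal.ofReal (nearestDensity lam p.1 p.2)) := by
      ext p
      by_cases h : 0 < p.1 <;> simp [Function.uncurry, h]
    rw [this]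
    exact (measurable_nearestDensity lam).indicator (measurable_fst measurableSet_Ioi)
  -- The density is replaced by 0 for t ≤ 0, which the ratio law does not charge;
  -- `lintegral_nearestDensity` then makes κ a finite kernel.
  let κ : Kernel ℝ ℝ := Kernel.withDensity (Kernel.const ℝ (volume.restrict (Ioi (0 : ℝ))))
    fun t u => (Ioi (0 : ℝ)).indicator (fun t => ENNReal.ofReal (nearestDensity lam t u)) t
  have hκ : ∀ t, κ t = (volume.restrict (Ioi (0 : ℝ))).withDensity fun u =>
      (Ioi (0 : ℝ)).indicator (fun t => ENNReal.ofReal (nearestDensity lam t u)) t := fun t =>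
    Kernel.withDensity_apply _ hfm t
  have hκpos : ∀ t, 0 < t → κ t = (volume.restrict (Ioi (0 : ℝ))).withDensity fun u =>
      ENNReal.ofReal (nearestDensity lam t u) := fun t ht => by
    rw [hκ]
    simp only [indicator_of_mem (mem_Ioi.2 ht)]
  have : IsFiniteKernel κ := by
    refine ⟨1, ENNReal.one_lt_top, fun t => ?_⟩
    by_cases ht : 0 < t
    · rw [hκpos t ht, withDensity_apply _ MeasurableSet.univ, Measure.restrict_univ,
        lintegral_nearestDensity hlam ht]
    · rw [hκ]
      simp only [indicator_of_notMem (notMem_Ioi.2 (not_lt.1 ht))]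
      simp
  have hr := hp.measurable_nthDist 0
  have hq := hp.measurable_ratio
  have hcond : condDistrib (nthDist Φ 0) (ratio Φ) P =ᵐ[P.map (ratio Φ)] κ := by
    refine condDistrib_ae_eq_of_measure_eq_compProd_of_measurable hq hr ?_
    ext s hs
    have h1 := hp.lintegral_nthDist_ratio hlam
      (F := fun p => s.indicator 1 (p.2, p.1)) ((measurable_one.indicator hs).comp measurable_swap)
    rw [hp.map_ratio hlam, Measure.compProd_apply hs, ← lintegral_indicator_one hs,
      lintegral_map (measurable_one.indicator hs) (hq.prodMk hr), h1]
    refine lintegral_congr_ae ?_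
    filter_upwards [ae_ratioLaw_one_lt] with t ht
    have hst : MeasurableSet (Prod.mk t ⁻¹' s) := measurable_prodMk_left hs
    rw [hκpos t (one_pos.trans ht), withDensity_apply _ hst, ← lintegral_indicator hst]
    refine lintegral_congr fun x => ?_
    by_cases hx : (t, x) ∈ s <;> simp [hx, indicator]
  filter_upwards [hcond, (hp.map_ratio hlam).symm ▸ ae_ratioLaw_one_lt] with t h1 h2
  rw [h1, hκpos t (one_pos.trans h2)]

end Ratio

/-! ### The coverage formula given the ratio -/

section CoverRatio

variable {α mu lam pow noise : ℝ}

lemma coverTwo_mul_nearestDensity_nonneg {b t u : ℝ} (hb : 0 < b) (ht : 0 < t) (hu : 0 < u) :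
    0 ≤ coverTwo α mu lam pow noise b u (u * t) * nearestDensity lam t u :=
  mul_nonneg (coverTwo_pos hb hu (mul_pos hu ht)).le (nearestDensity_nonneg hu.le)

lemma coverRatio_nonneg {b t : ℝ} (hb : 0 < b) (ht : 0 < t) :
    0 ≤ coverRatio α mu lam pow noise b t :=
  setIntegral_nonneg measurableSet_Ioi fun _ hu =>
    coverTwo_mul_nearestDensity_nonneg hb ht hu

lemma measurable_coverTwo_mul_nearestDensity (α mu lam pow noise : ℝ) :
    Measurable fun p : (ℝ × ℝ) × ℝ =>
      coverTwo α mu lam pow noise p.1.1 p.2 (p.2 * p.1.2) * nearestDensity lam p.1.2 p.2 := by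
  have h : Measurable fun p : (ℝ × ℝ) × ℝ => (p.1.1, p.2, p.2 * p.1.2) := by fun_prop
  refine ((measurable_coverTwo α mu lam pow noise).comp h).mul ?_
  simp only [nearestDensity]
  fun_prop

lemma measurable_coverRatio (α mu lam pow noise : ℝ) :
    Measurable fun p : ℝ × ℝ => coverRatio α mu lam pow noise p.1 p.2 :=
  ((measurable_coverTwo_mul_nearestDensity α mu lam pow
    noise).stronglyMeasurable.integral_prod_right' (ν := volume.restrict (Ioi 0))).measurable

/-- The bound of `coverTwo_le` depends on the distances through their ratio only, so averaging over
the nearest distance preserves it. -/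
lemma lintegral_coverTwo_le (hlam : 0 < lam) (hmu : 0 < mu) (hpow : 0 < pow) (hnoise : 0 ≤ noise)
    {b t : ℝ} (hb : 0 < b) (ht : 0 < t) :
    ∫⁻ u in Ioi 0, ENNReal.ofReal
        (coverTwo α mu lam pow noise b u (u * t) * nearestDensity lam t u) ≤
      ENNReal.ofReal (1 / (1 + b * (1 / t) ^ α)) := by
  calc _ ≤ ∫⁻ u in Ioi 0, ENNReal.ofReal (1 / (1 + b * (1 / t) ^ α)) *
        ENNReal.ofReal (nearestDensity lam t u) := by
        refine setLIntegral_mono' measurableSet_Ioi fun u hu => ?_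
        have hu : 0 < u := hu
        rw [← ENNReal.ofReal_mul (by positivity)]
        refine ENNReal.ofReal_le_ofReal (mul_le_mul_of_nonneg_right ?_ (nearestDensity_nonneg hu.le))
        refine (coverTwo_le hlam hmu hpow hnoise hb hu (mul_pos hu ht)).trans_eq ?_
        rw [div_mul_cancel_left₀ hu.ne', one_div t]
    _ = _ := by
        rw [lintegral_const_mul _ (measurable_nearestDensity_right lam t),
          lintegral_nearestDensity hlam ht, mul_one]

lemma ofReal_coverRatio (hlam : 0 < lam) (hmu : 0 < mu) (hpow : 0 < pow) (hnoise : 0 ≤ noise)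
    {b t : ℝ} (hb : 0 < b) (ht : 0 < t) :
    ENNReal.ofReal (coverRatio α mu lam pow noise b t) =
      ∫⁻ u in Ioi 0, ENNReal.ofReal
        (coverTwo α mu lam pow noise b u (u * t) * nearestDensity lam t u) := by
  rw [coverRatio, integral_eq_lintegral_of_nonneg_ae, ENNReal.ofReal_toReal]
  · exact ((lintegral_coverTwo_le hlam hmu hpow hnoise hb ht).trans_lt ENNReal.ofReal_lt_top).ne
  · exact (ae_restrict_iff' measurableSet_Ioi).2 (ae_of_all _ fun u hu =>
      coverTwo_mul_nearestDensity_nonneg hb ht hu)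
  · exact ((measurable_coverTwo_mul_nearestDensity α mu lam pow noise).comp
      (measurable_prodMk_left (x := (b, t)))).aestronglyMeasurable

lemma coverRatio_le (hlam : 0 < lam) (hmu : 0 < mu) (hpow : 0 < pow) (hnoise : 0 ≤ noise)
    {b t : ℝ} (hb : 0 < b) (ht : 0 < t) :
    coverRatio α mu lam pow noise b t ≤ 1 / (1 + b * (1 / t) ^ α) := by
  rw [← ENNReal.ofReal_le_ofReal_iff (by positivity),
    ofReal_coverRatio hlam hmu hpow hnoise hb ht]
  exact lintegral_coverTwo_le hlam hmu hpow hnoise hb ht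

end CoverRatio

section CondRatio

variable {Ω : Type*} [MeasurableSpace Ω] {P : Measure Ω} [IsProbabilityMeasure P] {T : ℕ}
  {Φ : Fin T → Ω → Set Plane} {H : Fin T → ℕ → Ω → ℝ} {lam : Fin T → ℝ} {mu α : ℝ}
  {pow noise : ℝ}

/-- The two-distance identity, tested against functions of r₁/r₀ only and averaged over r₀ by the
disintegration. -/
lemma IsPoissonNetwork.lintegral_coverEvent_ratio (hnet : IsPoissonNetwork P Φ H lam mu)
    (i : Fin T) (hlam : 0 < lam i) (hmu : 0 < mu) (hα : 2 < α) (hpow : 0 < pow)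
    (hnoise : 0 ≤ noise) {b : ℝ} (hb : 0 < b) {φ : ℝ → ℝ≥0∞} (hφ : Measurable φ)
    (hφ1 : ∀ t, φ t ≤ 1) :
    ∫⁻ ω, φ (ratio (Φ i) ω) * (coverEvent (Φ i) (H i) α pow noise b).indicator 1 ω ∂P =
      ∫⁻ t, φ t * ENNReal.ofReal (coverRatio α mu (lam i) pow noise b t) ∂ratioLaw := by
  have hp := hnet.poisson i
  have hcm : Measurable fun p : ℝ × ℝ => coverTwo α mu (lam i) pow noise b p.1 (p.1 * p.2) :=
    (measurable_coverTwo α mu (lam i) pow noise).comp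
      (measurable_const.prodMk (measurable_fst.prodMk (measurable_fst.mul measurable_snd)))
  have h1 := hnet.lintegral_coverEvent i hlam hmu hα hpow hnoise hb
    (ψ := fun p => φ (p.2 / p.1)) (hφ.comp (measurable_snd.div measurable_fst)) fun p => hφ1 _
  have h2 : ∫⁻ ω, φ (nthDist (Φ i) 1 ω / nthDist (Φ i) 0 ω) * ENNReal.ofReal
      (coverTwo α mu (lam i) pow noise b (nthDist (Φ i) 0 ω) (nthDist (Φ i) 1 ω)) ∂P =
      ∫⁻ ω, φ (ratio (Φ i) ω) * ENNReal.ofReal (coverTwo α mu (lam i) pow noise b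
        (nthDist (Φ i) 0 ω) (nthDist (Φ i) 0 ω * ratio (Φ i) ω)) ∂P := by
    refine lintegral_congr_ae ?_
    filter_upwards [hp.ae_nthDist_pos hlam] with ω hω
    rw [ratio, mul_div_cancel₀ _ (hω 0).ne']
  refine (h1.trans h2).trans ((hp.lintegral_nthDist_ratio hlam
    (F := fun p => φ p.2 * ENNReal.ofReal (coverTwo α mu (lam i) pow noise b p.1 (p.1 * p.2)))
    ((hφ.comp measurable_snd).mul hcm.ennreal_ofReal)).trans (lintegral_congr_ae ?_))
  filter_upwards [ae_ratioLaw_one_lt] with t ht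
  have ht0 := one_pos.trans ht
  rw [ofReal_coverRatio hlam hmu hpow hnoise hb ht0, ← lintegral_const_mul]
  · refine setLIntegral_congr_fun measurableSet_Ioi fun u hu => ?_
    rw [ENNReal.ofReal_mul (coverTwo_pos hb hu (mul_pos hu ht0)).le, mul_assoc]
  · exact ((measurable_coverTwo_mul_nearestDensity α mu (lam i) pow noise).comp
      (measurable_prodMk_left (x := (b, t)))).ennreal_ofReal

lemma IsPoissonNetwork.condExp_coverageMetric_ratio (hnet : IsPoissonNetwork P Φ H lam mu)
    (i : Fin T) (hlam : 0 < lam i) (hmu : 0 < mu) (hα : 2 < α) (hpow : 0 < pow)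
    (hnoise : 0 ≤ noise) {b : ℝ} (hb : 0 < b) :
    condExp (MeasurableSpace.comap (ratio (Φ i)) inferInstance) P
      (fun ω => coverageMetric b (sinr (Φ i) (H i) α pow noise 0 ω))
    =ᵐ[P] fun ω => coverRatio α mu (lam i) pow noise b (ratio (Φ i) ω) := by
  have hrm := (hnet.poisson i).measurable_nthDist
  have hg : Measurable (coverRatio α mu (lam i) pow noise b) :=
    (measurable_coverRatio α mu (lam i) pow noise).comp measurable_prodMk_left
  refine condExp_indicator_eq_of_lintegral (hnet.poisson i).measurable_ratio
    (measurableSet_coverEvent hrm (hnet.measurable_fading i) α pow noise b)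
    (hnet.ae_coverageMetric_eq i hlam hmu hα hpow hnoise hb) hg ?_ fun B hB => ?_
  · filter_upwards [(hnet.poisson i).ae_nthDist_pos hlam] with ω hω
    exact coverRatio_nonneg hb (div_pos (hω 1) (hω 0))
  · rw [hnet.lintegral_coverEvent_ratio i hlam hmu hα hpow hnoise hb
      (measurable_one.indicator hB) (indicator_one_le B)]
    exact ((hnet.poisson i).lintegral_ratio hlam
      ((measurable_one.indicator hB).mul hg.ennreal_ofReal)).symm

end CondRatio

/-! ### Selection by the max-ratio policy -/

lemma ratioLaw_singleton (t : ℝ) : ratioLaw {t} = 0 :=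
  withDensity_absolutelyContinuous _ _ (Measure.absolutelyContinuous_of_le Measure.restrict_le_self (measure_singleton t))

lemma IsMaxRatioPolicy.measurable_policy {Ω : Type*} [MeasurableSpace Ω] {P : Measure Ω} {T : ℕ}
    {Φ : Fin T → Ω → Set Plane} {H : Fin T → ℕ → Ω → ℝ} {lam : Fin T → ℝ} {mu : ℝ}
    (hnet : IsPoissonNetwork P Φ H lam mu)
    {π : Ω → Fin T × ℕ} (hπ : IsMaxRatioPolicy Φ π) : Measurable π :=
  hπ.measurable.mono (iSup_le fun i => (hnet.poisson i).measurable_ratio.comap_le) le_rfl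

lemma IsMaxRatioPolicy.measurableSet_selected {Ω : Type*} [MeasurableSpace Ω] {P : Measure Ω} {T : ℕ}
    {Φ : Fin T → Ω → Set Plane} {H : Fin T → ℕ → Ω → ℝ} {lam : Fin T → ℝ} {mu : ℝ}
    (hnet : IsPoissonNetwork P Φ H lam mu)
    {π : Ω → Fin T × ℕ} (hπ : IsMaxRatioPolicy Φ π) (i : Fin T) :
    MeasurableSet {ω | (π ω).1 = i} :=
  (measurable_fst.comp (hπ.measurable_policy hnet)) (measurableSet_singleton i)

section Policy

variable {Ω : Type*} [MeasurableSpace Ω] {P : Measure Ω} [IsProbabilityMeasure P] {T : ℕ}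
  {Φ : Fin T → Ω → Set Plane} {H : Fin T → ℕ → Ω → ℝ} {lam : Fin T → ℝ} {mu α : ℝ}
  {pow noise : ℝ}

/-- The indices of the σ-algebras that determine technology `i`. -/
def technologyIndices (T : ℕ) (i : Fin T) : Set (Fin T ⊕ (Fin T × ℕ)) :=
  insert (Sum.inl i) {s | ∃ k, s = Sum.inr (i, k)}

lemma measurable_nthDist_technology {Ω : Type*} {T : ℕ} (Φ : Fin T → Ω → Set Plane)
    (H : Fin T → ℕ → Ω → ℝ) (i : Fin T) (k : ℕ) :
    Measurable[⨆ s ∈ technologyIndices T i, networkSigma Φ H s] (nthDist (Φ i) k) :=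
  (measurable_nthDist_pointSigma (Φ i) k).mono
    (le_biSup (networkSigma Φ H) (i := Sum.inl i) (mem_insert _ _)) le_rfl

lemma measurableSet_coverEvent_technology {Ω : Type*} {T : ℕ} (Φ : Fin T → Ω → Set Plane)
    (H : Fin T → ℕ → Ω → ℝ) (i : Fin T) (α pow noise b : ℝ) :
    MeasurableSet[⨆ s ∈ technologyIndices T i, networkSigma Φ H s]
      (coverEvent (Φ i) (H i) α pow noise b) :=
  measurableSet_coverEvent (measurable_nthDist_technology Φ H i) (fun k =>
    (comap_measurable (H i k)).mono
      (le_biSup (networkSigma Φ H) (i := Sum.inr (i, k)) (Or.inr ⟨k, rfl⟩)) le_rfl) α pow noise b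

/-- Z may depend on the points and all fading coefficients of technology i. The other ratios are
independent of it and have the common law `ratioLaw`. -/
lemma IsPoissonNetwork.lintegral_mul_prod_ratio (hnet : IsPoissonNetwork P Φ H lam mu)
    (hlam : ∀ j, 0 < lam j) (i : Fin T) {S : Finset (Fin T)} (hS : i ∉ S)
    {g : ℝ × ℝ → ℝ≥0∞} (hg : Measurable g) {Z : Ω → ℝ≥0∞}
    (hZ : Measurable[⨆ s ∈ technologyIndices T i, networkSigma Φ H s] Z) :
    ∫⁻ ω, Z ω * ∏ j ∈ S, g (ratio (Φ i) ω, ratio (Φ j) ω) ∂P =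
      ∫⁻ ω, Z ω * ∏ _j ∈ S, (∫⁻ y, g (ratio (Φ i) ω, y) ∂ratioLaw) ∂P := by
  have hq : Measurable[⨆ s ∈ technologyIndices T i, networkSigma Φ H s] (ratio (Φ i)) :=
    (measurable_nthDist_technology Φ H i 1).div (measurable_nthDist_technology Φ H i 0)
  have h1 := lintegral_mul_prod_of_iIndep hnet.networkSigma_le hnet.indep
    (technologyIndices T i) (fun j : Fin T => Sum.inl j) (fun a b h => Sum.inl_injective h) S
    (fun j hj hmem => by
      rcases hmem with h | ⟨k, h⟩
      · exact hS (Sum.inl_injective h ▸ hj)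
      · simp at h) (W := fun _ => ratio (Φ i)) (fun _ => hq)
    (Y := fun j => ratio (Φ j)) (fun j => (measurable_nthDist_pointSigma (Φ j) 1).div
      (measurable_nthDist_pointSigma (Φ j) 0)) (φ := fun _ w y => g (w, y)) (fun _ => hg) hZ
  refine h1.trans (lintegral_congr fun ω => ?_)
  congr 1
  refine Finset.prod_congr rfl fun j _ => ?_
  exact (hnet.poisson j).lintegral_ratio (hlam j) (hg.comp measurable_prodMk_left)

/-- Independent variables with an atomless law almost surely differ. -/
lemma IsPoissonNetwork.ae_ratio_ne (hnet : IsPoissonNetwork P Φ H lam mu)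
    (hlam : ∀ j, 0 < lam j) {i j : Fin T} (hij : i ≠ j) :
    ∀ᵐ ω ∂P, ratio (Φ i) ω ≠ ratio (Φ j) ω := by
  have hD : MeasurableSet {p : ℝ × ℝ | p.1 = p.2} := measurableSet_eq_fun measurable_fst
    measurable_snd
  have hg : Measurable ({p : ℝ × ℝ | p.1 = p.2}.indicator (1 : ℝ × ℝ → ℝ≥0∞)) :=
    measurable_one.indicator hD
  have h1 := hnet.lintegral_mul_prod_ratio hlam i (S := {j}) (by simpa using hij) hg
    (Z := fun _ => 1) measurable_const
  have h2 : ∀ w, ∫⁻ y, {p : ℝ × ℝ | p.1 = p.2}.indicator 1 (w, y) ∂ratioLaw = 0 := fun w => by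
    rw [show (fun y => {p : ℝ × ℝ | p.1 = p.2}.indicator (1 : ℝ × ℝ → ℝ≥0∞) (w, y)) =
      ({w} : Set ℝ).indicator 1 by ext y; simp [indicator, eq_comm],
      lintegral_indicator_one (measurableSet_singleton w), ratioLaw_singleton]
  simp only [Finset.prod_singleton, h2, one_mul, lintegral_zero] at h1
  filter_upwards [(lintegral_eq_zero_iff (hg.comp ((hnet.poisson i).measurable_ratio.prodMk
    (hnet.poisson j).measurable_ratio))).1 h1] with ω hω hcon
  have hmem : (ratio (Φ i) ω, ratio (Φ j) ω) ∈ {p : ℝ × ℝ | p.1 = p.2} := hcon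
  rw [Function.comp_apply, indicator_of_mem hmem] at hω
  exact one_ne_zero hω

/-- Ties are null, so the tie-breaking rule is irrelevant and the selection becomes a product over
the competitors, ready for independence. -/
lemma IsMaxRatioPolicy.ae_selected_eq (hnet : IsPoissonNetwork P Φ H lam mu)
    (hlam : ∀ j, 0 < lam j) {π : Ω → Fin T × ℕ} (hπ : IsMaxRatioPolicy Φ π) (i : Fin T) :
    ∀ᵐ ω ∂P, {ω | (π ω).1 = i}.indicator (1 : Ω → ℝ≥0∞) ω =
      ∏ j ∈ Finset.univ.erase i,
        {p : ℝ × ℝ | p.2 ≤ p.1}.indicator 1 (ratio (Φ i) ω, ratio (Φ j) ω) := by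
  have hne : ∀ᵐ ω ∂P, ∀ j, j ≠ i → ratio (Φ j) ω ≠ ratio (Φ i) ω :=
    ae_all_iff.2 fun j => by
      by_cases hj : j = i
      · exact ae_of_all _ fun _ h => absurd hj h
      · filter_upwards [hnet.ae_ratio_ne hlam hj] with ω hω _ using hω
  filter_upwards [hne] with ω hω
  by_cases h : (π ω).1 = i
  · rw [indicator_of_mem (show ω ∈ {ω | (π ω).1 = i} from h), Pi.one_apply]
    refine (Finset.prod_eq_one fun j _ => ?_).symm
    rw [indicator_of_mem (show (ratio (Φ i) ω, ratio (Φ j) ω) ∈ {p : ℝ × ℝ | p.2 ≤ p.1} from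
      h ▸ hπ.maximal ω j), Pi.one_apply]
  · rw [indicator_of_notMem (show ω ∉ {ω | (π ω).1 = i} from h)]
    refine (Finset.prod_eq_zero (Finset.mem_erase.2 ⟨h, Finset.mem_univ _⟩) ?_).symm
    refine indicator_of_notMem (s := {p : ℝ × ℝ | p.2 ≤ p.1})
      (fun h' : ratio (Φ (π ω).1) ω ≤ ratio (Φ i) ω => ?_) _
    exact hω _ h (le_antisymm h' (hπ.maximal ω i))

/-- Given ratio t of technology i, each of the T - 1 competitors lies below t with probability 1 -
t⁻², independently of coverage by i; it remains to integrate against 2 t⁻³ dt. -/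
lemma IsMaxRatioPolicy.lintegral_selected_coverEvent (hnet : IsPoissonNetwork P Φ H lam mu)
    (hlam : ∀ j, 0 < lam j) {π : Ω → Fin T × ℕ} (hπ : IsMaxRatioPolicy Φ π) (i : Fin T)
    (hmu : 0 < mu) (hα : 2 < α) (hpow : 0 < pow) (hnoise : 0 ≤ noise) {b : ℝ} (hb : 0 < b) :
    ∫⁻ ω, {ω | (π ω).1 = i}.indicator 1 ω *
        (coverEvent (Φ i) (H i) α pow noise b).indicator 1 ω ∂P =
      2 * ∫⁻ t in Ici 1, ENNReal.ofReal
        (maxRatioIntegrand T α mu (lam i) pow noise b t) := by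
  have hg : Measurable ({p : ℝ × ℝ | p.2 ≤ p.1}.indicator (1 : ℝ × ℝ → ℝ≥0∞)) :=
    measurable_one.indicator (measurableSet_le measurable_snd measurable_fst)
  have hZ : Measurable[⨆ s ∈ technologyIndices T i, networkSigma Φ H s]
      ((coverEvent (Φ i) (H i) α pow noise b).indicator (1 : Ω → ℝ≥0∞)) :=
    measurable_const.indicator (measurableSet_coverEvent_technology Φ H i α pow noise b)
  have hF : ∀ w, ∫⁻ y, {p : ℝ × ℝ | p.2 ≤ p.1}.indicator 1 (w, y) ∂ratioLaw =
      ratioLaw (Iic w) := fun w => by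
    rw [← lintegral_indicator_one measurableSet_Iic]
    rfl
  have hFm : Measurable fun w => ratioLaw (Iic w) :=
    (show Monotone fun w => ratioLaw (Iic w) from
      fun _ _ h => measure_mono (Iic_subset_Iic.2 h)).measurable
  have h1 := hnet.lintegral_mul_prod_ratio hlam i (Finset.notMem_erase i Finset.univ) hg hZ
  simp only [hF, Finset.prod_const, Finset.card_erase_of_mem (Finset.mem_univ i),
    Finset.card_univ, Fintype.card_fin] at h1
  have hcm : Measurable (coverRatio α mu (lam i) pow noise b) :=
    (measurable_coverRatio α mu (lam i) pow noise).comp measurable_prodMk_left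
  have hprob : ∀ w, ratioLaw (Iic w) ≤ 1 := fun w => by
    rw [← (hnet.poisson i).map_ratio (hlam i),
      Measure.map_apply (hnet.poisson i).measurable_ratio measurableSet_Iic]
    exact prob_le_one
  calc _ = ∫⁻ ω, (coverEvent (Φ i) (H i) α pow noise b).indicator 1 ω *
          ∏ j ∈ Finset.univ.erase i,
            {p : ℝ × ℝ | p.2 ≤ p.1}.indicator 1 (ratio (Φ i) ω, ratio (Φ j) ω) ∂P := by
        refine lintegral_congr_ae ?_
        filter_upwards [hπ.ae_selected_eq hnet hlam i] with ω hω
        rw [hω, mul_comm]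
    _ = ∫⁻ ω, ratioLaw (Iic (ratio (Φ i) ω)) ^ (T - 1) *
          (coverEvent (Φ i) (H i) α pow noise b).indicator 1 ω ∂P :=
        h1.trans (lintegral_congr fun ω => mul_comm _ _)
    _ = ∫⁻ t, ratioLaw (Iic t) ^ (T - 1) *
          ENNReal.ofReal (coverRatio α mu (lam i) pow noise b t) ∂ratioLaw :=
        hnet.lintegral_coverEvent_ratio i (hlam i) hmu hα hpow hnoise hb
          (φ := fun t => ratioLaw (Iic t) ^ (T - 1)) (hFm.pow_const _)
          fun t => pow_le_one' (hprob t) _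
    _ = ∫⁻ t in Ioi 1, 2 * ENNReal.ofReal
          (maxRatioIntegrand T α mu (lam i) pow noise b t) := by
        rw [lintegral_ratioLaw (f := fun t => ratioLaw (Iic t) ^ (T - 1) *
          ENNReal.ofReal (coverRatio α mu (lam i) pow noise b t))
          ((hFm.pow_const _).mul hcm.ennreal_ofReal)]
        refine setLIntegral_congr_fun measurableSet_Ioi fun t ht => ?_
        have ht1 : 1 < t := ht
        have ht0 : 0 < t := one_pos.trans ht1
        have ht2 : 0 ≤ 1 - 1 / t ^ 2 := by
          rw [sub_nonneg, div_le_one (by positivity)]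
          exact one_le_pow₀ ht1.le
        rw [ratioLaw_Iic ht1.le, ← ENNReal.ofReal_pow ht2, ← ENNReal.ofReal_mul (by positivity),
          ← ENNReal.ofReal_mul (by positivity), ← ENNReal.ofReal_ofNat 2,
          ← ENNReal.ofReal_mul (by positivity), maxRatioIntegrand]
        congr 1
        ring
    _ = _ := by
        rw [lintegral_const_mul, setLIntegral_congr Ioi_ae_eq_Ici]
        unfold maxRatioIntegrand
        fun_prop

end Policy

/-! ### Absolute convergence of the integrals -/

section Integrand

variable {T : ℕ} {α mu lam pow noise : ℝ}

lemma measurable_maxRatioIntegrand (T : ℕ) (α mu lam pow noise : ℝ) :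
    Measurable fun p : ℝ × ℝ => maxRatioIntegrand T α mu lam pow noise p.1 p.2 := by
  have := measurable_coverRatio α mu lam pow noise
  unfold maxRatioIntegrand
  fun_prop

lemma one_sub_one_div_sq_mem {t : ℝ} (ht : 1 ≤ t) : 1 - 1 / t ^ 2 ∈ Icc (0 : ℝ) 1 := by
  have h : 0 < t ^ 2 := by positivity
  refine ⟨?_, sub_le_self _ (by positivity)⟩
  rw [sub_nonneg, div_le_one h]
  exact one_le_pow₀ ht

lemma maxRatioIntegrand_nonneg {b t : ℝ} (hb : 0 < b) (ht : 1 ≤ t) :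
    0 ≤ maxRatioIntegrand T α mu lam pow noise b t := by
  have ht0 : 0 < t := one_pos.trans_le ht
  exact mul_nonneg (mul_nonneg (coverRatio_nonneg hb ht0) (by positivity))
    (pow_nonneg (one_sub_one_div_sq_mem ht).1 _)

/-- The factor t⁻³ leaves room for linear growth in t, which is the price of decay in v below. -/
lemma maxRatioIntegrand_le {b t K : ℝ} (ht : 1 ≤ t) (hK : 0 ≤ K)
    (h : coverRatio α mu lam pow noise b t ≤ K * t) :
    maxRatioIntegrand T α mu lam pow noise b t ≤ K * t ^ (-2 : ℝ) := by
  have ht0 : 0 < t := one_pos.trans_le ht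
  obtain ⟨h1, h2⟩ := one_sub_one_div_sq_mem ht
  calc _ ≤ K * t * (1 / t ^ 3) * 1 := by
        unfold maxRatioIntegrand
        gcongr
        exact pow_le_one₀ h1 h2
    _ = K * t ^ (-2 : ℝ) := by
        rw [Real.rpow_neg ht0.le, Real.rpow_two]
        field_simp

/-- Put y = 2^{v/α}/t. Then y ≤ 1 + (2^v - 1) t^{-α}: this is clear if y ≤ 1, and otherwise y ≤ y^α
= 2^v t^{-α}, where t^{-α} ≤ 1. The reciprocal of y is the bound. -/
lemma coverRatio_two_rpow_le (hlam : 0 < lam) (hmu : 0 < mu) (hpow : 0 < pow) (hnoise : 0 ≤ noise)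
    (hα : 1 ≤ α) {v t : ℝ} (hv : 0 < v) (ht : 1 ≤ t) :
    coverRatio α mu lam pow noise ((2 : ℝ) ^ v - 1) t ≤ (2 : ℝ) ^ (-(v / α)) * t := by
  have ht0 : 0 < t := one_pos.trans_le ht
  have hX : 1 < (2 : ℝ) ^ v := Real.one_lt_rpow one_lt_two hv
  refine (coverRatio_le hlam hmu hpow hnoise (sub_pos.2 hX) ht0).trans ?_
  have hα0 : 0 < α := one_pos.trans_le hα
  have hs1 : (1 / t) ^ α ≤ 1 := Real.rpow_le_one (by positivity)
    ((div_le_one ht0).2 ht) hα0.le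
  have hs0 : 0 ≤ (1 / t) ^ α := by positivity
  have hy : 0 < (2 : ℝ) ^ (v / α) * (1 / t) := by positivity
  have hyα : ((2 : ℝ) ^ (v / α) * (1 / t)) ^ α = (2 : ℝ) ^ v * (1 / t) ^ α := by
    rw [Real.mul_rpow (by positivity) (by positivity), ← Real.rpow_mul zero_le_two,
      div_mul_cancel₀ _ hα0.ne']
  have hle : (2 : ℝ) ^ (v / α) * (1 / t) ≤ 1 + ((2 : ℝ) ^ v - 1) * (1 / t) ^ α := by
    rcases le_total ((2 : ℝ) ^ (v / α) * (1 / t)) 1 with h | h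
    · nlinarith
    · have := Real.rpow_le_rpow_of_exponent_le h hα
      rw [Real.rpow_one, hyα] at this
      linarith
  calc _ ≤ 1 / ((2 : ℝ) ^ (v / α) * (1 / t)) := one_div_le_one_div_of_le hy hle
    _ = _ := by
      rw [Real.rpow_neg zero_le_two]
      field_simp

lemma integrableOn_maxRatioIntegrand (hlam : 0 < lam) (hmu : 0 < mu) (hpow : 0 < pow)
    (hnoise : 0 ≤ noise) {b : ℝ} (hb : 0 < b) :
    IntegrableOn (maxRatioIntegrand T α mu lam pow noise b) (Ici 1) := by
  rw [integrableOn_Ici_iff_integrableOn_Ioi]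
  refine Integrable.mono' (integrableOn_Ioi_rpow_of_lt (a := -2) (by norm_num) one_pos)
    ((measurable_maxRatioIntegrand T α mu lam pow noise).comp
      (measurable_prodMk_left (x := b))).aestronglyMeasurable
    ((ae_restrict_iff' measurableSet_Ioi).2 (ae_of_all _ fun t ht => ?_))
  have ht1 : 1 ≤ t := le_of_lt ht
  have ht0 : 0 < t := one_pos.trans_le ht1
  rw [Real.norm_of_nonneg (maxRatioIntegrand_nonneg hb ht1),
    ← one_mul (t ^ (-2 : ℝ))]
  refine maxRatioIntegrand_le ht1 zero_le_one ?_
  refine (coverRatio_le hlam hmu hpow hnoise hb ht0).trans ?_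
  rw [one_mul]
  refine le_trans ?_ ht1
  rw [div_le_one (by positivity)]
  exact le_add_of_nonneg_right (by positivity)

lemma restrict_Ici_prod_Ici (a b : ℝ) : (volume : Measure (ℝ × ℝ)).restrict (Ici a ×ˢ Ici b) =
    (volume.restrict (Ioi a)).prod (volume.restrict (Ioi b)) := by
  rw [Measure.volume_eq_prod, ← Measure.prod_restrict, restrict_Ioi_eq_restrict_Ici,
    restrict_Ioi_eq_restrict_Ici]

lemma ae_prod_Ioi (a b : ℝ) :
    ∀ᵐ p ∂(volume.restrict (Ioi a)).prod (volume.restrict (Ioi b)), a < p.1 ∧ b < p.2 := by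
  rw [Measure.prod_restrict]
  exact ae_restrict_mem (measurableSet_Ioi.prod measurableSet_Ioi)

lemma integrableOn_maxRatioIntegrand_prod (hlam : 0 < lam) (hmu : 0 < mu) (hpow : 0 < pow)
    (hnoise : 0 ≤ noise) (hα : 1 ≤ α) :
    IntegrableOn (fun p : ℝ × ℝ => maxRatioIntegrand T α mu lam pow noise ((2 : ℝ) ^ p.1 - 1) p.2)
      (Ici 0 ×ˢ Ici 1) := by
  have hα0 : 0 < α := one_pos.trans_le hα
  have hexp : IntegrableOn (fun v : ℝ => (2 : ℝ) ^ (-(v / α))) (Ioi 0) := by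
    have hc : 0 < Real.log 2 / α := div_pos (Real.log_pos one_lt_two) hα0
    refine (exp_neg_integrableOn_Ioi 0 hc).congr_fun (fun v _ => ?_) measurableSet_Ioi
    simp only
    rw [Real.rpow_def_of_pos two_pos]
    congr 1
    ring
  rw [IntegrableOn, restrict_Ici_prod_Ici]
  have hdom := hexp.integrable.mul_prod
    (integrableOn_Ioi_rpow_of_lt (a := -2) (by norm_num) one_pos).integrable
  have hm : Measurable fun p : ℝ × ℝ => ((2 : ℝ) ^ p.1 - 1, p.2) := by fun_prop
  refine hdom.mono' ((measurable_maxRatioIntegrand T α mu lam pow noise).comp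
    hm).aestronglyMeasurable ?_
  filter_upwards [ae_prod_Ioi 0 1] with p hp
  rw [Real.norm_of_nonneg (maxRatioIntegrand_nonneg
    (sub_pos.2 (Real.one_lt_rpow one_lt_two hp.1)) hp.2.le)]
  exact maxRatioIntegrand_le hp.2.le (by positivity)
    (coverRatio_two_rpow_le hlam hmu hpow hnoise hα hp.1 hp.2.le)

lemma ofReal_integral_maxRatioIntegrand (hlam : 0 < lam) (hmu : 0 < mu) (hpow : 0 < pow)
    (hnoise : 0 ≤ noise) {b : ℝ} (hb : 0 < b) :
    ENNReal.ofReal (∫ t in Ici 1, maxRatioIntegrand T α mu lam pow noise b t) =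
      ∫⁻ t in Ici 1, ENNReal.ofReal (maxRatioIntegrand T α mu lam pow noise b t) :=
  ofReal_integral_eq_lintegral_ofReal (integrableOn_maxRatioIntegrand hlam hmu hpow hnoise hb)
    ((ae_restrict_iff' measurableSet_Ici).2
      (ae_of_all _ fun _ ht => maxRatioIntegrand_nonneg hb ht))

lemma ofReal_integral_integral_maxRatioIntegrand (hlam : 0 < lam) (hmu : 0 < mu) (hpow : 0 < pow)
    (hnoise : 0 ≤ noise) (hα : 1 ≤ α) :
    ENNReal.ofReal (∫ v in Ici (0 : ℝ), ∫ t in Ici (1 : ℝ),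
        maxRatioIntegrand T α mu lam pow noise ((2 : ℝ) ^ v - 1) t) =
      ∫⁻ v in Ioi (0 : ℝ), ∫⁻ t in Ici (1 : ℝ), ENNReal.ofReal
        (maxRatioIntegrand T α mu lam pow noise ((2 : ℝ) ^ v - 1) t) := by
  have hint := integrableOn_maxRatioIntegrand_prod (T := T) hlam hmu hpow hnoise hα
  rw [IntegrableOn, restrict_Ici_prod_Ici] at hint
  -- The null point v = 0 is dropped, since its threshold 2^v - 1 is not positive.
  rw [integral_Ici_eq_integral_Ioi, ofReal_integral_eq_lintegral_ofReal]
  · refine setLIntegral_congr_fun measurableSet_Ioi fun v hv => ?_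
    exact ofReal_integral_maxRatioIntegrand hlam hmu hpow hnoise
      (sub_pos.2 (Real.one_lt_rpow one_lt_two hv))
  · simp only [integral_Ici_eq_integral_Ioi]
    exact hint.integral_prod_left
  · refine (ae_restrict_iff' measurableSet_Ioi).2 (ae_of_all _ fun v hv => ?_)
    exact setIntegral_nonneg measurableSet_Ici fun t ht =>
      maxRatioIntegrand_nonneg (sub_pos.2 (Real.one_lt_rpow one_lt_two hv)) ht

end Integrand

/-! ### Coverage probability and rate of the policy -/

section Performance

lemma rateMetric_nonneg {x : ℝ} (hx : 0 ≤ x) : 0 ≤ rateMetric x :=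
  Real.logb_nonneg one_lt_two (le_add_of_nonneg_right hx)

lemma le_rateMetric_iff {v x : ℝ} (hx : 0 ≤ x) : v ≤ rateMetric x ↔ (2 : ℝ) ^ v - 1 ≤ x := by
  rw [rateMetric, Real.le_logb_iff_rpow_le one_lt_two (by positivity), sub_le_iff_le_add']

lemma achieved_eq_sum {Ω : Type*} {T : ℕ} {Φ : Fin T → Ω → Set Plane} {π : Ω → Fin T × ℕ}
    (hπ : IsMaxRatioPolicy Φ π) (H : Fin T → ℕ → Ω → ℝ) (α : ℝ) (pow noise : Fin T → ℝ)
    (p : Fin T → ℝ → ℝ) (ω : Ω) :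
    achieved Φ H α pow noise p π ω = ∑ i, {ω | (π ω).1 = i}.indicator
      (fun ω => p i (sinr (Φ i) (H i) α (pow i) (noise i) 0 ω)) ω := by
  rw [achieved, hπ.nearest, Finset.sum_eq_single (π ω).1]
  · rw [indicator_of_mem (by rfl)]
  · intro i _ hi
    exact indicator_of_notMem (s := {ω | (π ω).1 = i}) (fun h : (π ω).1 = i => hi h.symm) _
  · simp

/-- Exactly one technology is selected, so the metric is a sum over technologies. As each integral
in `[0, ∞]` is given as `ENNReal.ofReal` of a number, it is finite, which yields integrability
together with the value. -/
lemma IsMaxRatioPolicy.performance_eq_sum {Ω : Type*} [MeasurableSpace Ω] {P : Measure Ω} {T : ℕ}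
    {Φ : Fin T → Ω → Set Plane} {H : Fin T → ℕ → Ω → ℝ} {lam pow noise : Fin T → ℝ} {mu α : ℝ}
    {π : Ω → Fin T × ℕ} (hnet : IsPoissonNetwork P Φ H lam mu)
    (hπ : IsMaxRatioPolicy Φ π) (p : Fin T → ℝ → ℝ) (J : Fin T → ℝ) (hJ : ∀ i, 0 ≤ J i)
    (hp : ∀ i, AEMeasurable (fun ω => p i (sinr (Φ i) (H i) α (pow i) (noise i) 0 ω)) P)
    (hp0 : ∀ i, ∀ᵐ ω ∂P, 0 ≤ p i (sinr (Φ i) (H i) α (pow i) (noise i) 0 ω))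
    (h : ∀ i, ∫⁻ ω, ENNReal.ofReal ({ω | (π ω).1 = i}.indicator
      (fun ω => p i (sinr (Φ i) (H i) α (pow i) (noise i) 0 ω)) ω) ∂P = ENNReal.ofReal (J i)) :
    Integrable (achieved Φ H α pow noise p π) P ∧
      performance P Φ H α pow noise p π = ∑ i, J i := by
  have hi0 : ∀ i, 0 ≤ᵐ[P] {ω | (π ω).1 = i}.indicator
      (fun ω => p i (sinr (Φ i) (H i) α (pow i) (noise i) 0 ω)) := fun i => by
    filter_upwards [hp0 i] with ω hω
    exact indicator_apply_nonneg fun _ => hω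
  have him : ∀ i, AEStronglyMeasurable ({ω | (π ω).1 = i}.indicator
      (fun ω => p i (sinr (Φ i) (H i) α (pow i) (noise i) 0 ω))) P := fun i =>
    ((hp i).indicator (hπ.measurableSet_selected hnet i)).aestronglyMeasurable
  have hint : ∀ i, Integrable ({ω | (π ω).1 = i}.indicator
      (fun ω => p i (sinr (Φ i) (H i) α (pow i) (noise i) 0 ω))) P := fun i =>
    ⟨him i, by rw [hasFiniteIntegral_iff_ofReal (hi0 i), h i]; exact ENNReal.ofReal_lt_top⟩
  have hfun : achieved Φ H α pow noise p π = fun ω => ∑ i, {ω | (π ω).1 = i}.indicator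
      (fun ω => p i (sinr (Φ i) (H i) α (pow i) (noise i) 0 ω)) ω :=
    funext (achieved_eq_sum hπ H α pow noise p)
  rw [performance, hfun, integral_finsetSum _ fun i _ => hint i]
  refine ⟨integrable_finsetSum _ fun i _ => hint i, Finset.sum_congr rfl fun i _ => ?_⟩
  rw [integral_eq_lintegral_of_nonneg_ae (hi0 i) (him i), h i, ENNReal.toReal_ofReal (hJ i)]

variable {Ω : Type*} [MeasurableSpace Ω] {P : Measure Ω} [IsProbabilityMeasure P] {T : ℕ}
  {Φ : Fin T → Ω → Set Plane} {H : Fin T → ℕ → Ω → ℝ} {lam pow noise : Fin T → ℝ} {mu α : ℝ}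
  {π : Ω → Fin T × ℕ}

lemma IsMaxRatioPolicy.lintegral_coverageMetric (hnet : IsPoissonNetwork P Φ H lam mu)
    (hlam : ∀ j, 0 < lam j) (hπ : IsMaxRatioPolicy Φ π) (i : Fin T)
    (hmu : 0 < mu) (hα : 2 < α) (hpow : 0 < pow i) (hnoise : 0 ≤ noise i) {b : ℝ} (hb : 0 < b) :
    ∫⁻ ω, ENNReal.ofReal ({ω | (π ω).1 = i}.indicator
      (fun ω => coverageMetric b (sinr (Φ i) (H i) α (pow i) (noise i) 0 ω)) ω) ∂P =
    ENNReal.ofReal (2 * ∫ t in Ici 1,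
      maxRatioIntegrand T α mu (lam i) (pow i) (noise i) b t) := by
  rw [ENNReal.ofReal_mul zero_le_two, ENNReal.ofReal_ofNat,
    ofReal_integral_maxRatioIntegrand (hlam i) hmu hpow hnoise hb,
    ← hπ.lintegral_selected_coverEvent hnet hlam i hmu hα hpow hnoise hb]
  refine lintegral_congr_ae ?_
  filter_upwards [hnet.ae_coverageMetric_eq i (hlam i) hmu hα hpow hnoise hb] with ω hω
  by_cases h1 : ω ∈ {ω | (π ω).1 = i}
  · rw [indicator_of_mem h1, indicator_of_mem h1, hω]
    by_cases h2 : ω ∈ coverEvent (Φ i) (H i) α (pow i) (noise i) b <;> simp [h2]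
  · rw [indicator_of_notMem h1, indicator_of_notMem h1, zero_mul, ENNReal.ofReal_zero]

lemma IsPoissonNetwork.aemeasurable_rateMetric (hnet : IsPoissonNetwork P Φ H lam mu)
    (i : Fin T) (hlam : 0 < lam i) (hmu : 0 < mu) (hα : 2 < α) :
    AEMeasurable (fun ω => rateMetric (sinr (Φ i) (H i) α (pow i) (noise i) 0 ω)) P :=
  (Real.measurable_log.comp (measurable_const_add 1)).div_const _ |>.comp_aemeasurable
    (hnet.aemeasurable_sinr i hlam hmu hα)

/-- The layer-cake formula: the rate is at least v exactly when the SINR is at least 2^v - 1, so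
each layer is a coverage probability. -/
lemma IsMaxRatioPolicy.lintegral_rateMetric (hnet : IsPoissonNetwork P Φ H lam mu)
    (hlam : ∀ j, 0 < lam j) (hπ : IsMaxRatioPolicy Φ π) (i : Fin T)
    (hmu : 0 < mu) (hα : 2 < α) (hpow : 0 < pow i) (hnoise : 0 ≤ noise i) :
    ∫⁻ ω, ENNReal.ofReal ({ω | (π ω).1 = i}.indicator
      (fun ω => rateMetric (sinr (Φ i) (H i) α (pow i) (noise i) 0 ω)) ω) ∂P =
    ENNReal.ofReal (2 * ∫ v in Ici (0 : ℝ), ∫ t in Ici (1 : ℝ),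
      maxRatioIntegrand T α mu (lam i) (pow i) (noise i) ((2 : ℝ) ^ v - 1) t) := by
  have hsel := hπ.measurableSet_selected hnet i
  have hS := hnet.ae_le_sinr_iff i (hlam i) hmu hα hpow hnoise
  rw [ENNReal.ofReal_mul zero_le_two, ENNReal.ofReal_ofNat,
    ofReal_integral_integral_maxRatioIntegrand (hlam i) hmu hpow hnoise
      (one_le_two.trans hα.le), ← lintegral_const_mul' _ _ ENNReal.ofNat_ne_top,
    lintegral_eq_lintegral_meas_le P ?_
      ((hnet.aemeasurable_rateMetric i (hlam i) hmu hα).indicator hsel)]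
  · refine setLIntegral_congr_fun measurableSet_Ioi fun v hv => ?_
    have hv : 0 < v := hv
    have hb : 0 < (2 : ℝ) ^ v - 1 := sub_pos.2 (Real.one_lt_rpow one_lt_two hv)
    have hcov := measurableSet_coverEvent (hnet.poisson i).measurable_nthDist
      (hnet.measurable_fading i) α (pow i) (noise i) ((2 : ℝ) ^ v - 1)
    rw [← hπ.lintegral_selected_coverEvent hnet hlam i hmu hα hpow hnoise hb]
    have hprod : ∀ ω, {ω | (π ω).1 = i}.indicator (1 : Ω → ℝ≥0∞) ω *
        (coverEvent (Φ i) (H i) α (pow i) (noise i) ((2 : ℝ) ^ v - 1)).indicator 1 ω =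
        ({ω | (π ω).1 = i} ∩ coverEvent (Φ i) (H i) α (pow i) (noise i)
          ((2 : ℝ) ^ v - 1)).indicator 1 ω := fun ω => by
      rw [inter_indicator_one, Pi.mul_apply]
    simp_rw [hprod]
    rw [lintegral_indicator_one (hsel.inter hcov)]
    refine measure_congr ?_
    filter_upwards [hS] with ω hω
    refine propext ?_
    change v ≤ {ω | (π ω).1 = i}.indicator _ ω ↔ ω ∈ {ω | (π ω).1 = i} ∩ _
    by_cases h1 : ω ∈ {ω | (π ω).1 = i}
    · rw [indicator_of_mem h1, le_rateMetric_iff hω.1, hω.2 _ hb]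
      exact ⟨fun h => ⟨h1, h⟩, fun h => h.2⟩
    · rw [indicator_of_notMem h1]
      -- When i is not selected the variable is 0, which does not reach the level v > 0.
      exact ⟨fun h => absurd h hv.not_ge, fun h => absurd h.1 h1⟩
  · filter_upwards [hS] with ω hω
    exact indicator_apply_nonneg fun _ => rateMetric_nonneg hω.1

end Performance

end MaxRatio

end

/-! ### Assembly of the statements -/

theorem mainTheorem6 {Ω : Type*} [MeasurableSpace Ω] (P : Measure Ω) [IsProbabilityMeasure P]
    (T : ℕ) (Φ : Fin T → Ω → Set MaxRatio.Plane) (H : Fin T → ℕ → Ω → ℝ)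
    (lam pow noise β : Fin T → ℝ) (mu α : ℝ)
    (hlam : ∀ i, 0 < lam i) (hpow : ∀ i, 0 < pow i) (hnoise : ∀ i, 0 ≤ noise i)
    (hβ : ∀ i, 0 < β i) (hmu : 0 < mu) (hα : 2 < α)
    (hnet : MaxRatio.IsPoissonNetwork P Φ H lam mu)
    (π : Ω → Fin T × ℕ) (hπ : MaxRatio.IsMaxRatioPolicy Φ π) :
    -- the interference sums converge almost surely
    (∀ i, ∀ᵐ ω ∂P, Summable (fun k => MaxRatio.receivedPower (Φ i) (H i) α (pow i) k ω)) ∧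
    -- conditional coverage probability of the nearest base station given the two distances
    (∀ i, ∀ b : ℝ, 0 < b →
      condExp (MeasurableSpace.comap
          (fun ω => (MaxRatio.nthDist (Φ i) 0 ω, MaxRatio.nthDist (Φ i) 1 ω)) inferInstance) P
        (fun ω => MaxRatio.coverageMetric b
          (MaxRatio.sinr (Φ i) (H i) α (pow i) (noise i) 0 ω))
      =ᵐ[P] fun ω => MaxRatio.coverTwo α mu (lam i) (pow i) (noise i) b
          (MaxRatio.nthDist (Φ i) 0 ω) (MaxRatio.nthDist (Φ i) 1 ω)) ∧
    -- conditional density of the nearest distance given the ratio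
    (∀ i, ∀ᵐ t ∂(P.map (MaxRatio.ratio (Φ i))),
      condDistrib (MaxRatio.nthDist (Φ i) 0) (MaxRatio.ratio (Φ i)) P t =
        (volume.restrict (Ioi (0 : ℝ))).withDensity
          (fun u => ENNReal.ofReal (MaxRatio.nearestDensity (lam i) t u))) ∧
    -- conditional coverage probability of the nearest base station given the ratio
    (∀ i, ∀ b : ℝ, 0 < b →
      condExp (MeasurableSpace.comap (MaxRatio.ratio (Φ i)) inferInstance) P
        (fun ω => MaxRatio.coverageMetric b
          (MaxRatio.sinr (Φ i) (H i) α (pow i) (noise i) 0 ω))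
      =ᵐ[P] fun ω => MaxRatio.coverRatio α mu (lam i) (pow i) (noise i) b
          (MaxRatio.ratio (Φ i) ω)) ∧
    -- coverage probability of the max-ratio policy
    (∀ i, IntegrableOn (MaxRatio.maxRatioIntegrand T α mu (lam i) (pow i) (noise i) (β i))
      (Ici 1)) ∧
    MaxRatio.performance P Φ H α pow noise (fun i => MaxRatio.coverageMetric (β i)) π =
      2 * ∑ i, ∫ t in Ici (1 : ℝ),
        MaxRatio.maxRatioIntegrand T α mu (lam i) (pow i) (noise i) (β i) t ∧
    -- average achievable rate of the max-ratio policy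
    Integrable (MaxRatio.achieved Φ H α pow noise (fun _ => MaxRatio.rateMetric) π) P ∧
    (∀ i, IntegrableOn
      (fun vt : ℝ × ℝ => MaxRatio.maxRatioIntegrand T α mu (lam i) (pow i) (noise i)
        ((2 : ℝ) ^ vt.1 - 1) vt.2) (Ici 0 ×ˢ Ici 1)) ∧
    MaxRatio.performance P Φ H α pow noise (fun _ => MaxRatio.rateMetric) π =
      2 * ∑ i, ∫ v in Ici (0 : ℝ), ∫ t in Ici (1 : ℝ),
        MaxRatio.maxRatioIntegrand T α mu (lam i) (pow i) (noise i) ((2 : ℝ) ^ v - 1) t := by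
  have hsinr : ∀ i, ∀ᵐ ω ∂P, 0 ≤ MaxRatio.sinr (Φ i) (H i) α (pow i) (noise i) 0 ω := fun i => by
    filter_upwards [hnet.ae_le_sinr_iff i (hlam i) hmu hα (hpow i) (hnoise i)] with ω hω
      using hω.1
  have hα1 : 1 ≤ α := one_le_two.trans hα.le
  obtain ⟨-, hcov⟩ := hπ.performance_eq_sum hnet (fun i => MaxRatio.coverageMetric (β i))
    (fun i => 2 * ∫ t in Ici (1 : ℝ),
      MaxRatio.maxRatioIntegrand T α mu (lam i) (pow i) (noise i) (β i) t)
    (fun i => mul_nonneg zero_le_two (setIntegral_nonneg measurableSet_Ici fun _ ht =>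
      MaxRatio.maxRatioIntegrand_nonneg (hβ i) ht))
    (fun i => (measurable_const.indicator measurableSet_Ici).comp_aemeasurable
      (hnet.aemeasurable_sinr i (hlam i) hmu hα))
    (fun i => Filter.Eventually.of_forall fun _ => indicator_nonneg (fun _ _ => zero_le_one) _)
    (fun i => hπ.lintegral_coverageMetric hnet hlam i hmu hα (hpow i) (hnoise i) (hβ i))
  obtain ⟨hint, hrate⟩ := hπ.performance_eq_sum hnet (fun _ => MaxRatio.rateMetric)
    (fun i => 2 * ∫ v in Ici (0 : ℝ), ∫ t in Ici (1 : ℝ),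
      MaxRatio.maxRatioIntegrand T α mu (lam i) (pow i) (noise i) ((2 : ℝ) ^ v - 1) t)
    (fun i => mul_nonneg zero_le_two (by
      rw [integral_Ici_eq_integral_Ioi]
      exact setIntegral_nonneg measurableSet_Ioi fun v hv =>
        setIntegral_nonneg measurableSet_Ici fun t ht => MaxRatio.maxRatioIntegrand_nonneg
          (sub_pos.2 (Real.one_lt_rpow one_lt_two hv)) ht))
    (fun i => hnet.aemeasurable_rateMetric i (hlam i) hmu hα)
    (fun i => (hsinr i).mono fun _ h => MaxRatio.rateMetric_nonneg h)
    (fun i => hπ.lintegral_rateMetric hnet hlam i hmu hα (hpow i) (hnoise i))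
  exact ⟨fun i => hnet.ae_summable_receivedPower i (hlam i) hmu hα,
    fun i b hb => hnet.condExp_coverageMetric i (hlam i) hmu hα (hpow i) (hnoise i) hb,
    fun i => (hnet.poisson i).condDistrib_nthDist_ratio (hlam i),
    fun i b hb => hnet.condExp_coverageMetric_ratio i (hlam i) hmu hα (hpow i) (hnoise i) hb,
    fun i => MaxRatio.integrableOn_maxRatioIntegrand (hlam i) hmu (hpow i) (hnoise i) (hβ i),
    hcov.trans (Finset.mul_sum _ _ _).symm, hint,
    fun i => MaxRatio.integrableOn_maxRatioIntegrand_prod (hlam i) hmu (hpow i) (hnoise i) hα1,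
    hrate.trans (Finset.mul_sum _ _ _).symm⟩
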